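/- **Data.** Let $l>0$, let $\lambda_j,\mu_j$ ($j=1$: upper, $j=2$: lower half-plane) be Lamé moduli with $\mu_j>0$, $\lambda_j+\mu_j>0$, let $\gamma_0^{\pm},\gamma_1^{\pm},\gamma_0^i,\gamma_1^i,\sigma,\tau\in\mathbb R$, and put $$\alpha_j=\frac{2\mu_j^2}{\lambda_j+3\mu_j},\qquad \beta_j=\frac{2\mu_j(\lambda_j+2\mu_j)}{(\lambda_j+3\mu_j)\pi},\qquad \Delta=\alpha_1-\alpha_2,\qquad \kappa=\beta_1\alpha_2+\beta_2\alpha_1 .$$ Let $f^\pm,g^\pm$ be real functions on $|x|<l$ such that $\int_{|r|<l}\frac{g^\pm(r)\,dr}{r-x}$ exists for all $|x|<l$. Integrals with kernel $1/(r-x)$ are principal values: they exist if they converge absolutely away from $x$ and the symmetric limit at $x$ exists. Write $$S\varphi_k(x)=\int_{|r|<l}\frac{\varphi_k(r)\,dr}{r-x}\ (k=1,2),\qquad S\varphi(x)=\int_{|r|>l}\frac{\varphi(r)\,dr}{r-x},$$ similarly for $\psi_k,\psi$, their derivatives and $g^\pm$, and $$L\psi_k(x)=\int_{|r|<l}\ln\left|\frac{(l-x)(l+r)}{(l+x)(l-r)}\right|\frac{\psi_k(r)\,dr}{r-x},\qquad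 L\psi(x)=\int_{|r|>l}\ln\left|\frac{(l-x)(l+r)}{(l+x)(l-r)}\right|\frac{\psi(r)\,dr}{r-x}.$$ **1. Six singular equations.** Let $\varphi_1,\varphi_2,\psi_1,\psi_2$ be functions on $|x|<l$ and $\varphi,\psi$ functions on $|x|>l$. Let $p^+$ be $\varphi_1$ on $|x|<l$ and $\varphi$ on $|x|>l$, let $p^-$ be $\varphi_2$ and $\varphi$, $q^+$ be $\psi_1$ and $\psi$, $q^-$ be $\psi_2$ and $\psi$ (the boundary values of $u_{1,1}^\pm$, $u_{2,1}^\pm$). Let the boundary stresses be given by the half-plane Dirichlet-to-Neumann maps $$\sigma_{12}^+=\alpha_1q^++\beta_1\int_{-\infty}^\infty\frac{p^+(r)\,dr}{r-x},\quad \sigma_{22}^+=-\alpha_1p^++\beta_1\int_{-\infty}^\infty\frac{q^+(r)\,dr}{r-x},$$ $$\sigma_{12}^-=\alpha_2q^--\beta_2\int_{-\infty}^\infty\frac{p^-(r)\,dr}{r-x},\quad \sigma_{22}^-=-\alpha_2p^--\beta_2\int_{-\infty}^\infty\frac{q^-(r)\,dr}{r-x}.$$ Then the boundary conditions $$\sigma_{12}^{+}+\tau=\gamma_1^+(q^+)''+f^+,\quad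 \sigma_{22}^{+}+\sigma=-\gamma_0^+(q^+)'+g^+,\quad \sigma_{12}^{-}+\tau=-\gamma_1^-(q^-)''+f^-,\quad \sigma_{22}^{-}+\sigma=\gamma_0^-(q^-)'+g^-\quad(|x|<l),$$ $$\sigma_{12}^+-\sigma_{12}^-=\gamma_1^i(q^+)'',\quad \sigma_{22}^+-\sigma_{22}^-=-\gamma_0^i(q^+)'\quad(|x|>l),$$ with all integrals existing for $|x|\ne l$, hold if and only if the following system holds, with all integrals existing for $|x|\neq l$: $$\alpha_1\psi_1+\beta_1S\varphi_1+\beta_1S\varphi+\tau=\gamma_1^+\psi_1''+f^+,\qquad -\alpha_1\varphi_1+\beta_1S\psi_1+\beta_1S\psi+\sigma=-\gamma_0^+\psi_1'+g^+\quad(|x|<l),$$ $$\alpha_2\psi_2-\beta_2S\varphi_2-\beta_2S\varphi+\tau=-\gamma_1^-\psi_2''+f^-,\qquad -\alpha_2\varphi_2-\beta_2S\psi_2-\beta_2S\psi+\sigma=\gamma_0^-\psi_2'+g^-\quad(|x|<l),\tag{A}$$ $$\Delta\psi+\beta_1S\varphi_1+\beta_2S\varphi_2+(\beta_1+\beta_2)S\varphi=\gamma_1^i\psi'',\qquad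 -\Delta\varphi+\beta_1S\psi_1+\beta_2S\psi_2+(\beta_1+\beta_2)S\psi=-\gamma_0^i\psi'\quad(|x|>l).$$ From now on let $\alpha_1\ne\alpha_2$ and write $\chi_1=\psi_1''$, $\chi_2=\psi_2''$, $\chi=\psi''$. Call $(\psi_1,\psi_2,\psi)$ *admissible* if $\psi_1,\psi_2,\psi$ are $C^2$ on the open sets $|x|<l$, $|x|<l$, $|x|>l$ respectively, each of $\chi_1,\chi_2,\chi$ is integrable on its set with weight $(1+|x|)^{1+\delta}$ for some $\delta>0$, and $\psi(x)\to0$ as $|x|\to\infty$. Call $(\chi_1,\chi_2,\chi)$ an *admissible density* if the functions are continuous on these sets and integrable there with such a weight. **2. Elimination of $\varphi_1,\varphi_2,\varphi$.** If $(\psi_1,\psi_2,\psi)$ is admissible, then (A) holds if and only if $$\varphi_1=\tfrac1{\alpha_1}\bigl(\beta_1S\psi_1+\beta_1S\psi+\sigma+\gamma_0^+\psi_1'-g^+\bigr),\qquad \varphi_2=\tfrac1{\alpha_2}\bigl(-\beta_2S\psi_2-\beta_2S\psi+\sigma-\gamma_0^-\psi_2'-g^-\bigr),$$ $$\varphi=\tfrac1{\Delta}\bigl(\beta_1S\psi_1+\beta_2S\psi_2+(\beta_1+\beta_2)S\psi+\gamma_0^i\psi'\bigr)$$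 on the respective sets and $\psi_1,\psi_2,\psi$ satisfy the system of three equations (all $S\psi_k'$, $S\psi'$ existing and all $L\psi_k$, $L\psi$ converging absolutely for $|x|\ne l$) $$-\gamma_1^+\psi_1''+\alpha_1\Bigl(1-\tfrac{\beta_1^2\pi^2}{\alpha_1^2}\Bigr)\psi_1+\tfrac{\gamma_0^+\beta_1}{\alpha_1}S\psi_1'+\tfrac{\gamma_0^i\beta_1}{\Delta}S\psi'-\tfrac{\beta_1^2\alpha_2}{\alpha_1\Delta}L\psi_1-\tfrac{\beta_1\beta_2}{\Delta}L\psi_2-\tfrac{\beta_1\kappa}{\alpha_1\Delta}L\psi=\tfrac{\beta_1}{\alpha_1}Sg^++f^+-\sigma\tfrac{\beta_1}{\alpha_1}\ln\left|\tfrac{l-x}{l+x}\right|-\tau\quad(|x|<l),$$ $$\gamma_1^-\psi_2''+\alpha_2\Bigl(1-\tfrac{\beta_2^2\pi^2}{\alpha_2^2}\Bigr)\psi_2+\tfrac{\gamma_0^-\beta_2}{\alpha_2}S\psi_2'-\tfrac{\gamma_0^i\beta_2}{\Delta}S\psi'+\tfrac{\beta_1\beta_2}{\Delta}L\psi_1+\tfrac{\beta_2^2\alpha_1}{\alpha_2\Delta}L\psi_2+\tfrac{\beta_2\kappa}{\alpha_2\Delta}L\psi=-\tfrac{\beta_2}{\alpha_2}Sg^-+f^-+\sigma\tfrac{\beta_2}{\alpha_2}\ln\left|\tfrac{l-x}{l+x}\right|-\tau\quad(|x|<l),\tag{B}$$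 $$-\gamma_1^i\psi''+\Delta\Bigl(1-\tfrac{(\beta_1+\beta_2)^2\pi^2}{\Delta^2}\Bigr)\psi+\tfrac{\gamma_0^+\beta_1}{\alpha_1}S\psi_1'-\tfrac{\gamma_0^-\beta_2}{\alpha_2}S\psi_2'+\tfrac{\gamma_0^i(\beta_1+\beta_2)}{\Delta}S\psi'-\tfrac{\beta_1\kappa}{\alpha_1\Delta}L\psi_1-\tfrac{\beta_2\kappa}{\alpha_2\Delta}L\psi_2-\tfrac{\kappa^2}{\alpha_1\alpha_2\Delta}L\psi$$ $$=\tfrac{\beta_1}{\alpha_1}Sg^++\tfrac{\beta_2}{\alpha_2}Sg^--\sigma\Bigl(\tfrac{\beta_1}{\alpha_1}+\tfrac{\beta_2}{\alpha_2}\Bigr)\ln\left|\tfrac{l-x}{l+x}\right|\quad(|x|>l).$$ **3. Change of unknowns.** The relations $\chi_k=\psi_k''$, $\chi=\psi''$ and $$\psi_1'(x)=\int_{-l}^x\chi_1\,dr+C_1,\quad \psi_1(x)=\int_{-l}^x(x-r)\chi_1(r)\,dr+C_1x+C_2,\quad \psi_2'(x)=\int_{-l}^x\chi_2\,dr+C_3,\quad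 \psi_2(x)=\int_{-l}^x(x-r)\chi_2(r)\,dr+C_3x+C_4,$$ $$\psi'(x)=\int_{-\infty}^x\chi\,dr,\ \ \psi(x)=\int_{-\infty}^x(x-r)\chi(r)\,dr\ (x<-l),\qquad \psi'(x)=-\int_x^\infty\chi\,dr,\ \ \psi(x)=-\int_x^\infty(x-r)\chi(r)\,dr\ (x>l)$$ put the admissible $(\psi_1,\psi_2,\psi)$ in one-to-one correspondence with the pairs of an admissible density $(\chi_1,\chi_2,\chi)$ and constants $(C_1,\dots,C_4)\in\mathbb R^4$. **4. Fredholm system.** Put $D_1=D_2=(-l,l)$, $D_3=\{|x|>l\}$, $\chi_3=\chi$, $(a_1,a_2,a_3)=(-\gamma_1^+,\gamma_1^-,-\gamma_1^i)$. Let $\omega_0(s,r)$ be the kernel for which item 3 reads $\psi_k'(r)=\int_{D_k}\omega_0(s,r)\chi_k(s)\,ds+\text{const}$, that is, $1$ for $s\le r$ and $0$ otherwise if $k=1,2$, and for $k=3$: $1$ if $s<r<-l$, $-1$ if $l<r<s$, $0$ otherwise; let $\omega_1(s,r)=(r-s)\omega_0(s,r)$. Let $d_j,c_{jk},m_{jk}$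 be the coefficients of $\psi_j$, $S\psi_k'$, $L\psi_k$ in the $j$-th equation of (B) (with $\psi_3=\psi$), $F_j$ its right-hand side, and $$K_{jk}(x,s)=\delta_{jk}d_j\,\omega_1(s,x)+c_{jk}A(x,s)+m_{jk}\,\bigl(L\,\omega_1(s,\cdot)\bigr)(x),$$ where $L$ is the operator on $D_k$ and $A(x,s)=\ln\left|\frac{l-x}{s-x}\right|$ for $s>-l$, $A(x,s)=\ln\left|\frac{l+x}{s-x}\right|$ for $s<-l$. Then, under the correspondence of item 3, (B) holds if and only if $$a_j\chi_j(x)+\sum_{k=1}^3\int_{D_k}K_{jk}(x,s)\chi_k(s)\,ds=F_j(x)-G_j(x),\qquad x\in D_j,\ j=1,2,3,$$ with all integrals absolutely convergent, where, with $\rho_1(x)=C_1x+C_2$, $\rho_2(x)=C_3x+C_4$, $\rho_3=0$, $$G_j(x)=d_j\,\rho_j(x)+(c_{j1}C_1+c_{j2}C_3)\ln\left|\tfrac{l-x}{l+x}\right|+m_{j1}(L\rho_1)(x)+m_{j2}(L\rho_2)(x).$$ This is a system of Fredholm integral equations (of the second kind when $\gamma_1^\pm,\gamma_1^i\neq0$):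 each $K_{jk}$ is measurable, and for every $R>0$ there is a constant $c$ with $$|K_{jk}(x,s)|\le c\,\bigl(1+|\ln|x-s||+\ln^2\bigl||x|-l\bigr|\bigr),\qquad x\in D_j,\ s\in D_k,\ |x|,|s|\le R,\ x\ne s,$$ and $K_{jk}$ is square integrable on $(D_j\cap[-R,R])\times(D_k\cap[-R,R])$. -/

import Mathlib

open Set Filter Topology MeasureTheory

noncomputable section

/-! # Interface crack between two half-planes with curvature-dependent surface tension -/

namespace InterfaceCrack

/-! ## Principal values -/

/-- The Cauchy integral `∫_D f(r) / (r - x) dr` exists: it converges absolutely away from `x`,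
and the symmetric limit at `x` exists. If `x` is not in the closure of `D`, this is ordinary
absolute convergence. -/
def PVExists (D : Set ℝ) (f : ℝ → ℝ) (x : ℝ) : Prop :=
  (∀ ε : ℝ, 0 < ε → IntegrableOn (fun r => f r / (r - x)) (D \ Ioo (x - ε) (x + ε))) ∧
  ∃ I : ℝ, Tendsto (fun ε : ℝ => ∫ r in D \ Ioo (x - ε) (x + ε), f r / (r - x))
    (𝓝[>] 0) (𝓝 I)

/-- The principal value `∫_D f(r) / (r - x) dr`; meaningful under `PVExists D f x`. -/
def pv (D : Set ℝ) (f : ℝ → ℝ) (x : ℝ) : ℝ :=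
  limUnder (𝓝[>] (0 : ℝ)) (fun ε : ℝ => ∫ r in D \ Ioo (x - ε) (x + ε), f r / (r - x))

/-! ## Data of the problem -/

/-- The crack `|x| < l`. -/
def crack (l : ℝ) : Set ℝ := {x | |x| < l}

/-- The bonded part `|x| > l` of the interface. -/
def bonded (l : ℝ) : Set ℝ := {x | l < |x|}

/-- Unknowns are families indexed by `Fin 3`: `0` is the upper bank of the crack (index 1 in
`φ₁, ψ₁, χ₁`), `1` the lower bank (`φ₂, ψ₂, χ₂`), `2` the bonded interface (`φ, ψ, χ`). -/
def dom (l : ℝ) : Fin 3 → Set ℝ := ![crack l, crack l, bonded l]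

/-- Half-length of the crack, Lamé moduli of the upper (`₁`) and the lower (`₂`) half-plane,
surface tension constants on the upper bank (`p`), the lower bank (`m`) and the bonded interface
(`i`), stresses `σ, τ` at infinity, tractions on the two banks of the crack. -/
structure Problem where
  l : ℝ
  lam₁ : ℝ
  mu₁ : ℝ
  lam₂ : ℝ
  mu₂ : ℝ
  γ₀p : ℝ
  γ₁p : ℝ
  γ₀m : ℝ
  γ₁m : ℝ
  γ₀i : ℝ
  γ₁i : ℝ
  σ : ℝ
  τ : ℝ
  fp : ℝ → ℝ
  fm : ℝ → ℝ
  gp : ℝ → ℝ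
  gm : ℝ → ℝ

namespace Problem

variable (P : Problem)

def α₁ : ℝ := 2 * P.mu₁ ^ 2 / (P.lam₁ + 3 * P.mu₁)
def α₂ : ℝ := 2 * P.mu₂ ^ 2 / (P.lam₂ + 3 * P.mu₂)
def β₁ : ℝ := 2 * P.mu₁ * (P.lam₁ + 2 * P.mu₁) / ((P.lam₁ + 3 * P.mu₁) * Real.pi)
def β₂ : ℝ := 2 * P.mu₂ * (P.lam₂ + 2 * P.mu₂) / ((P.lam₂ + 3 * P.mu₂) * Real.pi)

/-! ## Dirichlet-to-Neumann maps and boundary conditions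

`p` and `q` are the boundary values of `u_{1,1}` and `u_{2,1}` on the whole real line. -/

/-- `σ₁₂` on the boundary of the upper half-plane. -/
def shearUpper (p q : ℝ → ℝ) (x : ℝ) : ℝ := P.α₁ * q x + P.β₁ * pv univ p x
/-- `σ₂₂` on the boundary of the upper half-plane. -/
def normalUpper (p q : ℝ → ℝ) (x : ℝ) : ℝ := -P.α₁ * p x + P.β₁ * pv univ q x
/-- `σ₁₂` on the boundary of the lower half-plane. -/
def shearLower (p q : ℝ → ℝ) (x : ℝ) : ℝ := P.α₂ * q x - P.β₂ * pv univ p x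
/-- `σ₂₂` on the boundary of the lower half-plane. -/
def normalLower (p q : ℝ → ℝ) (x : ℝ) : ℝ := -P.α₂ * p x - P.β₂ * pv univ q x

open Classical in
/-- Boundary value on the whole line which is `v` on the crack and `w` on the bonded interface. -/
def glue (v w : ℝ → ℝ) : ℝ → ℝ := fun x => if |x| < P.l then v x else w x

/-- The boundary conditions with surface tension on the two banks of the crack and on the bonded
interface, for the fields left after the homogeneous far field is separated, the stresses being
given by the Dirichlet-to-Neumann maps. Both half-planes share `φ 2`, `ψ 2` on the bonded
interface (perfect bonding). -/
def BoundaryConditions (φ ψ : Fin 3 → ℝ → ℝ) : Prop :=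
  let pU := P.glue (φ 0) (φ 2)
  let pL := P.glue (φ 1) (φ 2)
  let qU := P.glue (ψ 0) (ψ 2)
  let qL := P.glue (ψ 1) (ψ 2)
  (∀ x, |x| ≠ P.l →
    PVExists univ pU x ∧ PVExists univ pL x ∧ PVExists univ qU x ∧ PVExists univ qL x) ∧
  (∀ x ∈ crack P.l,
    P.shearUpper pU qU x + P.τ = P.γ₁p * deriv (deriv qU) x + P.fp x ∧
    P.normalUpper pU qU x + P.σ = -P.γ₀p * deriv qU x + P.gp x ∧
    P.shearLower pL qL x + P.τ = -P.γ₁m * deriv (deriv qL) x + P.fm x ∧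
    P.normalLower pL qL x + P.σ = P.γ₀m * deriv qL x + P.gm x) ∧
  (∀ x ∈ bonded P.l,
    P.shearUpper pU qU x - P.shearLower pL qL x = P.γ₁i * deriv (deriv qU) x ∧
    P.normalUpper pU qU x - P.normalLower pL qL x = -P.γ₀i * deriv qU x)

/-! ## The six singular integro-differential equations -/

def SingularSystem (φ ψ : Fin 3 → ℝ → ℝ) : Prop :=
  let C := crack P.l
  let B := bonded P.l
  (∀ x, |x| ≠ P.l → ∀ k, PVExists (dom P.l k) (φ k) x ∧ PVExists (dom P.l k) (ψ k) x) ∧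
  (∀ x ∈ C,
    P.α₁ * ψ 0 x + P.β₁ * pv C (φ 0) x + P.β₁ * pv B (φ 2) x + P.τ
      = P.γ₁p * deriv (deriv (ψ 0)) x + P.fp x ∧
    -P.α₁ * φ 0 x + P.β₁ * pv C (ψ 0) x + P.β₁ * pv B (ψ 2) x + P.σ
      = -P.γ₀p * deriv (ψ 0) x + P.gp x ∧
    P.α₂ * ψ 1 x - P.β₂ * pv C (φ 1) x - P.β₂ * pv B (φ 2) x + P.τ
      = -P.γ₁m * deriv (deriv (ψ 1)) x + P.fm x ∧
    -P.α₂ * φ 1 x - P.β₂ * pv C (ψ 1) x - P.β₂ * pv B (ψ 2) x + P.σ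
      = P.γ₀m * deriv (ψ 1) x + P.gm x) ∧
  (∀ x ∈ B,
    (P.α₁ - P.α₂) * ψ 2 x + P.β₁ * pv C (φ 0) x + P.β₂ * pv C (φ 1) x
        + (P.β₁ + P.β₂) * pv B (φ 2) x
      = P.γ₁i * deriv (deriv (ψ 2)) x ∧
    -(P.α₁ - P.α₂) * φ 2 x + P.β₁ * pv C (ψ 0) x + P.β₂ * pv C (ψ 1) x
        + (P.β₁ + P.β₂) * pv B (ψ 2) x
      = -P.γ₀i * deriv (ψ 2) x)

/-- The functions `φ₁, φ₂, φ` expressed through `ψ₁, ψ₂, ψ`. -/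
def phiOf (ψ : Fin 3 → ℝ → ℝ) : Fin 3 → ℝ → ℝ :=
  ![fun x => (P.β₁ * pv (crack P.l) (ψ 0) x + P.β₁ * pv (bonded P.l) (ψ 2) x + P.σ
        + P.γ₀p * deriv (ψ 0) x - P.gp x) / P.α₁,
    fun x => (-P.β₂ * pv (crack P.l) (ψ 1) x - P.β₂ * pv (bonded P.l) (ψ 2) x + P.σ
        - P.γ₀m * deriv (ψ 1) x - P.gm x) / P.α₂,
    fun x => (P.β₁ * pv (crack P.l) (ψ 0) x + P.β₂ * pv (crack P.l) (ψ 1) x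
        + (P.β₁ + P.β₂) * pv (bonded P.l) (ψ 2) x + P.γ₀i * deriv (ψ 2) x) / (P.α₁ - P.α₂)]

/-! ## The three integro-differential equations with logarithmic kernels -/

/-- `ln |(l - x) / (l + x)|`. -/
def tipLog (x : ℝ) : ℝ := Real.log |(P.l - x) / (P.l + x)|

/-- The kernel `ln |(l - x)(l + r) / ((l + x)(l - r))| / (r - x)`, with a removable singularity at
`r = x`. -/
def logKernel (x r : ℝ) : ℝ :=
  Real.log |(P.l - x) * (P.l + r) / ((P.l + x) * (P.l - r))| / (r - x)

/-- `∫_{D_k} logKernel(x, r) f(r) dr`. -/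
def logInt (k : Fin 3) (f : ℝ → ℝ) (x : ℝ) : ℝ :=
  ∫ r in dom P.l k, P.logKernel x r * f r

/-- Right-hand sides. -/
def rhs : Fin 3 → ℝ → ℝ :=
  ![fun x => P.β₁ / P.α₁ * pv (crack P.l) P.gp x + P.fp x
        - P.σ * (P.β₁ / P.α₁) * P.tipLog x - P.τ,
    fun x => -(P.β₂ / P.α₂) * pv (crack P.l) P.gm x + P.fm x
        + P.σ * (P.β₂ / P.α₂) * P.tipLog x - P.τ,
    fun x => P.β₁ / P.α₁ * pv (crack P.l) P.gp x + P.β₂ / P.α₂ * pv (crack P.l) P.gm x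
        - P.σ * (P.β₁ / P.α₁ + P.β₂ / P.α₂) * P.tipLog x]

def LogSystem (ψ : Fin 3 → ℝ → ℝ) : Prop :=
  let C := crack P.l
  let B := bonded P.l
  let Δ := P.α₁ - P.α₂
  let κ := P.β₁ * P.α₂ + P.β₂ * P.α₁
  (∀ x, |x| ≠ P.l → ∀ k, PVExists (dom P.l k) (deriv (ψ k)) x ∧
    IntegrableOn (fun r => P.logKernel x r * ψ k r) (dom P.l k)) ∧
  (∀ x ∈ C,
    -P.γ₁p * deriv (deriv (ψ 0)) x
        + P.α₁ * (1 - P.β₁ ^ 2 * Real.pi ^ 2 / P.α₁ ^ 2) * ψ 0 x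
        + P.γ₀p * P.β₁ / P.α₁ * pv C (deriv (ψ 0)) x
        + P.γ₀i * P.β₁ / Δ * pv B (deriv (ψ 2)) x
        - P.β₁ ^ 2 * P.α₂ / (P.α₁ * Δ) * P.logInt 0 (ψ 0) x
        - P.β₁ * P.β₂ / Δ * P.logInt 1 (ψ 1) x
        - P.β₁ * κ / (P.α₁ * Δ) * P.logInt 2 (ψ 2) x
      = P.rhs 0 x ∧
    P.γ₁m * deriv (deriv (ψ 1)) x
        + P.α₂ * (1 - P.β₂ ^ 2 * Real.pi ^ 2 / P.α₂ ^ 2) * ψ 1 x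
        + P.γ₀m * P.β₂ / P.α₂ * pv C (deriv (ψ 1)) x
        - P.γ₀i * P.β₂ / Δ * pv B (deriv (ψ 2)) x
        + P.β₁ * P.β₂ / Δ * P.logInt 0 (ψ 0) x
        + P.β₂ ^ 2 * P.α₁ / (P.α₂ * Δ) * P.logInt 1 (ψ 1) x
        + P.β₂ * κ / (P.α₂ * Δ) * P.logInt 2 (ψ 2) x
      = P.rhs 1 x) ∧
  (∀ x ∈ B,
    -P.γ₁i * deriv (deriv (ψ 2)) x
        + Δ * (1 - (P.β₁ + P.β₂) ^ 2 * Real.pi ^ 2 / Δ ^ 2) * ψ 2 x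
        + P.γ₀p * P.β₁ / P.α₁ * pv C (deriv (ψ 0)) x
        - P.γ₀m * P.β₂ / P.α₂ * pv C (deriv (ψ 1)) x
        + P.γ₀i * (P.β₁ + P.β₂) / Δ * pv B (deriv (ψ 2)) x
        - P.β₁ * κ / (P.α₁ * Δ) * P.logInt 0 (ψ 0) x
        - P.β₂ * κ / (P.α₂ * Δ) * P.logInt 1 (ψ 1) x
        - κ ^ 2 / (P.α₁ * P.α₂ * Δ) * P.logInt 2 (ψ 2) x
      = P.rhs 2 x)

end Problem

/-! ## Function classes -/

/-- The class of the functions `ψ₁, ψ₂, ψ`: twice continuously differentiable off the tips, with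
second derivative integrable up to the tips and decaying at infinity, `ψ` vanishing at infinity. -/
def Admissible (l : ℝ) (ψ : Fin 3 → ℝ → ℝ) : Prop :=
  (∀ k, ContDiffOn ℝ 2 (ψ k) (dom l k) ∧ ∃ δ : ℝ, 0 < δ ∧
    IntegrableOn (fun r => (1 + |r|) ^ (1 + δ) * deriv (deriv (ψ k)) r) (dom l k)) ∧
  Tendsto (ψ 2) (cocompact ℝ) (𝓝 0)

/-- The class of the functions `χ₁, χ₂, χ`. -/
def AdmissibleDensity (l : ℝ) (χ : Fin 3 → ℝ → ℝ) : Prop :=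
  ∀ k, ContinuousOn (χ k) (dom l k) ∧ ∃ δ : ℝ, 0 < δ ∧
    IntegrableOn (fun r => (1 + |r|) ^ (1 + δ) * χ k r) (dom l k)

/-! ## Change of unknowns -/

open Classical in
/-- `ω₀(s, x)` on the crack: `1` if `-l ≤ s ≤ x`, else `0`. -/
def omegaCrack (l s x : ℝ) : ℝ := if -l ≤ s ∧ s ≤ x then 1 else 0

open Classical in
/-- On the bonded interface: integration from `-∞` to `x` if `x < -l`, and minus the integration
from `x` to `+∞` if `x > l`. -/
def omegaBonded (l s x : ℝ) : ℝ :=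
  if x < -l ∧ s < x then 1 else if l < x ∧ x < s then -1 else 0

/-- `ψ_k'(x) = ∫_{D_k} omega₀(s, x) χ_k(s) ds + const`. -/
def omega₀ (l : ℝ) (k : Fin 3) (s x : ℝ) : ℝ :=
  (![omegaCrack l s x, omegaCrack l s x, omegaBonded l s x] : Fin 3 → ℝ) k

/-- `ψ_k(x) = ∫_{D_k} omega₁(s, x) χ_k(s) ds + affine`. -/
def omega₁ (l : ℝ) (k : Fin 3) (s x : ℝ) : ℝ := (x - s) * omega₀ l k s x

/-- The change of unknowns `χ_k = ψ_k''` with its integrated form; the integration constants are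
`C 0, C 1` (for `ψ₁`), `C 2, C 3` (for `ψ₂`), and zero for `ψ`. -/
def Represents (l : ℝ) (χ : Fin 3 → ℝ → ℝ) (C : Fin 4 → ℝ) (ψ : Fin 3 → ℝ → ℝ) : Prop :=
  ∀ k, ∀ x ∈ dom l k,
    χ k x = deriv (deriv (ψ k)) x ∧
    deriv (ψ k) x = (∫ s in dom l k, omega₀ l k s x * χ k s)
      + (![C 0, C 2, 0] : Fin 3 → ℝ) k ∧
    ψ k x = (∫ s in dom l k, omega₁ l k s x * χ k s)
      + (![C 0 * x + C 1, C 2 * x + C 3, 0] : Fin 3 → ℝ) k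

/-! ## The Fredholm system -/

/-- `χ` solves the system of linear integral equations
`a_j χ_j(x) + ∑_k ∫_{D_k} K_jk(x, s) χ_k(s) ds = F_j(x)`, `x ∈ D_j`, all integrals converging
absolutely. It is of the second kind if no `a_j` vanishes. -/
def SolvesFredholm (D : Fin 3 → Set ℝ) (a : Fin 3 → ℝ) (K : Fin 3 → Fin 3 → ℝ → ℝ → ℝ)
    (F χ : Fin 3 → ℝ → ℝ) : Prop :=
  ∀ j, ∀ x ∈ D j,
    (∀ k, IntegrableOn (fun s => K j k x s * χ k s) (D k)) ∧
    a j * χ j x + ∑ k, ∫ s in D k, K j k x s * χ k s = F j x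

/-- The kernel is jointly measurable and, over bounded parts of the domains (up to the tips `±l`),
it has at most a logarithmic singularity on the diagonal and squared-logarithmic ones in `x` at the
tips, and is square integrable. (`Real.log t` is `ln |t|`.) -/
def FredholmKernel (l : ℝ) (D E : Set ℝ) (K : ℝ → ℝ → ℝ) : Prop :=
  Measurable (Function.uncurry K) ∧
  ∀ R : ℝ,
    (∃ c : ℝ, ∀ x ∈ D, ∀ s ∈ E, |x| ≤ R → |s| ≤ R → x ≠ s →
      |K x s| ≤ c * (1 + |Real.log (x - s)| + Real.log (|x| - l) ^ 2)) ∧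
    IntegrableOn (fun z : ℝ × ℝ => K z.1 z.2 ^ 2) ((D ∩ Icc (-R) R) ×ˢ (E ∩ Icc (-R) R))

namespace Problem

variable (P : Problem)

/-- Coefficients of `χ_j` outside the integrals. -/
def leadCoef : Fin 3 → ℝ := ![-P.γ₁p, P.γ₁m, -P.γ₁i]

/-- Coefficients of `ψ_j` outside the integrals. -/
def diagCoef : Fin 3 → ℝ :=
  ![P.α₁ * (1 - P.β₁ ^ 2 * Real.pi ^ 2 / P.α₁ ^ 2),
    P.α₂ * (1 - P.β₂ ^ 2 * Real.pi ^ 2 / P.α₂ ^ 2),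
    (P.α₁ - P.α₂) * (1 - (P.β₁ + P.β₂) ^ 2 * Real.pi ^ 2 / (P.α₁ - P.α₂) ^ 2)]

/-- Coefficients of `∫ ψ_k'(r) / (r - x) dr` in the `j`-th equation. -/
def cauchyCoef : Matrix (Fin 3) (Fin 3) ℝ :=
  !![P.γ₀p * P.β₁ / P.α₁, 0, P.γ₀i * P.β₁ / (P.α₁ - P.α₂);
     0, P.γ₀m * P.β₂ / P.α₂, -(P.γ₀i * P.β₂ / (P.α₁ - P.α₂));
     P.γ₀p * P.β₁ / P.α₁, -(P.γ₀m * P.β₂ / P.α₂), P.γ₀i * (P.β₁ + P.β₂) / (P.α₁ - P.α₂)]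

/-- Coefficients of `logInt k ψ_k` in the `j`-th equation. -/
def logCoef : Matrix (Fin 3) (Fin 3) ℝ :=
  let Δ := P.α₁ - P.α₂
  let κ := P.β₁ * P.α₂ + P.β₂ * P.α₁
  !![-(P.β₁ ^ 2 * P.α₂ / (P.α₁ * Δ)), -(P.β₁ * P.β₂ / Δ), -(P.β₁ * κ / (P.α₁ * Δ));
     P.β₁ * P.β₂ / Δ, P.β₂ ^ 2 * P.α₁ / (P.α₂ * Δ), P.β₂ * κ / (P.α₂ * Δ);
     -(P.β₁ * κ / (P.α₁ * Δ)), -(P.β₂ * κ / (P.α₂ * Δ)), -(κ ^ 2 / (P.α₁ * P.α₂ * Δ))]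

open Classical in
/-- The principal value of `∫_{D_k} omega₀(s, r) / (r - x) dr`: on the crack, and for `s > l`, it
is `ln |(l - x) / (s - x)|`; for `s < -l` it is `ln |(l + x) / (s - x)|`. -/
def cauchyKernel (x s : ℝ) : ℝ :=
  if s < -P.l then Real.log |(P.l + x) / (s - x)| else Real.log |(P.l - x) / (s - x)|

/-- The kernels of the final system. -/
def fredholmKernel (j k : Fin 3) (x s : ℝ) : ℝ :=
  (if j = k then P.diagCoef j * omega₁ P.l k s x else 0)
    + P.cauchyCoef j k * P.cauchyKernel x s
    + P.logCoef j k * P.logInt k (omega₁ P.l k s) x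

/-- The free terms of the final system: the right-hand sides of the integro-differential system
minus the contributions of the affine parts `C 0 * x + C 1` of `ψ₁` and `C 2 * x + C 3` of `ψ₂`. -/
def fredholmRhs (C : Fin 4 → ℝ) (j : Fin 3) (x : ℝ) : ℝ :=
  P.rhs j x
    - P.diagCoef j * (![C 0 * x + C 1, C 2 * x + C 3, 0] : Fin 3 → ℝ) j
    - P.cauchyCoef j 0 * (C 0 * P.tipLog x) - P.cauchyCoef j 1 * (C 2 * P.tipLog x)
    - P.logCoef j 0 * P.logInt 0 (fun r => C 0 * r + C 1) x
    - P.logCoef j 1 * P.logInt 1 (fun r => C 2 * r + C 3) x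

end Problem

end InterfaceCrack

end

/-! The boundary conditions and the six singular equations differ only by splitting Cauchy integrals
over the line into crack and bonded part. One of the two parts always stays away from `x`, so
existence and value of the principal value both split (`hasPV_union`). The three normal stress
equations are linear in `φ₁, φ₂, φ` pointwise, with coefficients `α₁`, `α₂`, `Δ`, and can be solved
for them. Substituting into the other three produces Cauchy integrals of Cauchy integrals, and
everything hinges on a Poincaré–Bertrand formula on the crack and its complement.

That formula (`hasPV_pv`) is proved by explicit computation, without Hölder theory. An admissible
function is, up to a constant on the crack, a primitive of an integrable density `h`. A unit of
density at `t` contributes, up to sign, the indicator of the segment from `t` to its end point `e`,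
a tip of the crack or `∓l` on the bonded part. The Cauchy integral of that segment at `s` is `ln |(e
- s) / (t - s)|`. The second Cauchy integral in `s`, cut off at distance `ε` from `x`, is a
combination of real dilogarithms. By the inversion formula it equals `∫_t^e logKernel(x, r) dr` plus
`oddDilog ((e - x) / ε) - oddDilog ((t - x) / ε)` over the crack; over the whole line only the
`oddDilog` difference survives, so over the bonded part the logarithmic term changes sign. Since
`oddDilog (y / ε)` tends to `-π²/2` times the sign of `y`, the limit yields the `π²` terms: they
appear exactly when `x` lies on the segment. Fubini and dominated convergence then carry the formula
from segments to densities; they rest on a bound of the truncated integral by `|t - e| ^ a`, which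
the weight of the density absorbs, and on the boundedness of `oddDilog`.

The change of unknowns is double integration. The kernel `omega₀(s, x)` vanishes unless `|s|` is at
least comparable to `|x|`, so the weight on `χ` becomes decay of the primitives. On each connected
piece a function is determined by its second derivative up to an affine summand; decay at infinity
removes it on both bonded half-lines, and on each bank it gives two of the four constants.

Inserting this representation and interchanging integrals once more turns the logarithmic system
into the Fredholm system. The kernel bound comes from writing `logKernel` as a difference of two
copies of `ln |1 - v| / v` rescaled by the distances to the tips: its absolute integral over `[-A,
A]` grows like `ln² A`, hence the squared logarithm at the tips. Fourth powers of logarithms are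
locally integrable, which gives square integrability. -/

noncomputable section

namespace InterfaceCrack

/-! ## Principal values -/

/-- The Cauchy integral of `f` over `D` exists at `x` and equals `I`. -/
def HasPV (D : Set ℝ) (f : ℝ → ℝ) (x I : ℝ) : Prop :=
  (∀ ε : ℝ, 0 < ε → IntegrableOn (fun r => f r / (r - x)) (D \ Ioo (x - ε) (x + ε))) ∧
  Tendsto (fun ε : ℝ => ∫ r in D \ Ioo (x - ε) (x + ε), f r / (r - x)) (𝓝[>] 0) (𝓝 I)

section PrincipalValue

variable {D E : Set ℝ} {f g : ℝ → ℝ} {x I J : ℝ}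

theorem HasPV.pvExists (h : HasPV D f x I) : PVExists D f x := ⟨h.1, I, h.2⟩

theorem HasPV.pv_eq (h : HasPV D f x I) : pv D f x = I := h.2.limUnder_eq

theorem PVExists.hasPV (h : PVExists D f x) : HasPV D f x (pv D f x) := by
  obtain ⟨h1, I, h2⟩ := h
  refine ⟨h1, ?_⟩
  rw [HasPV.pv_eq ⟨h1, h2⟩]
  exact h2

theorem HasPV.congr (hD : MeasurableSet D) (h : HasPV D f x I) (hfg : EqOn f g D) :
    HasPV D g x I := by
  have hm : ∀ ε : ℝ, MeasurableSet (D \ Ioo (x - ε) (x + ε)) := fun ε => hD.diff measurableSet_Ioo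
  have he : ∀ ε : ℝ, EqOn (fun r => f r / (r - x)) (fun r => g r / (r - x))
      (D \ Ioo (x - ε) (x + ε)) := fun ε r hr => by simp only [hfg hr.1]
  refine ⟨fun ε hε => (h.1 ε hε).congr_fun (he ε) (hm ε), ?_⟩
  exact h.2.congr fun ε => setIntegral_congr_fun (hm ε) (he ε)

theorem HasPV.add (hf : HasPV D f x I) (hg : HasPV D g x J) :
    HasPV D (fun r => f r + g r) x (I + J) := by
  refine ⟨fun ε hε => ?_, ?_⟩
  · simp only [add_div]
    exact (hf.1 ε hε).add (hg.1 ε hε)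
  · refine (hf.2.add hg.2).congr' ?_
    filter_upwards [self_mem_nhdsWithin] with ε hε
    rw [← integral_add (hf.1 ε hε) (hg.1 ε hε)]
    simp only [add_div]

theorem HasPV.const_mul (c : ℝ) (hf : HasPV D f x I) : HasPV D (fun r => c * f r) x (c * I) := by
  refine ⟨fun ε hε => ?_, ?_⟩
  · simp only [mul_div_assoc]
    exact (hf.1 ε hε).const_mul c
  · refine (hf.2.const_mul c).congr fun ε => ?_
    rw [← integral_const_mul]
    simp only [mul_div_assoc]

theorem HasPV.sub (hf : HasPV D f x I) (hg : HasPV D g x J) :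
    HasPV D (fun r => f r - g r) x (I - J) := by
  have := hf.add (hg.const_mul (-1))
  simpa only [neg_mul, one_mul, ← sub_eq_add_neg] using this

theorem PVExists.congr (hD : MeasurableSet D) (h : PVExists D f x) (hfg : EqOn f g D) :
    PVExists D g x := (h.hasPV.congr hD hfg).pvExists

theorem pv_congr (hD : MeasurableSet D) (hfg : EqOn f g D) : pv D f x = pv D g x := by
  have : (fun ε : ℝ => ∫ r in D \ Ioo (x - ε) (x + ε), f r / (r - x))
      = fun ε : ℝ => ∫ r in D \ Ioo (x - ε) (x + ε), g r / (r - x) := by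
    funext ε
    refine setIntegral_congr_fun (hD.diff measurableSet_Ioo) fun r hr => ?_
    simp only [hfg hr.1]
  simp only [pv, this]

theorem PVExists.hasPV_of_notMem_closure (hx : ∀ᶠ ε in 𝓝[>] (0 : ℝ), D \ Ioo (x - ε) (x + ε) = D)
    (hi : IntegrableOn (fun r => f r / (r - x)) D) :
    HasPV D f x (∫ r in D, f r / (r - x)) := by
  refine ⟨fun ε _ => hi.mono_set sdiff_subset, ?_⟩
  refine tendsto_const_nhds.congr' ?_
  filter_upwards [hx] with ε hε
  rw [hε]

/-- Over an a.e. disjoint decomposition of the line, one part of which stays away from `x`, the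
Cauchy integral exists exactly if it exists over both parts. -/
theorem hasPV_union (hE : MeasurableSet E) (hDE : Disjoint D E)
    (hU : (D ∪ E : Set ℝ) =ᵐ[volume] univ)
    (hx : ∀ᶠ ε in 𝓝[>] (0 : ℝ), E \ Ioo (x - ε) (x + ε) = E) :
    (PVExists univ f x ↔ PVExists D f x ∧ PVExists E f x) ∧
    (PVExists univ f x → pv univ f x = pv D f x + pv E f x) := by
  have hset : ∀ ε : ℝ, (univ \ Ioo (x - ε) (x + ε) : Set ℝ) =ᵐ[volume]
      ((D \ Ioo (x - ε) (x + ε)) ∪ (E \ Ioo (x - ε) (x + ε)) : Set ℝ) := by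
    intro ε
    rw [← union_sdiff_distrib]
    exact hU.symm.diff (ae_eq_refl _)
  have hdisj : ∀ ε : ℝ, Disjoint (D \ Ioo (x - ε) (x + ε)) (E \ Ioo (x - ε) (x + ε)) :=
    fun ε => hDE.mono sdiff_subset sdiff_subset
  have hmE : ∀ ε : ℝ, MeasurableSet (E \ Ioo (x - ε) (x + ε)) :=
    fun ε => hE.diff measurableSet_Ioo
  have hsum : ∀ {I J : ℝ}, HasPV D f x I → HasPV E f x J → HasPV univ f x (I + J) := by
    intro I J hI hJ
    refine ⟨fun ε hε => ?_, ?_⟩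
    · rw [integrableOn_congr_set_ae (hset ε)]
      exact (hI.1 ε hε).union (hJ.1 ε hε)
    · refine (hI.2.add hJ.2).congr' ?_
      filter_upwards [self_mem_nhdsWithin] with ε hε
      rw [setIntegral_congr_set (hset ε),
        setIntegral_union (hdisj ε) (hmE ε) (hI.1 ε hε) (hJ.1 ε hε)]
  have hsplit : PVExists univ f x → PVExists D f x ∧ PVExists E f x := by
    rintro ⟨h1, I, h2⟩
    have h1' : ∀ ε : ℝ, 0 < ε → IntegrableOn (fun r => f r / (r - x))
        ((D \ Ioo (x - ε) (x + ε)) ∪ (E \ Ioo (x - ε) (x + ε))) := fun ε hε =>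
      (integrableOn_congr_set_ae (hset ε)).1 (h1 ε hε)
    have hE' : HasPV E f x (∫ r in E, f r / (r - x)) := by
      -- For one small cut-off the window misses `E`, so integrability away from `x` is already
      -- integrability on all of `E`.
      obtain ⟨ε, hε, hε0⟩ := (hx.and self_mem_nhdsWithin).exists
      refine PVExists.hasPV_of_notMem_closure hx ?_
      rw [← hε]
      exact (h1' ε hε0).mono_set subset_union_right
    refine ⟨⟨fun ε hε => (h1' ε hε).mono_set subset_union_left,
      I - ∫ r in E, f r / (r - x), ?_⟩, hE'.pvExists⟩
    refine (h2.sub hE'.2).congr' ?_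
    filter_upwards [self_mem_nhdsWithin] with ε hε
    have hh := h1' ε hε
    rw [setIntegral_congr_set (hset ε), setIntegral_union (hdisj ε) (hmE ε)
      (hh.mono_set subset_union_left) (hh.mono_set subset_union_right)]
    ring
  refine ⟨⟨hsplit, fun h => (hsum h.1.hasPV h.2.hasPV).pvExists⟩, fun h => ?_⟩
  have h2 := hsplit h
  exact (hsum h2.1.hasPV h2.2.hasPV).pv_eq

end PrincipalValue

/-! ## The crack and the bonded interface -/

section Domains

variable {l x : ℝ}

theorem crack_eq_Ioo (l : ℝ) : crack l = Ioo (-l) l := by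
  ext x; simp [crack, abs_lt]

theorem isOpen_crack (l : ℝ) : IsOpen (crack l) := by
  rw [crack_eq_Ioo]; exact isOpen_Ioo

theorem isOpen_bonded (l : ℝ) : IsOpen (bonded l) := isOpen_lt continuous_const continuous_abs

theorem isOpen_dom (l : ℝ) (k : Fin 3) : IsOpen (dom l k) := by
  fin_cases k
  exacts [isOpen_crack l, isOpen_crack l, isOpen_bonded l]

theorem measurableSet_crack (l : ℝ) : MeasurableSet (crack l) := (isOpen_crack l).measurableSet

theorem measurableSet_bonded (l : ℝ) : MeasurableSet (bonded l) := (isOpen_bonded l).measurableSet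

theorem measurableSet_dom (l : ℝ) (k : Fin 3) : MeasurableSet (dom l k) :=
  (isOpen_dom l k).measurableSet

theorem abs_ne_of_mem_dom {k : Fin 3} (hx : x ∈ dom l k) : |x| ≠ l := by
  fin_cases k
  exacts [ne_of_lt hx, ne_of_lt hx, ne_of_gt hx]

theorem disjoint_crack_bonded (l : ℝ) : Disjoint (crack l) (bonded l) :=
  Set.disjoint_left.2 fun _ h1 h2 => lt_asymm (show _ < l from h1) h2

theorem crack_union_bonded (l : ℝ) : (crack l ∪ bonded l : Set ℝ) =ᵐ[volume] univ := by
  rw [ae_eq_univ]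
  refine measure_mono_null (t := {l, -l}) (fun x hx => ?_) ((Set.toFinite _).measure_zero _)
  simp only [crack, bonded, mem_compl_iff, mem_union, mem_ofPred_eq, not_or, not_lt] at hx
  have : |x| = l := le_antisymm hx.2 hx.1
  rcases abs_choice x with h | h
  · left; linarith
  · right; simp only [mem_singleton_iff]; linarith

theorem eventually_diff_Ioo_eq {D : Set ℝ} (h : Dᶜ ∈ 𝓝 x) :
    ∀ᶠ ε in 𝓝[>] (0 : ℝ), D \ Ioo (x - ε) (x + ε) = D := by
  obtain ⟨ρ, hρ, hb⟩ := Metric.mem_nhds_iff.1 h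
  filter_upwards [Ioo_mem_nhdsGT hρ] with ε hε
  rw [sdiff_eq_left, Set.disjoint_left]
  intro r hr hr2
  refine hb ?_ hr
  rw [← Real.ball_eq_Ioo] at hr2
  exact Metric.ball_subset_ball hε.2.le hr2

theorem compl_crack_mem_nhds (hx : x ∈ bonded l) : (crack l)ᶜ ∈ 𝓝 x :=
  mem_of_superset ((isOpen_bonded l).mem_nhds hx)
    (disjoint_crack_bonded l).symm.subset_compl_right

theorem compl_bonded_mem_nhds (hx : x ∈ crack l) : (bonded l)ᶜ ∈ 𝓝 x :=
  mem_of_superset ((isOpen_crack l).mem_nhds hx) (disjoint_crack_bonded l).subset_compl_right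

/-- The part that stays away from `x` is the bonded interface if `|x| < l` and the crack if `|x| >
l`, so `hasPV_union` is used with the roles exchanged. The tips form a null set. -/
theorem pv_univ_eq {f : ℝ → ℝ} (hx : |x| ≠ l) :
    (PVExists univ f x ↔ PVExists (crack l) f x ∧ PVExists (bonded l) f x) ∧
    (PVExists univ f x → pv univ f x = pv (crack l) f x + pv (bonded l) f x) := by
  rcases lt_or_gt_of_ne hx with h | h
  · exact hasPV_union (measurableSet_bonded l) (disjoint_crack_bonded l)
      (crack_union_bonded l) (eventually_diff_Ioo_eq (compl_bonded_mem_nhds h))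
  · have := hasPV_union (f := f) (measurableSet_crack l)
      (disjoint_crack_bonded l).symm (by rw [union_comm]; exact crack_union_bonded l)
      (eventually_diff_Ioo_eq (compl_crack_mem_nhds h))
    rw [add_comm (pv (crack l) f x), and_comm (a := PVExists (crack l) f x)]
    exact this

end Domains

/-! ## The boundary conditions and the six singular equations -/

namespace Problem

variable (P : Problem) {v w : ℝ → ℝ} {x : ℝ}

theorem glue_eqOn_crack (v w : ℝ → ℝ) : EqOn (P.glue v w) v (crack P.l) :=
  fun _ hx => if_pos hx

theorem glue_eqOn_bonded (v w : ℝ → ℝ) : EqOn (P.glue v w) w (bonded P.l) :=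
  fun _ hx => if_neg (not_lt.2 (le_of_lt hx))

theorem pvExists_glue (hx : |x| ≠ P.l) :
    PVExists univ (P.glue v w) x ↔ PVExists (crack P.l) v x ∧ PVExists (bonded P.l) w x := by
  rw [(pv_univ_eq hx).1]
  exact and_congr
    ⟨fun h => h.congr (measurableSet_crack _) (P.glue_eqOn_crack v w),
      fun h => h.congr (measurableSet_crack _) (P.glue_eqOn_crack v w).symm⟩
    ⟨fun h => h.congr (measurableSet_bonded _) (P.glue_eqOn_bonded v w),
      fun h => h.congr (measurableSet_bonded _) (P.glue_eqOn_bonded v w).symm⟩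

theorem pv_glue (hx : |x| ≠ P.l) (hv : PVExists (crack P.l) v x)
    (hw : PVExists (bonded P.l) w x) :
    pv univ (P.glue v w) x = pv (crack P.l) v x + pv (bonded P.l) w x := by
  rw [(pv_univ_eq hx).2 ((P.pvExists_glue hx).2 ⟨hv, hw⟩),
    pv_congr (measurableSet_crack _) (P.glue_eqOn_crack v w),
    pv_congr (measurableSet_bonded _) (P.glue_eqOn_bonded v w)]

/-- On an open set the glued function has the same germ as the piece, so all derivatives agree
whether or not the pieces are smooth or match at the tips. -/
theorem glue_derivs_crack (hx : x ∈ crack P.l) :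
    P.glue v w x = v x ∧ deriv (P.glue v w) x = deriv v x ∧
    deriv (deriv (P.glue v w)) x = deriv (deriv v) x := by
  have h := (P.glue_eqOn_crack v w).eventuallyEq_of_mem ((isOpen_crack _).mem_nhds hx)
  exact ⟨h.eq_of_nhds, h.deriv_eq, h.deriv.deriv_eq⟩

theorem glue_derivs_bonded (hx : x ∈ bonded P.l) :
    P.glue v w x = w x ∧ deriv (P.glue v w) x = deriv w x ∧
    deriv (deriv (P.glue v w)) x = deriv (deriv w) x := by
  have h := (P.glue_eqOn_bonded v w).eventuallyEq_of_mem ((isOpen_bonded _).mem_nhds hx)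
  exact ⟨h.eq_of_nhds, h.deriv_eq, h.deriv.deriv_eq⟩

theorem boundaryConditions_iff_singularSystem (φ ψ : Fin 3 → ℝ → ℝ) :
    P.BoundaryConditions φ ψ ↔ P.SingularSystem φ ψ := by
  have hex : (∀ x, |x| ≠ P.l →
      PVExists univ (P.glue (φ 0) (φ 2)) x ∧ PVExists univ (P.glue (φ 1) (φ 2)) x ∧
      PVExists univ (P.glue (ψ 0) (ψ 2)) x ∧ PVExists univ (P.glue (ψ 1) (ψ 2)) x) ↔
      (∀ x, |x| ≠ P.l → ∀ k, PVExists (dom P.l k) (φ k) x ∧ PVExists (dom P.l k) (ψ k) x) := by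
    refine forall_congr' fun x => forall_congr' fun hx => ?_
    simp only [P.pvExists_glue hx, Fin.forall_fin_succ, dom]
    simp
    tauto
  simp only [BoundaryConditions, SingularSystem]
  rw [hex]
  refine and_congr_right fun hp => and_congr (forall₂_congr fun x hx => ?_)
    (forall₂_congr fun x hx => ?_)
  · have hx' : |x| ≠ P.l := ne_of_lt hx
    have h0 := hp x hx' 0
    have h1 := hp x hx' 1
    have h2 := hp x hx' 2
    obtain ⟨a1, a2, a3⟩ := P.glue_derivs_crack (v := ψ 0) (w := ψ 2) hx
    obtain ⟨b1, b2, b3⟩ := P.glue_derivs_crack (v := ψ 1) (w := ψ 2) hx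
    have a0 := (P.glue_derivs_crack (v := φ 0) (w := φ 2) hx).1
    have b0 := (P.glue_derivs_crack (v := φ 1) (w := φ 2) hx).1
    simp only [shearUpper, shearLower, normalUpper, normalLower, a0, a1, a2, a3, b0, b1, b2, b3,
      P.pv_glue hx' h0.1 h2.1, P.pv_glue hx' h0.2 h2.2, P.pv_glue hx' h1.1 h2.1,
      P.pv_glue hx' h1.2 h2.2, mul_add, ← add_assoc, ← sub_sub]
  · have hx' : |x| ≠ P.l := ne_of_gt hx
    have h0 := hp x hx' 0
    have h1 := hp x hx' 1
    have h2 := hp x hx' 2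
    obtain ⟨a1, a2, a3⟩ := P.glue_derivs_bonded (v := ψ 0) (w := ψ 2) hx
    obtain ⟨b1, b2, b3⟩ := P.glue_derivs_bonded (v := ψ 1) (w := ψ 2) hx
    have a0 := (P.glue_derivs_bonded (v := φ 0) (w := φ 2) hx).1
    have b0 := (P.glue_derivs_bonded (v := φ 1) (w := φ 2) hx).1
    simp only [shearUpper, shearLower, normalUpper, normalLower, a0, a1, a2, a3, b0, b1,
      P.pv_glue hx' h0.1 h2.1, P.pv_glue hx' h0.2 h2.2, P.pv_glue hx' h1.1 h2.1,
      P.pv_glue hx' h1.2 h2.2]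
    constructor <;> rintro ⟨e1, e2⟩ <;> constructor <;> linarith

end Problem

/-! ## The dilogarithm on the real line -/

/-- `ln |1 - v| / v`. -/
def dilogKernel (v : ℝ) : ℝ := Real.log (1 - v) / v

/-- `∫₀^y ln |1 - v| / v dv`, which is `-Li₂(y)` for `y ≤ 1`. -/
def dilog (y : ℝ) : ℝ := ∫ v in (0 : ℝ)..y, dilogKernel v

/-- `∫₀^y ln |(1 - v) / (1 + v)| / v dv`. -/
def oddDilog (y : ℝ) : ℝ := dilog y - dilog (-y)

theorem measurable_dilogKernel : Measurable dilogKernel := by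
  unfold dilogKernel; fun_prop

/-- For `|v| ≤ 1/2` the zero of the logarithm cancels the denominator, since `|ln (1 - v)| ≤ 2 |v|`;
for larger `|v|` the quantities `|v|` and `1 + |v|` are comparable. One inequality thus covers the
removable singularity at `0`, the logarithmic one at `1` and the decay at infinity. -/
theorem abs_dilogKernel_le (v : ℝ) :
    |dilogKernel v| ≤ 4 * (1 + |Real.log (1 - v)|) / (1 + |v|) := by
  have hv := abs_nonneg v
  have hL := abs_nonneg (Real.log (1 - v))
  rw [dilogKernel, abs_div]
  rcases eq_or_ne v 0 with rfl | h0
  · simp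
  have hpos : 0 < |v| := abs_pos.2 h0
  rw [div_le_div_iff₀ hpos (by positivity)]
  rcases le_or_gt |v| (1 / 2) with h | h
  · have hlog : |Real.log (1 - v)| ≤ 2 * |v| := by
      have h1 := (abs_le.1 h).1
      have h2 := (abs_le.1 h).2
      have hp : 0 < 1 - v := by linarith
      have e1 := Real.log_le_sub_one_of_pos hp
      have e2 := Real.one_sub_inv_le_log_of_pos hp
      have e3 : (1 - v)⁻¹ ≤ 1 + 2 * |v| := by
        rw [inv_le_comm₀ hp (by positivity), inv_le_comm₀ (by positivity) hp,
          inv_eq_one_div, div_le_iff₀ hp]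
        nlinarith [le_abs_self v]
      rw [abs_le]
      constructor <;> linarith [neg_abs_le v, le_abs_self v]
    nlinarith
  · nlinarith

theorem intervalIntegrable_log_sub_left (p a b : ℝ) :
    IntervalIntegrable (fun v => Real.log (p - v)) volume a b := by
  simpa using (intervalIntegral.intervalIntegrable_log' (a := p - a) (b := p - b)).comp_sub_left p

theorem intervalIntegrable_dilogKernel (a b : ℝ) :
    IntervalIntegrable dilogKernel volume a b := by
  have h : IntervalIntegrable (fun v => 4 * (1 + |Real.log (1 - v)|)) volume a b :=
    (intervalIntegrable_const.add (intervalIntegrable_log_sub_left 1 a b).abs).const_mul 4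
  refine h.mono_fun' measurable_dilogKernel.aestronglyMeasurable (ae_of_all _ fun v => ?_)
  refine (Real.norm_eq_abs _).le.trans ((abs_dilogKernel_le v).trans (div_le_self (by positivity) ?_))
  linarith [abs_nonneg v]

theorem continuous_dilog : Continuous dilog :=
  intervalIntegral.continuous_primitive intervalIntegrable_dilogKernel 0

theorem continuous_oddDilog : Continuous oddDilog :=
  continuous_dilog.sub (continuous_dilog.comp continuous_neg)

theorem dilog_zero : dilog 0 = 0 := by simp [dilog]

theorem dilog_sub (a b : ℝ) : dilog b - dilog a = ∫ v in a..b, dilogKernel v :=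
  intervalIntegral.integral_interval_sub_left (intervalIntegrable_dilogKernel _ _)
    (intervalIntegrable_dilogKernel _ _)

/-- The point `0` is excluded because division by zero gives the integrand the value `0` there
instead of its limit `-1`. -/
theorem hasDerivAt_dilog {y : ℝ} (h0 : y ≠ 0) (h1 : y ≠ 1) :
    HasDerivAt dilog (dilogKernel y) y := by
  refine intervalIntegral.integral_hasDerivAt_right (intervalIntegrable_dilogKernel 0 y)
    (measurable_dilogKernel.stronglyMeasurable.stronglyMeasurableAtFilter) ?_
  unfold dilogKernel
  refine ContinuousAt.div ?_ continuousAt_id h0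
  exact (continuousAt_const.sub continuousAt_id).log (sub_ne_zero.2 h1.symm)

/-- The inversion formula of the dilogarithm, as a difference of its values at two points. -/
theorem dilog_add_dilog_inv_sub {y z : ℝ} (h : 0 < y * z) :
    (dilog y + dilog y⁻¹) - (dilog z + dilog z⁻¹)
      = (Real.log y ^ 2 - Real.log z ^ 2) / 2 := by
  have hne : ∀ v ∈ uIcc z y, v ≠ 0 := by
    rintro v hv rfl
    rw [mem_uIcc] at hv
    rcases hv with hv | hv <;> nlinarith
  have hcont : ContinuousOn (fun v => dilog v + dilog v⁻¹ - Real.log v ^ 2 / 2) (uIcc z y) := by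
    refine ContinuousOn.sub (ContinuousOn.add continuous_dilog.continuousOn ?_) ?_
    · exact continuous_dilog.comp_continuousOn (continuousOn_id.inv₀ hne)
    · exact ((continuousOn_id.log hne).pow 2).div_const 2
  -- The derivative vanishes except at `v = 1`, where the function is still continuous, so it is
  -- constant on the segment. The segment avoids `0` because `y` and `z` have the same sign; the
  -- constant depends on that sign, hence the formulation as a difference.
  have hder : ∀ v ∈ Ioo (min z y) (max z y) \ {1},
      HasDerivAt (fun v => dilog v + dilog v⁻¹ - Real.log v ^ 2 / 2) 0 v := by
    intro v hv
    have hv0 : v ≠ 0 := hne v (Ioo_subset_Icc_self hv.1)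
    have hv1 : v ≠ 1 := hv.2
    have d1 := hasDerivAt_dilog hv0 hv1
    have d2 := (hasDerivAt_dilog (inv_ne_zero hv0) (fun h => hv1 (inv_eq_one.1 h))).comp v
      (hasDerivAt_inv hv0)
    have d3 := ((Real.hasDerivAt_log hv0).pow 2).div_const 2
    refine ((d1.add d2).sub d3).congr_deriv ?_
    have hl : Real.log (1 - v⁻¹) = Real.log (1 - v) - Real.log v := by
      rw [← Real.log_div (sub_ne_zero.2 hv1.symm) hv0, ← Real.log_neg_eq_log]
      congr 1
      field_simp
      ring
    simp only [dilogKernel, hl]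
    field_simp
    ring
  have hint := integral_eq_of_hasDerivAt_off_countable
    (fun v => dilog v + dilog v⁻¹ - Real.log v ^ 2 / 2) (fun _ => (0 : ℝ))
    (countable_singleton (1 : ℝ)) hcont hder intervalIntegrable_const
  simp only [intervalIntegral.integral_zero] at hint
  linarith

theorem oddDilog_neg (y : ℝ) : oddDilog (-y) = -oddDilog y := by
  simp [oddDilog]

theorem oddDilog_zero : oddDilog 0 = 0 := by simp [oddDilog]

/-! ### The constant `π²`: values and limits of the odd dilogarithm -/

theorem hasSum_one_div_odd_sq :
    HasSum (fun k : ℕ => 1 / (2 * (k : ℝ) + 1) ^ 2) (Real.pi ^ 2 / 8) := by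
  have h := hasSum_zeta_two
  have he : HasSum (fun k : ℕ => 1 / ((2 * k : ℕ) : ℝ) ^ 2) (Real.pi ^ 2 / 24) := by
    have h4 := h.mul_left (1 / 4)
    rw [show 1 / 4 * (Real.pi ^ 2 / 6) = Real.pi ^ 2 / 24 by ring] at h4
    refine h4.congr_fun fun k => ?_
    push_cast
    rw [mul_pow, one_div_mul_one_div]
    norm_num
  have hs : Summable (fun k : ℕ => 1 / ((2 * k + 1 : ℕ) : ℝ) ^ 2) :=
    h.summable.comp_injective (i := fun k : ℕ => 2 * k + 1) fun a b hab => by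
      have : 2 * a + 1 = 2 * b + 1 := hab
      omega
  have heq := (HasSum.even_add_odd (f := fun n : ℕ => 1 / (n : ℝ) ^ 2) he hs.hasSum).unique h
  have : ∑' k : ℕ, 1 / ((2 * k + 1 : ℕ) : ℝ) ^ 2 = Real.pi ^ 2 / 8 := by linarith
  rw [← this]
  have hf : (fun k : ℕ => 1 / (2 * (k : ℝ) + 1) ^ 2) = fun k : ℕ => 1 / ((2 * k + 1 : ℕ) : ℝ) ^ 2 := by
    funext k
    push_cast
    ring
  rw [hf]
  exact hs.hasSum

/-- Termwise integration of `ln ((1 + v) / (1 - v)) / v = 2 ∑ v^(2k) / (2k + 1)` over `(0, 1)` gives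
`2 ∑ 1 / (2k + 1)² = π²/4`. -/
theorem oddDilog_one : oddDilog 1 = -(Real.pi ^ 2 / 4) := by
  have hneg : dilog (-1) = ∫ v in (0 : ℝ)..1, Real.log (1 + v) / v := by
    have := intervalIntegral.integral_comp_neg (a := 0) (b := 1) dilogKernel
    rw [dilog, intervalIntegral.integral_symm, ← neg_zero, ← this,
      ← intervalIntegral.integral_neg, neg_zero]
    refine intervalIntegral.integral_congr fun v _ => ?_
    simp [dilogKernel, div_neg]
  have hterm : ∀ k : ℕ, ∫ v in Ioo (0 : ℝ) 1, 2 / (2 * (k : ℝ) + 1) * v ^ (2 * k)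
      = 2 * (1 / (2 * (k : ℝ) + 1) ^ 2) := by
    intro k
    rw [← integral_Ioc_eq_integral_Ioo, ← intervalIntegral.integral_of_le zero_le_one,
      intervalIntegral.integral_const_mul, integral_pow]
    push_cast
    simp
    field_simp
  have hint : ∀ k : ℕ, Integrable (fun v : ℝ => 2 / (2 * (k : ℝ) + 1) * v ^ (2 * k))
      (volume.restrict (Ioo (0 : ℝ) 1)) := fun k =>
    ((by fun_prop : Continuous fun v : ℝ => 2 / (2 * (k : ℝ) + 1) * v ^ (2 * k)).integrableOn_Icc
      (a := 0) (b := 1)).mono_set Ioo_subset_Icc_self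
  have hnorm : ∀ k : ℕ, ∫ v in Ioo (0 : ℝ) 1, ‖2 / (2 * (k : ℝ) + 1) * v ^ (2 * k)‖
      = 2 * (1 / (2 * (k : ℝ) + 1) ^ 2) := by
    intro k
    rw [← hterm k]
    refine setIntegral_congr_fun measurableSet_Ioo fun v hv => ?_
    refine Real.norm_of_nonneg ?_
    have := hv.1
    positivity
  have hsum := hasSum_integral_of_summable_integral_norm hint
    (by simp only [hnorm]; exact (hasSum_one_div_odd_sq.mul_left 2).summable)
  simp only [hterm] at hsum
  have hval := hsum.unique (hasSum_one_div_odd_sq.mul_left 2)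
  have hfun : ∫ v in Ioo (0 : ℝ) 1, ∑' k : ℕ, 2 / (2 * (k : ℝ) + 1) * v ^ (2 * k)
      = ∫ v in Ioo (0 : ℝ) 1, (Real.log (1 + v) / v - dilogKernel v) := by
    refine setIntegral_congr_fun measurableSet_Ioo fun v hv => ?_
    have hv0 : v ≠ 0 := hv.1.ne'
    have hs := (Real.hasSum_log_sub_log_of_abs_lt_one (x := v)
      (by rw [abs_of_pos hv.1]; exact hv.2)).div_const v
    simp only [dilogKernel]
    rw [← sub_div, ← hs.tsum_eq]
    refine tsum_congr fun k => ?_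
    rw [pow_succ]
    field_simp
  have hi2 : IntervalIntegrable (fun v => Real.log (1 + v) / v) volume 0 1 := by
    have := (IntervalIntegrable.iff_comp_neg (f := dilogKernel) (a := 0) (b := -1)).1
      (intervalIntegrable_dilogKernel 0 (-1))
    have h := this.neg
    simp only [neg_neg, neg_zero] at h
    refine h.congr fun v _ => ?_
    simp [dilogKernel, div_neg]
  rw [oddDilog, hneg, dilog, ← intervalIntegral.integral_sub (intervalIntegrable_dilogKernel 0 1) hi2,
    intervalIntegral.integral_of_le zero_le_one, integral_Ioc_eq_integral_Ioo]
  have : ∫ v in Ioo (0 : ℝ) 1, (dilogKernel v - Real.log (1 + v) / v)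
      = -∫ v in Ioo (0 : ℝ) 1, (Real.log (1 + v) / v - dilogKernel v) := by
    rw [← integral_neg]
    simp
  rw [this, ← hfun, hval]
  ring

/-- The inversion formula is used between `y` and `1` and between `-y` and `-1`. Since `Real.log`
ignores signs, the squared logarithms cancel in the difference, leaving `2 * oddDilog 1`. This fixes
the limit at infinity and hence the jump in the Poincaré–Bertrand formula. -/
theorem oddDilog_add_inv {y : ℝ} (hy : 0 < y) :
    oddDilog y + oddDilog y⁻¹ = -(Real.pi ^ 2 / 2) := by
  have h1 := dilog_add_dilog_inv_sub (y := y) (z := 1) (by simpa using hy)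
  have h2 := dilog_add_dilog_inv_sub (y := -y) (z := -1) (by simpa using hy)
  have h3 := oddDilog_one
  simp only [oddDilog, inv_one, inv_neg, Real.log_neg_eq_log, Real.log_one] at *
  linarith

theorem tendsto_oddDilog_atTop : Tendsto oddDilog atTop (𝓝 (-(Real.pi ^ 2 / 2))) := by
  have h : Tendsto (fun y : ℝ => -(Real.pi ^ 2 / 2) - oddDilog y⁻¹) atTop
      (𝓝 (-(Real.pi ^ 2 / 2) - oddDilog 0)) :=
    tendsto_const_nhds.sub ((continuous_oddDilog.tendsto 0).comp tendsto_inv_atTop_zero)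
  rw [oddDilog_zero, sub_zero] at h
  refine h.congr' ?_
  filter_upwards [eventually_gt_atTop 0] with y hy
  linarith [oddDilog_add_inv hy]

theorem tendsto_oddDilog_atBot : Tendsto oddDilog atBot (𝓝 (Real.pi ^ 2 / 2)) := by
  have h := (tendsto_oddDilog_atTop.comp tendsto_neg_atBot_atTop).neg
  rw [neg_neg] at h
  refine h.congr fun y => ?_
  simp [oddDilog_neg]

/-- Compactness covers `[0, 1]`, inversion covers `[1, ∞)`, and oddness covers the rest. The bound
is the domination as the cut-off shrinks. -/
theorem exists_abs_oddDilog_le : ∃ B : ℝ, ∀ y, |oddDilog y| ≤ B := by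
  obtain ⟨B, hB⟩ := (isCompact_Icc (a := (0 : ℝ)) (b := 1)).exists_bound_of_continuousOn
    continuous_oddDilog.continuousOn
  have hpos : ∀ y, 0 ≤ y → |oddDilog y| ≤ Real.pi ^ 2 / 2 + B := by
    intro y hy
    rcases le_or_gt y 1 with h | h
    · have := hB y ⟨hy, h⟩
      rw [Real.norm_eq_abs] at this
      have : 0 ≤ Real.pi ^ 2 / 2 := by positivity
      linarith
    · have h1 := oddDilog_add_inv (zero_lt_one.trans h)
      have h2 := hB y⁻¹ ⟨by positivity, inv_le_one_of_one_le₀ h.le⟩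
      rw [Real.norm_eq_abs] at h2
      rw [eq_sub_of_add_eq h1, abs_le]
      have : 0 ≤ Real.pi ^ 2 / 2 := by positivity
      constructor <;> linarith [(abs_le.1 h2).1, (abs_le.1 h2).2]
  refine ⟨Real.pi ^ 2 / 2 + B, fun y => ?_⟩
  rcases le_total 0 y with h | h
  · exact hpos y h
  · have := hpos (-y) (by linarith)
    rwa [oddDilog_neg, abs_neg] at this

/-- As `ε → 0`, `oddDilog (y / ε)` tends to `-π²/2` times the sign of `y`. -/
theorem tendsto_oddDilog_div (y : ℝ) :
    Tendsto (fun ε : ℝ => oddDilog (y / ε)) (𝓝[>] 0) (𝓝 (-(Real.pi ^ 2 / 2) * SignType.sign y)) := by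
  rcases lt_trichotomy y 0 with h | rfl | h
  · have : Tendsto (fun ε : ℝ => y / ε) (𝓝[>] 0) atBot := by
      simp only [div_eq_mul_inv]
      exact tendsto_inv_nhdsGT_zero.const_mul_atTop_of_neg h
    simpa [sign_neg h, Function.comp_def] using tendsto_oddDilog_atBot.comp this
  · simp [oddDilog_zero]
  · have : Tendsto (fun ε : ℝ => y / ε) (𝓝[>] 0) atTop := by
      simp only [div_eq_mul_inv]
      exact tendsto_inv_nhdsGT_zero.const_mul_atTop h
    simpa [sign_pos h, Function.comp_def] using tendsto_oddDilog_atTop.comp this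

/-- The absolute integrals of `ln |1 - v| / v` grow like a squared logarithm. -/
theorem exists_integral_abs_dilogKernel_le :
    ∃ C : ℝ, 0 ≤ C ∧ ∀ A : ℝ, 0 ≤ A →
      ∫ v in (-A)..A, |dilogKernel v| ≤ C + 2 * Real.log (1 + A) ^ 2 := by
  have hi : ∀ a b, IntervalIntegrable (fun v => |dilogKernel v|) volume a b :=
    fun a b => (intervalIntegrable_dilogKernel a b).abs
  have hmono : ∀ A, 0 ≤ A → A ≤ 2 →
      ∫ v in (-A)..A, |dilogKernel v| ≤ ∫ v in (-2 : ℝ)..2, |dilogKernel v| := by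
    intro A h0 hA
    refine intervalIntegral.integral_mono_interval (by linarith) (by linarith) hA
      (ae_of_all _ fun v => abs_nonneg _) (hi _ _)
  refine ⟨∫ v in (-2 : ℝ)..2, |dilogKernel v|,
    intervalIntegral.integral_nonneg (by norm_num) fun v _ => abs_nonneg _, fun A hA => ?_⟩
  rcases le_or_gt A 2 with h | h
  · have := hmono A hA h
    have : 0 ≤ Real.log (1 + A) ^ 2 := sq_nonneg _
    linarith
  · have hlogA : 0 ≤ Real.log (1 + A) := Real.log_nonneg (by linarith)
    -- Beyond `|v| = 2` one has `1 ≤ |1 - v| ≤ 1 + A`, so the logarithm is nonnegative and at most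
    -- `ln (1 + A)`; the remaining `∫ dv / v` contributes another factor of that size.
    have hb : ∀ v : ℝ, 2 ≤ |v| → |v| ≤ A → |dilogKernel v| ≤ Real.log (1 + A) * (1 / |v|) := by
      intro v h2 hv
      rw [dilogKernel, abs_div, mul_one_div]
      have h1 : 1 ≤ |1 - v| := by
        have := abs_sub_abs_le_abs_sub v 1
        rw [abs_one, abs_sub_comm] at this
        linarith
      have h3 : |1 - v| ≤ 1 + A := by
        have := abs_sub 1 v
        rw [abs_one] at this
        linarith
      rw [← Real.log_abs (1 - v), abs_of_nonneg (Real.log_nonneg h1)]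
      gcongr
    have hinv : ∫ v in (2 : ℝ)..A, Real.log (1 + A) * (1 / v) ≤ Real.log (1 + A) ^ 2 := by
      rw [intervalIntegral.integral_const_mul, integral_one_div_of_pos (by norm_num) (by linarith),
        sq]
      refine mul_le_mul_of_nonneg_left (Real.log_le_log (by positivity) (by linarith)) hlogA
    have hii : IntervalIntegrable (fun v : ℝ => Real.log (1 + A) * (1 / v)) volume 2 A := by
      refine (intervalIntegral.intervalIntegrable_one_div (fun v hv => ?_) continuousOn_id).const_mul _
      rw [uIcc_of_le h.le] at hv
      exact (lt_of_lt_of_le two_pos hv.1).ne'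
    have h1 : ∫ v in (2 : ℝ)..A, |dilogKernel v| ≤ Real.log (1 + A) ^ 2 := by
      refine le_trans (intervalIntegral.integral_mono_on h.le (hi _ _) hii fun v hv => ?_) hinv
      have hv0 : |v| = v := abs_of_nonneg (by linarith [hv.1])
      have := hb v (by rw [hv0]; exact hv.1) (by rw [hv0]; exact hv.2)
      rwa [hv0] at this
    have h2 : ∫ v in (-A)..(-2 : ℝ), |dilogKernel v| ≤ Real.log (1 + A) ^ 2 := by
      rw [← intervalIntegral.integral_comp_neg]
      refine le_trans (intervalIntegral.integral_mono_on h.le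
        (by simpa using ((IntervalIntegrable.iff_comp_neg).1 (hi (-2) (-A)))) hii fun v hv => ?_) hinv
      have hv0 : |-v| = v := by rw [abs_neg]; exact abs_of_nonneg (by linarith [hv.1])
      have := hb (-v) (by rw [hv0]; exact hv.1) (by rw [hv0]; exact hv.2)
      rwa [hv0] at this
    rw [← intervalIntegral.integral_add_adjacent_intervals (hi (-A) (-2)) (hi _ _),
      ← intervalIntegral.integral_add_adjacent_intervals (hi (-2) 2) (hi _ _)]
    linarith

/-! ## Cauchy integrals of logarithms -/

/-- The Cauchy kernel `1 / (r - x)`, cut off at distance `ε` from `x`. -/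
def cut (x ε r : ℝ) : ℝ := (Ioo (x - ε) (x + ε))ᶜ.indicator (fun r => (r - x)⁻¹) r

/-- `ln |(e - s) / (t - s)|`. -/
def logDiff (t e s : ℝ) : ℝ := Real.log (e - s) - Real.log (t - s)

/-- The value of `∫_p^q ln |(e - s) / (t - s)| ds / (s - x)` for `x` outside `[p, q]`. -/
def dilogComb (x p q t e : ℝ) : ℝ :=
  dilog ((e - x) / (p - x)) - dilog ((e - x) / (q - x))
    - (dilog ((t - x) / (p - x)) - dilog ((t - x) / (q - x)))

theorem measurable_cut (x ε : ℝ) : Measurable (cut x ε) :=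
  (by fun_prop : Measurable fun r : ℝ => (r - x)⁻¹).indicator measurableSet_Ioo.compl

theorem measurable_logDiff (t e : ℝ) : Measurable (logDiff t e) := by
  unfold logDiff; fun_prop

theorem cut_of_mem {x ε r : ℝ} (h : r ∈ Ioo (x - ε) (x + ε)) : cut x ε r = 0 := by
  simp [cut, h]

theorem cut_of_notMem {x ε r : ℝ} (h : r ∉ Ioo (x - ε) (x + ε)) : cut x ε r = (r - x)⁻¹ := by
  simp only [cut, indicator, mem_compl_iff, h, not_false_eq_true, if_true]

theorem setIntegral_diff_Ioo {D : Set ℝ} (f : ℝ → ℝ) (x ε : ℝ) :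
    ∫ r in D \ Ioo (x - ε) (x + ε), f r / (r - x) = ∫ r in D, cut x ε r * f r := by
  rw [sdiff_eq, ← setIntegral_indicator measurableSet_Ioo.compl]
  refine integral_congr_ae (ae_of_all _ fun r => ?_)
  simp only [cut, indicator]
  split_ifs
  · rw [div_eq_inv_mul]
  · rw [zero_mul]

theorem integrableOn_diff_Ioo {D : Set ℝ} (f : ℝ → ℝ) (x ε : ℝ) :
    IntegrableOn (fun r => f r / (r - x)) (D \ Ioo (x - ε) (x + ε)) ↔
      IntegrableOn (fun r => cut x ε r * f r) D := by
  rw [sdiff_eq, inter_comm, ← integrableOn_indicator_iff measurableSet_Ioo.compl]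
  refine iff_of_eq (congrArg (fun f => IntegrableOn f D) (funext fun r => ?_))
  simp only [cut, indicator]
  split_ifs
  · rw [div_eq_inv_mul]
  · rw [zero_mul]

theorem intervalIntegrable_logDiff (t e a b : ℝ) :
    IntervalIntegrable (logDiff t e) volume a b :=
  (intervalIntegrable_log_sub_left e a b).sub (intervalIntegrable_log_sub_left t a b)

/-- Write `ln |e - s| = ln |e| + ln |1 - s / e|`: the first term integrates to a logarithm, the
second is a rescaled `dilogKernel`. -/
theorem integral_log_sub_div {p q e : ℝ} (hpq : 0 < p * q) (he : e ≠ 0) :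
    ∫ s in p..q, Real.log (e - s) / s
      = Real.log e * (Real.log q - Real.log p) + (dilog (q / e) - dilog (p / e)) := by
  have h0 : (0 : ℝ) ∉ uIcc p q := by
    intro h
    rw [mem_uIcc] at h
    rcases h with h | h <;> nlinarith
  have hp : p ≠ 0 := left_ne_zero_of_mul hpq.ne'
  have hq : q ≠ 0 := right_ne_zero_of_mul hpq.ne'
  have hk : ∫ s in p..q, e⁻¹ * dilogKernel (s / e) = dilog (q / e) - dilog (p / e) := by
    rw [intervalIntegral.integral_const_mul, intervalIntegral.integral_comp_div _ he, dilog_sub,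
      smul_eq_mul, ← mul_assoc, inv_mul_cancel₀ he, one_mul]
  have hki : IntervalIntegrable (fun s => e⁻¹ * dilogKernel (s / e)) volume p q := by
    refine IntervalIntegrable.const_mul ?_ _
    have := (intervalIntegrable_dilogKernel (p / e) (q / e)).comp_mul_right (c := e⁻¹)
    simpa [div_eq_mul_inv, he] using this
  have h1 : ∫ s in p..q, Real.log e * (1 / s) = Real.log e * (Real.log q - Real.log p) := by
    rw [intervalIntegral.integral_const_mul, integral_one_div h0, Real.log_div hq hp]
  have h1i : IntervalIntegrable (fun s => Real.log e * (1 / s)) volume p q :=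
    (intervalIntegral.intervalIntegrable_one_div (fun v hv h => h0 (h ▸ hv))
      continuousOn_id).const_mul _
  rw [← h1, ← hk, ← intervalIntegral.integral_add h1i hki]
  refine intervalIntegral.integral_congr_ae ?_
  -- At `s = e` the splitting of the logarithm can fail because `Real.log 0 = 0`.
  have hae : ∀ᵐ s : ℝ, s ≠ e := by simp [ae_iff]
  filter_upwards [hae] with s hs hmem
  have hs0 : s ≠ 0 := fun h => h0 (h ▸ uIoc_subset_uIcc hmem)
  have : Real.log (1 - s / e) = Real.log (e - s) - Real.log e := by
    rw [← Real.log_div (sub_ne_zero.2 hs.symm) he]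
    congr 1
    field_simp
  rw [dilogKernel, this]
  field_simp
  ring

/-- After translating `x` to `0`, inversion replaces the arguments `q / c`, `p / c` by `c / q`, `c /
p`. The cross terms of the squared logarithms cancel the products of logarithms, and what remains
does not depend on `c`, so it drops out between `c = e` and `c = t`. The inverted arguments tend to
`0` when `p`, `q` go to infinity, and they are the ones met when integrating `logKernel`. -/
theorem integral_logDiff_div {x p q t e : ℝ} (hpq : 0 < (p - x) * (q - x)) (ht : t ≠ x)
    (he : e ≠ x) :
    ∫ s in p..q, (s - x)⁻¹ * logDiff t e s = dilogComb x p q t e := by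
  have hshift : ∫ s in p..q, (s - x)⁻¹ * logDiff t e s
      = ∫ s in (p - x)..(q - x), s⁻¹ * logDiff (t - x) (e - x) s := by
    rw [← intervalIntegral.integral_comp_sub_right]
    simp [logDiff]
  have ht' := sub_ne_zero.2 ht
  have he' := sub_ne_zero.2 he
  rw [hshift, dilogComb]
  set p' := p - x
  set q' := q - x
  set t' := t - x
  set e' := e - x
  have h0 : ∀ v ∈ uIcc p' q', v ≠ 0 := by
    rintro v hv rfl
    rw [mem_uIcc] at hv
    rcases hv with h | h <;> nlinarith
  have hi : ∀ c, IntervalIntegrable (fun s => Real.log (c - s) / s) volume p' q' := by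
    intro c
    simp only [div_eq_mul_inv]
    exact (intervalIntegrable_log_sub_left c p' q').mul_continuousOn (continuousOn_id.inv₀ h0)
  have hsplit : ∫ s in p'..q', s⁻¹ * logDiff t' e' s
      = (∫ s in p'..q', Real.log (e' - s) / s) - ∫ s in p'..q', Real.log (t' - s) / s := by
    rw [← intervalIntegral.integral_sub (hi _) (hi _)]
    refine intervalIntegral.integral_congr fun s _ => ?_
    simp only [logDiff]
    ring
  have hp : p' ≠ 0 := left_ne_zero_of_mul hpq.ne'
  have hq : q' ≠ 0 := right_ne_zero_of_mul hpq.ne'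
  have hR : ∀ c : ℝ, c ≠ 0 → dilog (q' / c) + dilog (c / q') - (dilog (p' / c) + dilog (c / p'))
      = ((Real.log q' - Real.log c) ^ 2 - (Real.log p' - Real.log c) ^ 2) / 2 := by
    intro c hc
    have := dilog_add_dilog_inv_sub (y := q' / c) (z := p' / c) (by
      rw [div_mul_div_comm, mul_comm q']
      exact div_pos hpq (mul_self_pos.2 hc))
    rwa [inv_div, inv_div, Real.log_div hq hc, Real.log_div hp hc] at this
  have r1 := hR e' he'
  have r2 := hR t' ht'
  rw [hsplit, integral_log_sub_div hpq he', integral_log_sub_div hpq ht']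
  linarith

/-- The window contributes nothing, and on each side of it the closed form applies. The terms from
the inner end points `x ± ε` have arguments `±c / ε` and pair up into `oddDilog`. -/
theorem integral_cut_logDiff_Icc {x ε a b t e : ℝ} (hε : 0 < ε) (ha : a ≤ x - ε) (hb : x + ε ≤ b)
    (ht : t ≠ x) (he : e ≠ x) :
    ∫ s in a..b, cut x ε s * logDiff t e s
      = dilogComb x a b t e + (oddDilog ((e - x) / ε) - oddDilog ((t - x) / ε)) := by
  have e1 : ∫ s in a..(x - ε), cut x ε s * logDiff t e s = dilogComb x a (x - ε) t e := by
    rw [← integral_logDiff_div (by nlinarith) ht he]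
    refine intervalIntegral.integral_congr fun s hs => ?_
    rw [uIcc_of_le ha] at hs
    simp only [cut_of_notMem (fun h : s ∈ Ioo (x - ε) (x + ε) => absurd h.1 (not_lt.2 hs.2))]
  have e3 : ∫ s in (x + ε)..b, cut x ε s * logDiff t e s = dilogComb x (x + ε) b t e := by
    rw [← integral_logDiff_div (by nlinarith) ht he]
    refine intervalIntegral.integral_congr fun s hs => ?_
    rw [uIcc_of_le hb] at hs
    simp only [cut_of_notMem (fun h : s ∈ Ioo (x - ε) (x + ε) => absurd h.2 (not_lt.2 hs.1))]
  have e2 : ∫ s in (x - ε)..(x + ε), cut x ε s * logDiff t e s = 0 := by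
    rw [intervalIntegral.integral_of_le (by linarith), integral_Ioc_eq_integral_Ioo]
    refine setIntegral_eq_zero_of_forall_eq_zero fun s hs => ?_
    rw [cut_of_mem hs, zero_mul]
  have hbd : ∀ s, ‖cut x ε s‖ ≤ ε⁻¹ := by
    intro s
    by_cases h : s ∈ Ioo (x - ε) (x + ε)
    · rw [cut_of_mem h]; simpa using hε.le
    · rw [cut_of_notMem h, norm_inv, Real.norm_eq_abs]
      refine inv_anti₀ hε ?_
      rw [← Real.ball_eq_Ioo, Metric.mem_ball, Real.dist_eq, not_lt] at h
      exact h
  have hi : ∀ c d, IntervalIntegrable (fun s => cut x ε s * logDiff t e s) volume c d := by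
    intro c d
    refine ((intervalIntegrable_logDiff t e c d).norm.const_mul ε⁻¹).mono_fun'
      ((measurable_cut x ε).mul (measurable_logDiff t e)).aestronglyMeasurable
      (ae_of_all _ fun s => ?_)
    refine (norm_mul _ _).le.trans ?_
    exact mul_le_mul_of_nonneg_right (hbd s) (norm_nonneg _)
  rw [← intervalIntegral.integral_add_adjacent_intervals (hi a (x - ε)) (hi _ b),
    ← intervalIntegral.integral_add_adjacent_intervals (hi (x - ε) (x + ε)) (hi _ b), e1, e2, e3]
  simp only [dilogComb, oddDilog, sub_sub_cancel_left, add_sub_cancel_left, div_neg]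
  ring

/-! ### Bounds -/

/-- `a ln (1 + z) = ln (1 + z)^a ≤ (1 + z)^a - 1 ≤ z^a`, by subadditivity of the power `a ≤ 1`. -/
theorem log_one_add_le_rpow {a z : ℝ} (ha : 0 < a) (ha1 : a ≤ 1) (hz : 0 ≤ z) :
    Real.log (1 + z) ≤ a⁻¹ * z ^ a := by
  have h1 : a * Real.log (1 + z) ≤ z ^ a := by
    rw [← Real.log_rpow (by linarith)]
    have h2 := Real.log_le_sub_one_of_pos (x := (1 + z) ^ a) (by positivity)
    have h3 := Real.rpow_add_le_add_rpow zero_le_one hz ha.le ha1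
    rw [Real.one_rpow] at h3
    linarith
  rw [le_inv_mul_iff₀ ha]
  exact h1

/-- Since `|s - e| / |s - t| ≤ 1 + |t - e| / |s - t|`, the previous inequality bounds the logarithm
on one side; exchanging `t` and `e` bounds it on the other. The logarithmic singularities become
integrable powers in `s`, at the price of the slowly growing factor `|t - e| ^ a`. -/
theorem abs_logDiff_le {a t e s : ℝ} (ha : 0 < a) (ha1 : a ≤ 1) (ht : s ≠ t) (he : s ≠ e) :
    |logDiff t e s| ≤ a⁻¹ * |t - e| ^ a * (|s - t| ^ (-a) + |s - e| ^ (-a)) := by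
  have key : ∀ t e : ℝ, s ≠ t → s ≠ e →
      Real.log (e - s) - Real.log (t - s) ≤ a⁻¹ * |t - e| ^ a * |s - t| ^ (-a) := by
    intro t e ht he
    have hp : 0 < |s - t| := abs_pos.2 (sub_ne_zero.2 ht)
    have hq : 0 < |s - e| := abs_pos.2 (sub_ne_zero.2 he)
    rw [← Real.log_abs (e - s), ← Real.log_abs (t - s), abs_sub_comm e s, abs_sub_comm t s,
      ← Real.log_div hq.ne' hp.ne']
    have h1 : |s - e| / |s - t| ≤ 1 + |t - e| / |s - t| := by
      rw [div_le_iff₀ hp, add_mul, div_mul_cancel₀ _ hp.ne', one_mul]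
      have := abs_add_le (s - t) (t - e)
      simpa using this
    refine (Real.log_le_log (by positivity) h1).trans
      ((log_one_add_le_rpow ha ha1 (by positivity)).trans (le_of_eq ?_))
    rw [Real.div_rpow (abs_nonneg _) (abs_nonneg _), Real.rpow_neg (abs_nonneg _)]
    ring
  have h1 := key t e ht he
  have h2 := key e t he ht
  rw [abs_sub_comm e t] at h2
  have n1 : 0 ≤ a⁻¹ * |t - e| ^ a * |s - t| ^ (-a) := by positivity
  have n2 : 0 ≤ a⁻¹ * |t - e| ^ a * |s - e| ^ (-a) := by positivity
  rw [logDiff, mul_add, abs_le]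
  constructor <;> linarith

theorem integrable_one_add_abs_rpow {a : ℝ} (ha : 0 < a) :
    Integrable fun s : ℝ => (1 + |s|) ^ (-(1 + a)) := by
  have := integrable_one_add_norm (E := ℝ) (μ := volume) (r := 1 + a) (by simpa using ha)
  simpa only [Real.norm_eq_abs] using this

theorem abs_cut_le {x ε : ℝ} (hε : 0 < ε) (s : ℝ) :
    |cut x ε s| ≤ (1 + (1 + |x|) / ε) * (1 + |s|)⁻¹ := by
  by_cases h : s ∈ Ioo (x - ε) (x + ε)
  · rw [cut_of_mem h, abs_zero]; positivity
  · rw [cut_of_notMem h, abs_inv]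
    rw [← Real.ball_eq_Ioo, Metric.mem_ball, Real.dist_eq, not_lt] at h
    have hp : 0 < |s - x| := hε.trans_le h
    rw [← div_eq_mul_inv, le_div_iff₀ (by positivity), inv_mul_le_iff₀ hp]
    have h1 : |s| ≤ |s - x| + |x| := by simpa using abs_add_le (s - x) x
    have h2 : (1 + |x|) ≤ |s - x| * ((1 + |x|) / ε) := by
      rw [mul_div_assoc', le_div_iff₀ hε, mul_comm]
      exact mul_le_mul_of_nonneg_right h (by positivity)
    nlinarith

/-- The majorant is a translate `k (s - p)` plus a fixed function `m s`, so its integral does not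
depend on `p`. Within distance `1` of `p` the local singularity is kept; farther away the smaller of
`|s - p|` and `1 + |s|` takes over the whole exponent `1 + a`. -/
theorem exists_integral_rpow_div_le {a : ℝ} (ha : 0 < a) (ha1 : a < 1) :
    ∃ C : ℝ, 0 ≤ C ∧ ∀ p : ℝ, Integrable (fun s : ℝ => |s - p| ^ (-a) * (1 + |s|)⁻¹) ∧
      ∫ s : ℝ, |s - p| ^ (-a) * (1 + |s|)⁻¹ ≤ C := by
  let k : ℝ → ℝ := fun u => (Ioo (-1 : ℝ) 1).indicator (fun u => |u| ^ (-a)) u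
    + 4 * (1 + |u|) ^ (-(1 + a))
  let m : ℝ → ℝ := fun s => (1 + |s|) ^ (-(1 + a))
  have hm : Integrable m := integrable_one_add_abs_rpow ha
  have hk : Integrable k := by
    refine Integrable.add ?_ ((integrable_one_add_abs_rpow ha).const_mul 4)
    rw [integrable_indicator_iff measurableSet_Ioo]
    have h1 : IntervalIntegrable (fun u : ℝ => |u| ^ (-a)) volume (-1) 1 := by
      have h01 : IntervalIntegrable (fun u : ℝ => |u| ^ (-a)) volume 0 1 := by
        refine (intervalIntegral.intervalIntegrable_rpow' (by linarith : -1 < -a)).congr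
          fun u hu => ?_
        rw [uIoc_of_le zero_le_one] at hu
        simp only [abs_of_pos hu.1]
      have h10 : IntervalIntegrable (fun u : ℝ => |u| ^ (-a)) volume (-1) 0 := by
        have := (IntervalIntegrable.iff_comp_neg).1 h01
        simpa using this.symm
      exact h10.trans h01
    exact ((intervalIntegrable_iff_integrableOn_Ioc_of_le (by norm_num)).1 h1).mono_set
      Ioo_subset_Ioc_self
  have hle : ∀ p s : ℝ, |s - p| ^ (-a) * (1 + |s|)⁻¹ ≤ k (s - p) + m s := by
    intro p s
    have hm0 : 0 ≤ m s := by positivity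
    have hc1 : (1 + |s|)⁻¹ ≤ 1 := inv_le_one_of_one_le₀ (by linarith [abs_nonneg s])
    by_cases h : s - p ∈ Ioo (-1 : ℝ) 1
    · have h4 : 0 ≤ 4 * (1 + |s - p|) ^ (-(1 + a)) := by positivity
      simp only [k, indicator_of_mem h]
      have : |s - p| ^ (-a) * (1 + |s|)⁻¹ ≤ |s - p| ^ (-a) :=
        mul_le_of_le_one_right (by positivity) hc1
      linarith
    · simp only [k, indicator_of_notMem h, zero_add]
      have hu : 1 ≤ |s - p| := by
        rw [← not_lt, abs_lt]
        exact h
      have hup : 0 < |s - p| := by linarith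
      rcases le_total |s - p| (1 + |s|) with h1 | h1
      · have e1 : |s - p| ^ (-a) * (1 + |s|)⁻¹ ≤ |s - p| ^ (-(1 + a)) := by
          rw [show -(1 + a) = -a + -1 by ring, Real.rpow_add hup, Real.rpow_neg_one]
          gcongr
        have e2 : |s - p| ^ (-(1 + a)) ≤ 4 * (1 + |s - p|) ^ (-(1 + a)) := by
          rw [Real.rpow_neg hup.le, Real.rpow_neg (by positivity), ← div_eq_mul_inv,
            inv_eq_one_div, div_le_div_iff₀ (by positivity) (by positivity), one_mul]
          calc (1 + |s - p|) ^ (1 + a) ≤ (2 * |s - p|) ^ (1 + a) := by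
                gcongr; linarith
            _ = 2 ^ (1 + a) * |s - p| ^ (1 + a) := Real.mul_rpow (by norm_num) hup.le
            _ ≤ 4 * |s - p| ^ (1 + a) := by
                gcongr
                calc (2 : ℝ) ^ (1 + a) ≤ 2 ^ (2 : ℝ) :=
                      Real.rpow_le_rpow_of_exponent_le (by norm_num) (by linarith)
                  _ = 4 := by norm_num
        linarith
      · have e1 : |s - p| ^ (-a) * (1 + |s|)⁻¹ ≤ m s := by
          simp only [m]
          rw [show -(1 + a) = -a + -1 by ring, Real.rpow_add (by positivity), Real.rpow_neg_one]
          refine mul_le_mul_of_nonneg_right ?_ (by positivity)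
          exact Real.rpow_le_rpow_of_nonpos (by positivity) h1 (by linarith)
        have : 0 ≤ 4 * (1 + |s - p|) ^ (-(1 + a)) := by positivity
        linarith
  have hint : ∀ p : ℝ, Integrable (fun s => k (s - p) + m s) :=
    fun p => (hk.comp_sub_right p).add hm
  have hnn : ∀ p s : ℝ, 0 ≤ |s - p| ^ (-a) * (1 + |s|)⁻¹ := fun p s => by positivity
  refine ⟨(∫ u, k u) + ∫ s, m s, ?_, fun p => ?_⟩
  · refine add_nonneg (integral_nonneg fun u => ?_) (integral_nonneg fun s => by positivity)
    refine add_nonneg (indicator_nonneg (fun u _ => by positivity) _) (by positivity)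
  · have hi : Integrable (fun s : ℝ => |s - p| ^ (-a) * (1 + |s|)⁻¹) := by
      refine (hint p).mono' (by fun_prop) (ae_of_all _ fun s => ?_)
      rw [Real.norm_of_nonneg (hnn p s)]
      exact hle p s
    refine ⟨hi, (integral_mono hi (hint p) (hle p)).trans (le_of_eq ?_)⟩
    rw [integral_add (hk.comp_sub_right p) hm, integral_sub_right_eq_self]

/-- The constant may depend on `x` and `ε` but not on `t`, `e`: this is what makes Fubini applicable
against a density in `t`. -/
theorem exists_integral_cut_logDiff_le {a ε : ℝ} (ha : 0 < a) (ha1 : a < 1) (x : ℝ) (hε : 0 < ε) :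
    ∃ C : ℝ, 0 ≤ C ∧ ∀ t e : ℝ, Integrable (fun s => cut x ε s * logDiff t e s) ∧
      ∫ s, |cut x ε s * logDiff t e s| ≤ C * |t - e| ^ a := by
  obtain ⟨C, hC, h⟩ := exists_integral_rpow_div_le ha ha1
  let c : ℝ := 1 + (1 + |x|) / ε
  have hc : 0 ≤ c := by positivity
  refine ⟨c * a⁻¹ * (C + C), by positivity, fun t e => ?_⟩
  have hae : ∀ᵐ s : ℝ, s ≠ t ∧ s ≠ e := by
    have : ∀ q : ℝ, ∀ᵐ s : ℝ, s ≠ q := fun q => by simp [ae_iff]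
    exact (this t).and (this e)
  have hle : ∀ᵐ s : ℝ, |cut x ε s * logDiff t e s| ≤ c * a⁻¹ * |t - e| ^ a *
      (|s - t| ^ (-a) * (1 + |s|)⁻¹ + |s - e| ^ (-a) * (1 + |s|)⁻¹) := by
    filter_upwards [hae] with s hs
    rw [abs_mul]
    refine (mul_le_mul (abs_cut_le hε s) (abs_logDiff_le ha ha1.le hs.1 hs.2) (abs_nonneg _)
      (by positivity)).trans (le_of_eq ?_)
    ring
  have hint := ((h t).1.add (h e).1).const_mul (c * a⁻¹ * |t - e| ^ a)
  have hi : Integrable (fun s => cut x ε s * logDiff t e s) :=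
    hint.mono' ((measurable_cut x ε).mul (measurable_logDiff t e)).aestronglyMeasurable hle
  refine ⟨hi, (integral_mono_ae hi.abs hint hle).trans ?_⟩
  simp only [Pi.add_apply]
  rw [integral_const_mul, integral_add (h t).1 (h e).1]
  have := add_le_add (h t).2 (h e).2
  calc _ ≤ c * a⁻¹ * |t - e| ^ a * (C + C) := by gcongr
    _ = _ := by ring

/-- Exhaust the line by `[-R, R]`: every dilogarithm in `dilogComb` has an argument tending to `0`,
so only the contribution of the window is left. -/
theorem integral_cut_logDiff {x ε t e : ℝ} (hε : 0 < ε) (ht : t ≠ x) (he : e ≠ x) :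
    ∫ s, cut x ε s * logDiff t e s = oddDilog ((e - x) / ε) - oddDilog ((t - x) / ε) := by
  obtain ⟨C, -, h⟩ := exists_integral_cut_logDiff_le (a := 1 / 2) (by norm_num) (by norm_num) x hε
  have h1 := intervalIntegral_tendsto_integral (h t e).1 tendsto_neg_atTop_atBot tendsto_id
  have hz : ∀ c : ℝ, Tendsto (fun R : ℝ => dilog (c / (R - x))) atTop (𝓝 0) ∧
      Tendsto (fun R : ℝ => dilog (c / (-R - x))) atTop (𝓝 0) := by
    intro c
    have hd : Tendsto dilog (𝓝 0) (𝓝 0) := by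
      simpa [dilog_zero] using continuous_dilog.tendsto 0
    exact ⟨hd.comp (tendsto_const_nhds.div_atTop (tendsto_atTop_add_const_right _ _ tendsto_id)),
      hd.comp (tendsto_const_nhds.div_atBot
        (tendsto_atBot_add_const_right _ _ tendsto_neg_atTop_atBot))⟩
  have h2 : Tendsto (fun R : ℝ => dilogComb x (-R) R t e
      + (oddDilog ((e - x) / ε) - oddDilog ((t - x) / ε))) atTop
      (𝓝 (0 - 0 - (0 - 0) + (oddDilog ((e - x) / ε) - oddDilog ((t - x) / ε)))) :=
    (((hz _).2.sub (hz _).1).sub ((hz _).2.sub (hz _).1)).add tendsto_const_nhds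
  simp only [sub_zero, zero_add] at h2
  refine tendsto_nhds_unique h1 (h2.congr' ?_)
  filter_upwards [eventually_ge_atTop (|x| + ε)] with R hR
  have := abs_le.1 (le_sub_iff_add_le.2 hR)
  exact (integral_cut_logDiff_Icc hε (by linarith) (show x + ε ≤ R by linarith) ht he).symm

theorem ae_ne (q : ℝ) : ∀ᵐ s : ℝ, s ≠ q := by simp [ae_iff]

/-! ## The logarithmic kernel -/

namespace Problem

variable (P : Problem) {x : ℝ}

theorem sub_ne_zero_of_abs_ne (hx : |x| ≠ P.l) (hl : 0 < P.l) : P.l - x ≠ 0 ∧ -P.l - x ≠ 0 := by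
  constructor
  · intro h
    exact hx (by rw [show x = P.l by linarith, abs_of_pos hl])
  · intro h
    exact hx (by rw [show x = -P.l by linarith, abs_neg, abs_of_pos hl])

/-- Because `1 - (r - x) / (±l - x) = (l ∓ r) / (l ∓ x)`, the logarithm splits into one rescaled
`dilogKernel` per tip. At `r = x` both sides are `0` by the convention on division. -/
theorem logKernel_eq (hl : 0 < P.l) (hx : |x| ≠ P.l) {r : ℝ} (h1 : r ≠ P.l) (h2 : r ≠ -P.l) :
    P.logKernel x r = (-P.l - x)⁻¹ * dilogKernel ((r - x) / (-P.l - x))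
      - (P.l - x)⁻¹ * dilogKernel ((r - x) / (P.l - x)) := by
  obtain ⟨hp, hm⟩ := P.sub_ne_zero_of_abs_ne hx hl
  have hr1 : P.l - r ≠ 0 := sub_ne_zero.2 h1.symm
  have hr2 : -P.l - r ≠ 0 := sub_ne_zero.2 h2.symm
  have hr2' : P.l + r ≠ 0 := fun h => hr2 (by linarith)
  have hm' : P.l + x ≠ 0 := fun h => hm (by linarith)
  have e1 : Real.log (1 - (r - x) / (-P.l - x)) = Real.log (P.l + r) - Real.log (P.l + x) := by
    rw [← Real.log_div hr2' hm']
    congr 1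
    field_simp
    ring
  have e2 : Real.log (1 - (r - x) / (P.l - x)) = Real.log (P.l - r) - Real.log (P.l - x) := by
    rw [← Real.log_div hr1 hp]
    congr 1
    field_simp
    ring
  rw [logKernel, Real.log_abs, Real.log_div (mul_ne_zero hp hr2') (mul_ne_zero hm' hr1),
    Real.log_mul hp hr2', Real.log_mul hm' hr1, dilogKernel, dilogKernel, e1, e2]
  rcases eq_or_ne (r - x) 0 with h | h
  · simp [h]
  · field_simp
    ring

theorem logKernel_ae_eq (hl : 0 < P.l) (hx : |x| ≠ P.l) :
    P.logKernel x =ᵐ[volume] fun r => (-P.l - x)⁻¹ * dilogKernel ((r - x) / (-P.l - x))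
      - (P.l - x)⁻¹ * dilogKernel ((r - x) / (P.l - x)) := by
  filter_upwards [ae_ne P.l, ae_ne (-P.l)] with r h1 h2
  exact P.logKernel_eq hl hx h1 h2

theorem measurable_logKernel : Measurable (Function.uncurry P.logKernel) := by
  unfold logKernel Function.uncurry
  fun_prop

theorem measurable_logKernel_right (x : ℝ) : Measurable (P.logKernel x) :=
  P.measurable_logKernel.comp measurable_prodMk_left

theorem intervalIntegrable_dilogKernel_scaled {c : ℝ} (hc : c ≠ 0) (x a b : ℝ) :
    IntervalIntegrable (fun r => c⁻¹ * dilogKernel ((r - x) / c)) volume a b := by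
  refine IntervalIntegrable.const_mul ?_ _
  have h := ((intervalIntegrable_dilogKernel ((a - x) / c) ((b - x) / c)).comp_mul_right
    (c := c⁻¹)).comp_sub_right x
  simpa [div_eq_mul_inv, hc] using h

theorem integral_dilogKernel_scaled {c : ℝ} (hc : c ≠ 0) (x a b : ℝ) :
    ∫ r in a..b, c⁻¹ * dilogKernel ((r - x) / c)
      = dilog ((b - x) / c) - dilog ((a - x) / c) := by
  rw [intervalIntegral.integral_const_mul,
    intervalIntegral.integral_comp_sub_right (fun r => dilogKernel (r / c)),
    intervalIntegral.integral_comp_div _ hc, dilog_sub, smul_eq_mul, ← mul_assoc,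
    inv_mul_cancel₀ hc, one_mul]

theorem intervalIntegrable_logKernel (hl : 0 < P.l) (hx : |x| ≠ P.l) (a b : ℝ) :
    IntervalIntegrable (P.logKernel x) volume a b := by
  obtain ⟨hp, hm⟩ := P.sub_ne_zero_of_abs_ne hx hl
  refine ((intervalIntegrable_dilogKernel_scaled hm x a b).sub
    (intervalIntegrable_dilogKernel_scaled hp x a b)).congr_ae ?_
  exact (ae_restrict_of_ae (P.logKernel_ae_eq hl hx)).mono fun r hr => hr.symm

/-- The result is the same `dilogComb` as in `integral_logDiff_div`; this coincidence is the
interchange of the two integrations for a single segment. -/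
theorem integral_logKernel (hl : 0 < P.l) (hx : |x| ≠ P.l) (t e : ℝ) :
    ∫ r in t..e, P.logKernel x r = dilogComb x (-P.l) P.l t e := by
  obtain ⟨hp, hm⟩ := P.sub_ne_zero_of_abs_ne hx hl
  rw [intervalIntegral.integral_congr_ae ((P.logKernel_ae_eq hl hx).mono fun r hr _ => hr),
    intervalIntegral.integral_sub (intervalIntegrable_dilogKernel_scaled hm x t e)
      (intervalIntegrable_dilogKernel_scaled hp x t e),
    integral_dilogKernel_scaled hm, integral_dilogKernel_scaled hp, dilogComb]
  ring

/-- Rescaling by the distance `|c|` from `x` to a tip enlarges the interval to half-length at most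
`(R + |x|) / |c|`, and the absolute integral of `dilogKernel` grows only like a squared logarithm.
For negative `c` the rescaling includes a reflection. -/
theorem exists_integral_abs_logKernel_le (hl : 0 < P.l) :
    ∃ C : ℝ, 0 ≤ C ∧ ∀ x : ℝ, |x| ≠ P.l → ∀ R : ℝ, 0 ≤ R →
      ∫ r in (-R)..R, |P.logKernel x r| ≤ C + 2 * Real.log (1 + (R + |x|) / |-P.l - x|) ^ 2
        + 2 * Real.log (1 + (R + |x|) / |P.l - x|) ^ 2 := by
  obtain ⟨C, hC, h⟩ := exists_integral_abs_dilogKernel_le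
  have key : ∀ c x R : ℝ, c ≠ 0 → 0 ≤ R → ∫ r in (-R)..R, |c⁻¹ * dilogKernel ((r - x) / c)|
      ≤ C + 2 * Real.log (1 + (R + |x|) / |c|) ^ 2 := by
    intro c x R hc hR
    have hcp : 0 < |c| := abs_pos.2 hc
    have hA : 0 ≤ (R + |x|) / |c| := by positivity
    refine le_trans ?_ (h _ hA)
    have hi : ∀ a b, IntervalIntegrable (fun v => |dilogKernel v|) volume a b :=
      fun a b => (intervalIntegrable_dilogKernel a b).abs
    have hscale : ∀ d : ℝ, 0 < d → ∀ g : ℝ → ℝ,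
        ∫ r in (-R)..R, d⁻¹ * g ((r - x) / d) = ∫ v in ((-R - x) / d)..((R - x) / d), g v := by
      intro d hd g
      rw [intervalIntegral.integral_const_mul,
        intervalIntegral.integral_comp_sub_right (fun r => g (r / d)),
        intervalIntegral.integral_comp_div _ hd.ne', smul_eq_mul, ← mul_assoc,
        inv_mul_cancel₀ hd.ne', one_mul]
    have hmono : ∀ g : ℝ → ℝ, (∀ a b, IntervalIntegrable g volume a b) → (∀ v, 0 ≤ g v) →
        ∫ r in (-R)..R, |c|⁻¹ * g ((r - x) / |c|)
          ≤ ∫ v in (-((R + |x|) / |c|))..((R + |x|) / |c|), g v := by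
      intro g hg hg0
      rw [hscale _ hcp]
      refine intervalIntegral.integral_mono_interval ?_ ?_ ?_ (ae_of_all _ hg0) (hg _ _)
      · rw [← neg_div]
        gcongr
        linarith [le_abs_self x]
      · gcongr
        linarith
      · gcongr
        linarith [neg_abs_le x]
    rcases lt_or_gt_of_ne hc with hc' | hc'
    · have e1 := hmono (fun v => |dilogKernel (-v)|)
        (fun a b => by simpa using (IntervalIntegrable.iff_comp_neg).1 (hi (-a) (-b)))
        (fun v => abs_nonneg _)
      rw [intervalIntegral.integral_comp_neg (fun v => |dilogKernel v|), neg_neg] at e1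
      refine le_trans (le_of_eq ?_) e1
      refine intervalIntegral.integral_congr fun r _ => ?_
      simp only [abs_mul, abs_inv, abs_of_neg hc', div_neg, neg_neg]
    · refine le_trans (le_of_eq ?_) (hmono _ hi fun v => abs_nonneg _)
      refine intervalIntegral.integral_congr fun r _ => ?_
      simp only [abs_mul, abs_inv, abs_of_pos hc']
  refine ⟨C + C, by positivity, fun x hx R hR => ?_⟩
  obtain ⟨hp, hm⟩ := P.sub_ne_zero_of_abs_ne hx hl
  have im := (intervalIntegrable_dilogKernel_scaled hm x (-R) R).abs
  have ip := (intervalIntegrable_dilogKernel_scaled hp x (-R) R).abs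
  have hle : ∫ r in (-R)..R, |P.logKernel x r| ≤ ∫ r in (-R)..R,
      (|(-P.l - x)⁻¹ * dilogKernel ((r - x) / (-P.l - x))|
        + |(P.l - x)⁻¹ * dilogKernel ((r - x) / (P.l - x))|) := by
    refine intervalIntegral.integral_mono_ae (by linarith)
      (P.intervalIntegrable_logKernel hl hx _ _).abs (im.add ip) ?_
    filter_upwards [P.logKernel_ae_eq hl hx] with r hr
    rw [hr]
    exact abs_sub _ _
  rw [intervalIntegral.integral_add im ip] at hle
  have k1 := key _ x R hm hR
  have k2 := key _ x R hp hR
  linarith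

end Problem

/-! ### Weighted integrability -/

theorem aestronglyMeasurable_one_add_abs_rpow (c : ℝ) {μ : Measure ℝ} :
    AEStronglyMeasurable (fun s : ℝ => (1 + |s|) ^ c) μ :=
  (by fun_prop : Measurable fun s : ℝ => (1 + |s|) ^ c).aestronglyMeasurable

theorem abs_log_le_rpow_of_le {a ρ u : ℝ} (ha : 0 < a) (hρ : 0 < ρ) (hu : ρ ≤ |u|) :
    |Real.log u| ≤ |Real.log ρ| + a⁻¹ * |u| ^ a := by
  have hu0 : 0 < |u| := hρ.trans_le hu
  rw [← Real.log_abs u, abs_le]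
  have h1 := Real.log_le_rpow_div hu0.le ha
  have h2 := Real.log_le_log hρ hu
  have h3 := neg_abs_le (Real.log ρ)
  have h4 := abs_nonneg (Real.log ρ)
  have h5 : 0 ≤ a⁻¹ * |u| ^ a := by positivity
  rw [div_eq_inv_mul] at h1
  constructor <;> linarith

theorem integrableOn_log_ball (x ρ : ℝ) :
    IntegrableOn (fun t => Real.log (t - x)) (Metric.ball x ρ) := by
  rw [Real.ball_eq_Ioo]
  rcases le_or_gt (x - ρ) (x + ρ) with h | h
  · have := (intervalIntegral.intervalIntegrable_log' (a := -ρ) (b := ρ)).comp_sub_right x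
    rw [intervalIntegrable_iff_integrableOn_Ioo_of_le (by linarith)] at this
    rwa [show -ρ + x = x - ρ by ring, show ρ + x = x + ρ by ring] at this
  · simp [Ioo_eq_empty (not_lt.2 h.le)]

/-- A density with a power weight, bounded near `x`, is integrable against `ln |t - x|`. -/
theorem integrableOn_log_mul {S : Set ℝ} {h : ℝ → ℝ} {a x ρ B : ℝ} (hS : MeasurableSet S)
    (ha : 0 < a) (hρ : 0 < ρ) (hint : IntegrableOn (fun t => (1 + |t|) ^ a * h t) S)
    (hm : AEStronglyMeasurable h (volume.restrict S))
    (hB : ∀ t ∈ S, |t - x| < ρ → |h t| ≤ B) :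
    IntegrableOn (fun t => Real.log (t - x) * h t) S := by
  let c : ℝ := |Real.log ρ| + a⁻¹ * (1 + |x|) ^ a
  have hfar : ∀ t, ρ ≤ |t - x| → |Real.log (t - x)| ≤ c * (1 + |t|) ^ a := by
    intro t ht
    refine (abs_log_le_rpow_of_le ha hρ ht).trans ?_
    have h1 : |t - x| ^ a ≤ (1 + |x|) ^ a * (1 + |t|) ^ a := by
      rw [← Real.mul_rpow (by positivity) (by positivity)]
      refine Real.rpow_le_rpow (abs_nonneg _) ?_ ha.le
      have := abs_sub t x
      nlinarith [abs_nonneg t, abs_nonneg x]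
    have h2 : 1 ≤ (1 + |t|) ^ a := Real.one_le_rpow (by linarith [abs_nonneg t]) ha.le
    have h3 : a⁻¹ * |t - x| ^ a ≤ a⁻¹ * ((1 + |x|) ^ a * (1 + |t|) ^ a) := by gcongr
    have h4 : |Real.log ρ| ≤ |Real.log ρ| * (1 + |t|) ^ a :=
      le_mul_of_one_le_right (abs_nonneg _) h2
    simp only [c]
    linarith
  have hI1 : Integrable ((Metric.ball x ρ).indicator (fun t => |Real.log (t - x)|)) := by
    rw [integrable_indicator_iff measurableSet_ball]
    exact (integrableOn_log_ball x ρ).abs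
  -- The absolute value is needed: if no point of `S` is near `x`, the bound `B` may be negative.
  have hdom : IntegrableOn (fun t => |B| * (Metric.ball x ρ).indicator
      (fun t => |Real.log (t - x)|) t + c * |(1 + |t|) ^ a * h t|) S :=
    (hI1.integrableOn.const_mul _).add (hint.abs.const_mul _)
  refine hdom.mono' (AEStronglyMeasurable.mul
    (by fun_prop : Measurable fun t => Real.log (t - x)).aestronglyMeasurable hm) ?_
  refine (ae_restrict_iff' hS).2 (ae_of_all _ fun t ht => ?_)
  rw [Real.norm_eq_abs, abs_mul, abs_mul, abs_of_nonneg (show (0 : ℝ) ≤ (1 + |t|) ^ a by positivity)]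
  by_cases hb : t ∈ Metric.ball x ρ
  · rw [indicator_of_mem hb]
    have h1 : |h t| ≤ |B| := (hB t ht hb).trans (le_abs_self B)
    have h2 : 0 ≤ c * ((1 + |t|) ^ a * |h t|) := by positivity
    have h3 := mul_le_mul_of_nonneg_left h1 (abs_nonneg (Real.log (t - x)))
    linarith
  · rw [indicator_of_notMem hb, mul_zero, zero_add, ← mul_assoc]
    refine mul_le_mul_of_nonneg_right (hfar t ?_) (abs_nonneg _)
    simpa [Real.dist_eq] using hb

theorem integrable_rpow_mul_log {a : ℝ} (ha : 0 < a) (p : ℝ) :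
    Integrable (fun s : ℝ => Real.log (s - p) * (1 + |s|) ^ (-(1 + a))) := by
  rw [← integrableOn_univ]
  -- Half of the spare exponent pays for the growth of the logarithm, the other half keeps the
  -- integral finite.
  refine integrableOn_log_mul (a := a / 2) (ρ := 1) (B := 1) MeasurableSet.univ (by positivity)
    one_pos ?_ (aestronglyMeasurable_one_add_abs_rpow _) fun t _ _ => ?_
  · rw [integrableOn_univ]
    refine (integrable_one_add_abs_rpow (half_pos ha)).congr (ae_of_all _ fun s => ?_)
    simp only []
    rw [← Real.rpow_add (by positivity)]
    congr 1
    ring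
  · rw [abs_of_nonneg (by positivity)]
    exact Real.rpow_le_one_of_one_le_of_nonpos (by linarith [abs_nonneg t]) (by linarith)

theorem integrable_rpow_mul_dilogKernel {a : ℝ} (ha : 0 < a) :
    Integrable (fun v : ℝ => (1 + |v|) ^ (-a) * dilogKernel v) := by
  have h := ((integrable_one_add_abs_rpow ha).add (integrable_rpow_mul_log ha 1).abs).const_mul 4
  refine h.mono' ((aestronglyMeasurable_one_add_abs_rpow _).mul
    measurable_dilogKernel.aestronglyMeasurable) (ae_of_all _ fun v => ?_)
  have hp : 0 < 1 + |v| := by positivity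
  rw [Real.norm_eq_abs, abs_mul, abs_of_nonneg (Real.rpow_nonneg hp.le _)]
  refine (mul_le_mul_of_nonneg_left (abs_dilogKernel_le v) (by positivity)).trans (le_of_eq ?_)
  simp only [Pi.add_apply, abs_mul, abs_of_nonneg (Real.rpow_nonneg hp.le (-(1 + a)))]
  rw [show -(1 + a) = -a + -1 by ring, Real.rpow_add hp, Real.rpow_neg_one,
    ← Real.log_neg_eq_log, neg_sub]
  field_simp

theorem integrable_rpow_mul_dilogKernel_scaled {a c : ℝ} (ha : 0 < a) (hc : c ≠ 0) (x : ℝ) :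
    Integrable (fun r : ℝ => (1 + |r|) ^ (-a) * (c⁻¹ * dilogKernel ((r - x) / c))) := by
  have h := (((integrable_rpow_mul_dilogKernel ha).comp_div hc).comp_sub_right x).abs.const_mul
    (((1 + (1 + |x|) / |c|)) ^ a * |c|⁻¹)
  have hcp : 0 < |c| := abs_pos.2 hc
  refine h.mono' (by
    refine AEStronglyMeasurable.mul (aestronglyMeasurable_one_add_abs_rpow _) (AEStronglyMeasurable.const_mul ?_ _)
    exact (measurable_dilogKernel.comp (by fun_prop)).aestronglyMeasurable)
    (ae_of_all _ fun r => ?_)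
  have hp : 0 < 1 + |r| := by positivity
  have hq : 0 < 1 + |(r - x) / c| := by positivity
  rw [Real.norm_eq_abs, abs_mul, abs_mul, abs_mul, abs_inv, abs_of_nonneg (Real.rpow_nonneg hp.le _),
    abs_of_nonneg (Real.rpow_nonneg hq.le _)]
  have hle : (1 + |r|) ^ (-a) ≤ (1 + (1 + |x|) / |c|) ^ a * (1 + |(r - x) / c|) ^ (-a) := by
    rw [Real.rpow_neg hp.le, Real.rpow_neg hq.le, ← div_eq_mul_inv, inv_eq_one_div,
      div_le_div_iff₀ (by positivity) (by positivity), one_mul,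
      ← Real.mul_rpow (by positivity) hp.le]
    refine Real.rpow_le_rpow hq.le ?_ ha.le
    rw [abs_div]
    have h1 : |r - x| ≤ |r| + |x| := abs_sub r x
    have h2 : |r - x| / |c| ≤ (|r| + |x|) / |c| := by gcongr
    have h3 : (|r| + |x|) / |c| ≤ (1 + |x|) / |c| * (1 + |r|) := by
      rw [div_mul_eq_mul_div]
      gcongr
      nlinarith [abs_nonneg x, abs_nonneg r]
    nlinarith [abs_nonneg r]
  calc _ ≤ (1 + (1 + |x|) / |c|) ^ a * (1 + |(r - x) / c|) ^ (-a)
        * (|c|⁻¹ * |dilogKernel ((r - x) / c)|) := by gcongr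
    _ = _ := by ring

theorem Problem.integrable_rpow_mul_logKernel (P : Problem) (hl : 0 < P.l) {x a : ℝ}
    (hx : |x| ≠ P.l) (ha : 0 < a) :
    Integrable (fun r : ℝ => (1 + |r|) ^ (-a) * P.logKernel x r) := by
  obtain ⟨hp, hm⟩ := P.sub_ne_zero_of_abs_ne hx hl
  refine ((integrable_rpow_mul_dilogKernel_scaled ha hm x).sub
    (integrable_rpow_mul_dilogKernel_scaled ha hp x)).congr ?_
  filter_upwards [P.logKernel_ae_eq hl hx] with r hr
  rw [Pi.sub_apply, hr]
  ring

theorem integrable_rpow_mul_cut {a ε : ℝ} (ha : 0 < a) (hε : 0 < ε) (x : ℝ) :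
    Integrable (fun r : ℝ => (1 + |r|) ^ (-a) * cut x ε r) := by
  refine ((integrable_one_add_abs_rpow ha).const_mul (1 + (1 + |x|) / ε)).mono'
    (AEStronglyMeasurable.mul (aestronglyMeasurable_one_add_abs_rpow _) (measurable_cut x ε).aestronglyMeasurable)
    (ae_of_all _ fun r => ?_)
  have hp : 0 < 1 + |r| := by positivity
  rw [Real.norm_eq_abs, abs_mul, abs_of_nonneg (Real.rpow_nonneg hp.le _)]
  refine (mul_le_mul_of_nonneg_left (abs_cut_le hε r) (by positivity)).trans (le_of_eq ?_)
  rw [show -(1 + a) = -a + -1 by ring, Real.rpow_add hp, Real.rpow_neg_one]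
  ring

/-! ### Cauchy integrals of logarithms over the crack and the bonded interface -/

/-- The sign with which the logarithmic kernel enters the iterated Cauchy integrals. -/
def side : Fin 3 → ℝ := ![1, 1, -1]

theorem setIntegral_crack {l : ℝ} (hl : 0 < l) (f : ℝ → ℝ) :
    ∫ r in crack l, f r = ∫ r in (-l)..l, f r := by
  rw [crack_eq_Ioo, intervalIntegral.integral_of_le (by linarith), integral_Ioc_eq_integral_Ioo]

/-- The Poincaré–Bertrand formula for one segment, before the limit. For small `ε` the window lies
inside the crack or misses it, and the closed forms apply. The bonded part is the whole line minus
the crack, and the whole line carries no `logKernel` term, whence the sign `side`. -/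
theorem Problem.setIntegral_cut_logDiff (P : Problem) (hl : 0 < P.l) {x : ℝ} (hx : |x| ≠ P.l)
    (j : Fin 3) :
    ∀ᶠ ε in 𝓝[>] (0 : ℝ), ∀ t e : ℝ, t ≠ x → e ≠ x →
      ∫ s in dom P.l j, cut x ε s * logDiff t e s = side j * (∫ r in t..e, P.logKernel x r)
        + (dom P.l j).indicator (fun _ => oddDilog ((e - x) / ε) - oddDilog ((t - x) / ε)) x := by
  have hcrack : ∀ᶠ ε in 𝓝[>] (0 : ℝ), ∀ t e : ℝ, t ≠ x → e ≠ x →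
      ∫ s in crack P.l, cut x ε s * logDiff t e s = (∫ r in t..e, P.logKernel x r)
        + (crack P.l).indicator (fun _ => oddDilog ((e - x) / ε) - oddDilog ((t - x) / ε)) x := by
    rcases lt_or_gt_of_ne hx with h | h
    · filter_upwards [Ioo_mem_nhdsGT (sub_pos.2 h)] with ε hε t e ht he
      have h1 := (abs_lt.1 h).1
      have h2 := le_abs_self x
      have h3 := neg_abs_le x
      rw [setIntegral_crack hl, integral_cut_logDiff_Icc hε.1 (by linarith [hε.2])
        (by linarith [hε.2]) ht he, P.integral_logKernel hl hx, indicator_of_mem (show x ∈ crack P.l from h)]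
    · filter_upwards [eventually_diff_Ioo_eq (compl_crack_mem_nhds h)] with ε hε t e ht he
      rw [indicator_of_notMem (show x ∉ crack P.l from not_lt.2 h.le), add_zero, P.integral_logKernel hl hx,
        ← integral_logDiff_div (by nlinarith [sq_abs x, abs_nonneg x]) ht he, ← setIntegral_crack hl]
      refine setIntegral_congr_fun (measurableSet_crack _) fun s hs => ?_
      rw [← hε] at hs
      simp only [cut_of_notMem hs.2]
  have hbonded : ∀ᶠ ε in 𝓝[>] (0 : ℝ), ∀ t e : ℝ, t ≠ x → e ≠ x →
      ∫ s in bonded P.l, cut x ε s * logDiff t e s = -(∫ r in t..e, P.logKernel x r)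
        + (bonded P.l).indicator (fun _ => oddDilog ((e - x) / ε) - oddDilog ((t - x) / ε)) x := by
    filter_upwards [hcrack, self_mem_nhdsWithin] with ε hε hε0 t e ht he
    obtain ⟨C, -, hC⟩ := exists_integral_cut_logDiff_le (a := 1 / 2) (by norm_num) (by norm_num) x
      (show 0 < ε from hε0)
    have hi := (hC t e).1
    have h1 := integral_cut_logDiff (show 0 < ε from hε0) ht he
    rw [← setIntegral_univ, ← setIntegral_congr_set (crack_union_bonded P.l),
      setIntegral_union (disjoint_crack_bonded _) (measurableSet_bonded _) hi.integrableOn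
        hi.integrableOn, hε t e ht he] at h1
    rcases lt_or_gt_of_ne hx with h | h
    · rw [indicator_of_mem (show x ∈ crack P.l from h)] at h1
      rw [indicator_of_notMem (show x ∉ bonded P.l from not_lt.2 h.le)]
      linarith
    · rw [indicator_of_notMem (show x ∉ crack P.l from not_lt.2 h.le)] at h1
      rw [indicator_of_mem (show x ∈ bonded P.l from h)]
      linarith
  fin_cases j
  · simpa [side, dom] using hcrack
  · simpa [side, dom] using hcrack
  · simpa [side, dom] using hbonded

/-! ## Integration kernels -/

/-- The end point at which the integration of a density sitting at `t` starts or stops. -/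
def endp (l t : ℝ) : ℝ := if t < -l then -l else l

/-- `∫_{D_k} omega₀(s, x) h(s) ds`, a primitive of `h` on `D_k`. -/
def prim (l : ℝ) (k : Fin 3) (h : ℝ → ℝ) (x : ℝ) : ℝ := ∫ s in dom l k, omega₀ l k s x * h s

/-- `∫_{D_k} omega₁(s, x) h(s) ds`, a second primitive of `h` on `D_k`. -/
def prim₂ (l : ℝ) (k : Fin 3) (h : ℝ → ℝ) (x : ℝ) : ℝ := ∫ s in dom l k, omega₁ l k s x * h s

/-- `h` is continuous on `D_k` and integrable there with the weight `(1 + |t|) ^ a`. -/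
def IsDensity (l : ℝ) (k : Fin 3) (a : ℝ) (h : ℝ → ℝ) : Prop :=
  ContinuousOn h (dom l k) ∧ IntegrableOn (fun t => (1 + |t|) ^ a * h t) (dom l k)

section

variable {l : ℝ} {k : Fin 3}

theorem measurable_omega₀ (l : ℝ) (k : Fin 3) : Measurable (Function.uncurry (omega₀ l k)) := by
  have hc : Measurable fun p : ℝ × ℝ => omegaCrack l p.1 p.2 := by
    unfold omegaCrack
    refine Measurable.ite ?_ measurable_const measurable_const
    rw [ofPred_and]
    exact (measurableSet_le (by fun_prop) (by fun_prop)).inter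
      (measurableSet_le (by fun_prop) (by fun_prop))
  have hb : Measurable fun p : ℝ × ℝ => omegaBonded l p.1 p.2 := by
    unfold omegaBonded
    refine Measurable.ite ?_ measurable_const (Measurable.ite ?_ measurable_const measurable_const)
    all_goals
      rw [ofPred_and]
      exact (measurableSet_lt (by fun_prop) (by fun_prop)).inter
        (measurableSet_lt (by fun_prop) (by fun_prop))
  fin_cases k
  exacts [hc, hc, hb]

theorem measurable_omega₁ (l : ℝ) (k : Fin 3) : Measurable (Function.uncurry (omega₁ l k)) :=
  (measurable_snd.sub measurable_fst).mul (measurable_omega₀ l k)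

theorem abs_omega₀_le (s x : ℝ) : |omega₀ l k s x| ≤ 1 := by
  have hc : |omegaCrack l s x| ≤ 1 := by unfold omegaCrack; split_ifs <;> simp
  have hb : |omegaBonded l s x| ≤ 1 := by unfold omegaBonded; split_ifs <;> simp
  fin_cases k
  exacts [hc, hc, hb]

/-- `omega₀(s, x)` vanishes unless `|x|` is controlled by `|s|`. -/
theorem one_add_abs_le_of_omega₀_ne_zero (hl : 0 < l) {s x : ℝ} (hx : x ∈ dom l k)
    (h : omega₀ l k s x ≠ 0) : 1 + |x| ≤ (1 + l) * (1 + |s|) := by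
  have hs := abs_nonneg s
  have hc : |x| < l → 1 + |x| ≤ (1 + l) * (1 + |s|) := fun h => by nlinarith
  have hb : omegaBonded l s x ≠ 0 → 1 + |x| ≤ (1 + l) * (1 + |s|) := by
    intro h
    have : |x| ≤ |s| := by
      unfold omegaBonded at h
      split_ifs at h with h1 h2
      · rw [abs_of_neg (by linarith [h1.1]), abs_of_neg (by linarith [h1.1, h1.2])]
        linarith [h1.2]
      · rw [abs_of_pos (by linarith [h2.1]), abs_of_pos (by linarith [h2.1, h2.2])]
        exact h2.2.le
      · exact absurd rfl h
    nlinarith [abs_nonneg x]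
  fin_cases k
  exacts [hc hx, hc hx, hb h]

theorem setIntegral_crack_omega (l t : ℝ) (ht : t ∈ crack l) (g : ℝ → ℝ) :
    ∫ r in crack l, omegaCrack l t r * g r = ∫ r in t..l, g r := by
  have ht' := abs_lt.1 (show |t| < l from ht)
  rw [intervalIntegral.integral_of_le ht'.2.le, ← setIntegral_congr_set Ico_ae_eq_Ioc,
    show Ico t l = crack l ∩ Ici t by
      rw [crack_eq_Ioo]; ext r; simp only [mem_Ico, mem_inter_iff, mem_Ioo, mem_Ici]
      constructor
      · rintro ⟨h1, h2⟩; exact ⟨⟨by linarith, h2⟩, h1⟩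
      · rintro ⟨⟨-, h2⟩, h1⟩; exact ⟨h1, h2⟩,
    ← setIntegral_indicator measurableSet_Ici]
  refine integral_congr_ae (ae_of_all _ fun r => ?_)
  simp only [omegaCrack, indicator, mem_Ici, ht'.1.le, true_and]
  split_ifs <;> simp

theorem setIntegral_bonded_omega (l t : ℝ) (hl : 0 < l) (ht : t ∈ bonded l) (g : ℝ → ℝ) :
    ∫ r in bonded l, omegaBonded l t r * g r = ∫ r in t..(endp l t), g r := by
  rcases lt_abs.1 (show l < |t| from ht) with h | h
  · rw [endp, if_neg (by linarith), intervalIntegral.integral_symm,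
      intervalIntegral.integral_of_le h.le, integral_Ioc_eq_integral_Ioo, ← integral_neg,
      show Ioo l t = bonded l ∩ Ioo l t by
        refine (inter_eq_self_of_subset_right fun r hr => ?_).symm
        exact lt_of_lt_of_le hr.1 (le_abs_self r),
      ← setIntegral_indicator measurableSet_Ioo]
    refine integral_congr_ae (ae_of_all _ fun r => ?_)
    have h1 : ¬ (r < -l ∧ t < r) := fun h' => by linarith [h'.1, h'.2]
    simp only [omegaBonded, indicator, mem_Ioo, if_neg h1]
    split_ifs <;> simp
  · have h' : t < -l := by linarith
    rw [endp, if_pos h', intervalIntegral.integral_of_le h'.le, integral_Ioc_eq_integral_Ioo,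
      show Ioo t (-l) = bonded l ∩ Ioo t (-l) by
        refine (inter_eq_self_of_subset_right fun r hr => ?_).symm
        exact lt_of_lt_of_le (by linarith [hr.2] : l < -r) (neg_le_abs r),
      ← setIntegral_indicator measurableSet_Ioo]
    refine integral_congr_ae (ae_of_all _ fun r => ?_)
    have h2 : ¬ (l < r ∧ r < t) := fun h' => by linarith [h'.1, h'.2]
    simp only [omegaBonded, indicator, mem_Ioo, if_neg h2, and_comm (a := t < r)]
    split_ifs <;> simp

/-- In its second argument the kernel is, up to a null set, plus or minus the indicator of the
segment between `t` and its end point; the minus sign for `t > l` is the orientation of the interval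
integral. -/
theorem setIntegral_omega₀ (hl : 0 < l) {t : ℝ} (ht : t ∈ dom l k) (g : ℝ → ℝ) :
    ∫ r in dom l k, omega₀ l k t r * g r = ∫ r in t..(endp l t), g r := by
  have hc : t ∈ crack l → ∫ r in crack l, omegaCrack l t r * g r = ∫ r in t..(endp l t), g r := by
    intro ht
    rw [setIntegral_crack_omega l t ht, endp, if_neg (not_lt.2 (abs_lt.1 ht).1.le)]
  fin_cases k
  exacts [hc ht, hc ht, setIntegral_bonded_omega l t hl ht g]

theorem abs_endp (hl : 0 < l) (t : ℝ) : |endp l t| = l := by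
  unfold endp
  split_ifs
  · rw [abs_neg, abs_of_pos hl]
  · exact abs_of_pos hl

theorem endp_ne (hl : 0 < l) {x : ℝ} (hx : |x| ≠ l) (t : ℝ) : endp l t ≠ x := fun h =>
  hx (by rw [← h, abs_endp hl])

theorem measurable_endp (l : ℝ) : Measurable (endp l) :=
  Measurable.ite (measurableSet_lt measurable_id measurable_const) measurable_const measurable_const

/-- On `D_k` the kernel `omega₀` tells on which side of `x` the segment from `t` to its end point
lies. -/
theorem sign_endp_sub_sign (hl : 0 < l) {t x : ℝ} (ht : t ∈ dom l k) (hx : x ∈ dom l k)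
    (htx : t ≠ x) :
    ((SignType.sign (endp l t - x) : ℝ) - SignType.sign (t - x)) = 2 * omega₀ l k t x := by
  have hc : |t| < l → |x| < l →
      ((SignType.sign (endp l t - x) : ℝ) - SignType.sign (t - x)) = 2 * omegaCrack l t x := by
    intro ht hx
    have h1 := abs_lt.1 ht
    have h2 := abs_lt.1 hx
    rw [endp, if_neg (not_lt.2 h1.1.le), sign_pos (by linarith), omegaCrack]
    rcases lt_or_gt_of_ne htx with h | h
    · rw [sign_neg (by linarith), if_pos ⟨h1.1.le, h.le⟩]
      norm_num
    · rw [sign_pos (by linarith), if_neg (fun h' => by linarith [h'.2])]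
      norm_num
  have hb : l < |t| → l < |x| →
      ((SignType.sign (endp l t - x) : ℝ) - SignType.sign (t - x)) = 2 * omegaBonded l t x := by
    intro ht hx
    rw [omegaBonded, endp]
    rcases lt_abs.1 ht with h1 | h1 <;> rcases lt_abs.1 hx with h2 | h2
    · rw [if_neg (by linarith), sign_neg (by linarith), if_neg (fun h' => by linarith [h'.1])]
      rcases lt_or_gt_of_ne htx with h | h
      · rw [sign_neg (by linarith), if_neg (fun h' => by linarith [h'.2])]
        norm_num
      · rw [sign_pos (by linarith), if_pos ⟨h2, h⟩]
        norm_num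
    · rw [if_neg (by linarith), sign_pos (by linarith), sign_pos (by linarith),
        if_neg (fun h' => by linarith [h'.2]), if_neg (fun h' => by linarith [h'.1])]
      norm_num
    · rw [if_pos (by linarith), sign_neg (by linarith), sign_neg (by linarith),
        if_neg (fun h' => by linarith [h'.1]), if_neg (fun h' => by linarith [h'.2])]
      norm_num
    · rw [if_pos (by linarith), sign_pos (by linarith)]
      rcases lt_or_gt_of_ne htx with h | h
      · rw [sign_neg (by linarith), if_pos ⟨by linarith, h⟩]
        norm_num
      · rw [sign_pos (by linarith), if_neg (fun h' => by linarith [h'.2]),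
          if_neg (fun h' => by linarith [h'.1])]
        norm_num
  fin_cases k
  exacts [hc ht hx, hc ht hx, hb ht hx]

/-- The segment from a point of `D_k` to its end point stays on one side of a point outside
`D_k`. -/
theorem sign_endp_eq_sign (hl : 0 < l) {t x : ℝ} (ht : t ∈ dom l k) (hx : x ∉ dom l k)
    (hxl : |x| ≠ l) :
    (SignType.sign (endp l t - x) : ℝ) = SignType.sign (t - x) := by
  have hc : |t| < l → ¬ |x| < l → (SignType.sign (endp l t - x) : ℝ) = SignType.sign (t - x) := by
    intro ht hx
    have h1 := abs_lt.1 ht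
    rw [endp, if_neg (not_lt.2 h1.1.le)]
    rcases lt_abs.1 (lt_of_le_of_ne (not_lt.1 hx) hxl.symm) with h | h
    · rw [sign_neg (by linarith), sign_neg (by linarith)]
    · rw [sign_pos (by linarith), sign_pos (by linarith)]
  have hb : l < |t| → ¬ l < |x| → (SignType.sign (endp l t - x) : ℝ) = SignType.sign (t - x) := by
    intro ht hx
    have h2 := abs_lt.1 (lt_of_le_of_ne (not_lt.1 hx) hxl)
    rw [endp]
    rcases lt_abs.1 ht with h | h
    · rw [if_neg (by linarith), sign_pos (by linarith), sign_pos (by linarith)]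
    · rw [if_pos (by linarith), sign_neg (by linarith), sign_neg (by linarith)]
  fin_cases k
  exacts [hc ht hx, hc ht hx, hb ht hx]

/-! ### Densities -/

theorem IsDensity.mono {a b : ℝ} {h : ℝ → ℝ} (hab : a ≤ b) (hd : IsDensity l k b h) :
    IsDensity l k a h := by
  refine ⟨hd.1, hd.2.norm.mono' ((aestronglyMeasurable_one_add_abs_rpow _).mul
    (hd.1.aestronglyMeasurable (measurableSet_dom l k))) (ae_of_all _ fun t => ?_)⟩
  have hT : 0 < 1 + |t| := by positivity
  rw [norm_mul, norm_mul, Real.norm_of_nonneg (Real.rpow_nonneg hT.le _),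
    Real.norm_of_nonneg (Real.rpow_nonneg hT.le _)]
  gcongr
  linarith [abs_nonneg t]

theorem IsDensity.aestronglyMeasurable {a : ℝ} {h : ℝ → ℝ} (hd : IsDensity l k a h) :
    AEStronglyMeasurable h (volume.restrict (dom l k)) :=
  hd.1.aestronglyMeasurable (measurableSet_dom l k)

theorem IsDensity.integrableOn {a : ℝ} {h : ℝ → ℝ} (ha : 0 ≤ a) (hd : IsDensity l k a h) :
    IntegrableOn h (dom l k) := by
  simpa [IsDensity] using (hd.mono ha).2

theorem IsDensity.id_mul {a : ℝ} {h : ℝ → ℝ} (hd : IsDensity l k (1 + a) h) :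
    IsDensity l k a (fun t => t * h t) := by
  have hc : ContinuousOn (fun t => t * h t) (dom l k) := continuousOn_id.mul hd.1
  refine ⟨hc, hd.2.abs.mono' ((aestronglyMeasurable_one_add_abs_rpow _).mul
    (hc.aestronglyMeasurable (measurableSet_dom l k))) (ae_of_all _ fun t => ?_)⟩
  rw [Real.norm_eq_abs, abs_mul, abs_mul, abs_mul, Real.rpow_add (by positivity), Real.rpow_one,
    abs_of_nonneg (show (0 : ℝ) ≤ (1 + |t|) ^ a by positivity), abs_mul,
    abs_of_nonneg (show (0 : ℝ) ≤ (1 + |t|) ^ a by positivity), abs_of_nonneg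
      (show (0 : ℝ) ≤ 1 + |t| by positivity)]
  have : |t| ≤ 1 + |t| := by linarith
  have h0 : 0 ≤ (1 + |t|) ^ a * |h t| := by positivity
  nlinarith

/-- Interchange of the integrations in `∫ w(r) ∫ κ(t, r) h(t) dt dr`, for a kernel `κ` of moderate
growth supported where `|r|` is controlled by `|t|`. -/
theorem integrable_kernel_prod {κ : ℝ → ℝ → ℝ} {a b B : ℝ} {w h : ℝ → ℝ} (hl : 0 < l) (ha : 0 ≤ a)
    (hB : 0 ≤ B)
    (hκ : Measurable (Function.uncurry κ))
    (hκb : ∀ t ∈ dom l k, ∀ r ∈ dom l k, |κ t r| ≤ B * (1 + |t|) ^ b)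
    (hκs : ∀ t ∈ dom l k, ∀ r ∈ dom l k, κ t r ≠ 0 → 1 + |r| ≤ (1 + l) * (1 + |t|))
    (hwm : Measurable w) (hw : Integrable fun r : ℝ => (1 + |r|) ^ (-a) * w r)
    (hd : IsDensity l k (a + b) h) :
    Integrable (fun p : ℝ × ℝ => κ p.1 p.2 * (w p.2 * h p.1))
      ((volume.restrict (dom l k)).prod (volume.restrict (dom l k))) := by
  have hdom := (Integrable.mul_prod hd.2 hw.integrableOn (ν := volume.restrict (dom l k))).abs.const_mul
    (B * (1 + l) ^ a)
  refine hdom.mono' ?_ ?_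
  · refine hκ.aestronglyMeasurable.mul ?_
    exact (hwm.comp measurable_snd).aestronglyMeasurable.mul
      (hd.aestronglyMeasurable.comp_fst)
  · rw [Measure.prod_restrict]
    refine (ae_restrict_iff' ((measurableSet_dom l k).prod (measurableSet_dom l k))).2
      (ae_of_all _ fun p hp => ?_)
    obtain ⟨t, r⟩ := p
    have ht : t ∈ dom l k := hp.1
    have hr : r ∈ dom l k := hp.2
    simp only [Real.norm_eq_abs, abs_mul]
    have hT : 0 < 1 + |t| := by positivity
    have hR : 0 < 1 + |r| := by positivity
    rw [abs_of_nonneg (Real.rpow_nonneg hT.le _), abs_of_nonneg (Real.rpow_nonneg hR.le _)]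
    by_cases h0 : κ t r = 0
    · rw [h0, abs_zero, zero_mul]; positivity
    · have h1 := hκb t ht r hr
      -- On the support of `κ` this product of weights is at least `1`, so it may be inserted; it
      -- hands `(1 + |t|) ^ a` to `h` and `(1 + |r|) ^ (-a)` to `w`.
      have h2 : 1 ≤ (1 + l) ^ a * (1 + |t|) ^ a * (1 + |r|) ^ (-a) := by
        rw [← Real.mul_rpow (by positivity) hT.le, Real.rpow_neg hR.le, ← div_eq_mul_inv,
          one_le_div (by positivity)]
        exact Real.rpow_le_rpow hR.le (hκs t ht r hr h0) ha
      calc |κ t r| * (|w r| * |h t|)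
          ≤ (B * (1 + |t|) ^ b) * (|w r| * |h t|) := by gcongr
        _ ≤ (B * (1 + |t|) ^ b) * (|w r| * |h t|)
            * ((1 + l) ^ a * (1 + |t|) ^ a * (1 + |r|) ^ (-a)) :=
          le_mul_of_one_le_right (by positivity) h2
        _ = _ := by rw [Real.rpow_add hT]; ring

theorem integral_mul_kernel {κ : ℝ → ℝ → ℝ} {w h : ℝ → ℝ} {D : Set ℝ}
    (hi : Integrable (fun p : ℝ × ℝ => κ p.1 p.2 * (w p.2 * h p.1))
      ((volume.restrict D).prod (volume.restrict D))) :
    IntegrableOn (fun r => w r * ∫ t in D, κ t r * h t) D ∧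
    IntegrableOn (fun t => (∫ r in D, κ t r * w r) * h t) D ∧
    ∫ r in D, w r * ∫ t in D, κ t r * h t = ∫ t in D, (∫ r in D, κ t r * w r) * h t := by
  have e1 : ∀ r, ∫ t in D, κ t r * (w r * h t) = w r * ∫ t in D, κ t r * h t := by
    intro r
    rw [← integral_const_mul]
    refine integral_congr_ae (ae_of_all _ fun t => ?_)
    ring
  have e2 : ∀ t, ∫ r in D, κ t r * (w r * h t) = (∫ r in D, κ t r * w r) * h t := by
    intro t
    rw [← integral_mul_const]
    refine integral_congr_ae (ae_of_all _ fun r => ?_)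
    ring
  have h1 := hi.integral_prod_right
  have h2 := hi.integral_prod_left
  have h3 := integral_integral_swap (f := fun t r => κ t r * (w r * h t)) hi
  simp only [e1, e2] at h1 h2 h3
  exact ⟨h1, h2, h3.symm⟩

theorem integrable_omega₀_prod {a : ℝ} {w h : ℝ → ℝ} (hl : 0 < l) (ha : 0 ≤ a) (hwm : Measurable w)
    (hw : Integrable fun r : ℝ => (1 + |r|) ^ (-a) * w r) (hd : IsDensity l k a h) :
    Integrable (fun p : ℝ × ℝ => omega₀ l k p.1 p.2 * (w p.2 * h p.1))
      ((volume.restrict (dom l k)).prod (volume.restrict (dom l k))) := by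
  refine integrable_kernel_prod (B := 1) (b := 0) hl ha zero_le_one (measurable_omega₀ l k)
    (fun t _ r _ => by simpa using abs_omega₀_le t r)
    (fun t _ r hr h0 => one_add_abs_le_of_omega₀_ne_zero hl hr h0) hwm hw (by simpa using hd)

theorem abs_omega₁_le (hl : 0 < l) {t r : ℝ} (hr : r ∈ dom l k) :
    |omega₁ l k t r| ≤ (2 + l) * (1 + |t|) := by
  rw [omega₁, abs_mul]
  by_cases h0 : omega₀ l k t r = 0
  · rw [h0, abs_zero, mul_zero]; positivity
  · have h1 := one_add_abs_le_of_omega₀_ne_zero hl hr h0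
    have h2 := abs_sub r t
    have h3 := mul_le_mul h2 (abs_omega₀_le (l := l) (k := k) t r) (abs_nonneg _) (by positivity)
    nlinarith [abs_nonneg t]

theorem integrable_omega₁_prod {a : ℝ} {w h : ℝ → ℝ} (hl : 0 < l) (ha : 0 ≤ a) (hwm : Measurable w)
    (hw : Integrable fun r : ℝ => (1 + |r|) ^ (-a) * w r) (hd : IsDensity l k (1 + a) h) :
    Integrable (fun p : ℝ × ℝ => omega₁ l k p.1 p.2 * (w p.2 * h p.1))
      ((volume.restrict (dom l k)).prod (volume.restrict (dom l k))) := by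
  refine integrable_kernel_prod (B := 2 + l) (b := 1) hl ha (by positivity) (measurable_omega₁ l k)
    (fun t _ r hr => by simpa using abs_omega₁_le hl hr)
    (fun t _ r hr h0 => one_add_abs_le_of_omega₀_ne_zero hl hr (right_ne_zero_of_mul h0)) hwm hw
    (by rwa [add_comm])

theorem integrableOn_omega₀_mul {h : ℝ → ℝ} (hd : IntegrableOn h (dom l k)) (x : ℝ) :
    IntegrableOn (fun s => omega₀ l k s x * h s) (dom l k) := by
  refine hd.norm.mono' (((measurable_omega₀ l k).comp
    measurable_prodMk_right).aestronglyMeasurable.mul hd.aestronglyMeasurable)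
    (ae_of_all _ fun s => ?_)
  rw [norm_mul]
  exact mul_le_of_le_one_left (norm_nonneg _) (abs_omega₀_le s x)

theorem prim₂_eq {a : ℝ} {h : ℝ → ℝ} (ha : 0 ≤ a) (hd : IsDensity l k (1 + a) h) (x : ℝ) :
    prim₂ l k h x = x * prim l k h x - prim l k (fun s => s * h s) x := by
  rw [prim₂, prim, prim, ← integral_const_mul, ← integral_sub
    ((integrableOn_omega₀_mul (hd.integrableOn (by linarith)) x).const_mul x)
    (integrableOn_omega₀_mul (hd.id_mul.integrableOn ha) x)]
  refine integral_congr_ae (ae_of_all _ fun s => ?_)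
  simp only [omega₁]
  ring

theorem integrableOn_omega₁_mul {a : ℝ} {h : ℝ → ℝ} (ha : 0 ≤ a) (hd : IsDensity l k (1 + a) h)
    (x : ℝ) : IntegrableOn (fun s => omega₁ l k s x * h s) (dom l k) := by
  refine (((integrableOn_omega₀_mul (hd.integrableOn (by linarith)) x).const_mul x).sub
    (integrableOn_omega₀_mul (hd.id_mul.integrableOn ha) x)).congr (ae_of_all _ fun s => ?_)
  simp only [omega₁, Pi.sub_apply]
  ring

/-! ### Decay and derivatives of the primitives -/

/-- Where the kernel is nonzero, `1 + |s|` is at least a multiple of `1 + |x|`, so the weight of the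
density can be pulled out as decay in `x`. -/
theorem exists_abs_prim_le {a : ℝ} {h : ℝ → ℝ} (hl : 0 < l) (ha : 0 ≤ a)
    (hd : IsDensity l k a h) :
    ∃ C : ℝ, 0 ≤ C ∧ ∀ x ∈ dom l k, |prim l k h x| ≤ C * (1 + |x|) ^ (-a) := by
  refine ⟨(1 + l) ^ a * ∫ s in dom l k, |(1 + |s|) ^ a * h s|,
    mul_nonneg (by positivity) (integral_nonneg fun s => abs_nonneg _), fun x hx => ?_⟩
  have hX : 0 < 1 + |x| := by positivity
  rw [prim, mul_right_comm, ← integral_const_mul]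
  refine (abs_integral_le_integral_abs).trans (integral_mono
    (integrableOn_omega₀_mul (hd.integrableOn ha) x).abs (hd.2.abs.const_mul _) fun s => ?_)
  simp only [abs_mul]
  have hS : 0 < 1 + |s| := by positivity
  rw [abs_of_nonneg (Real.rpow_nonneg hS.le _)]
  by_cases h0 : omega₀ l k s x = 0
  · rw [h0, abs_zero, zero_mul]; positivity
  · have h1 := abs_omega₀_le (l := l) (k := k) s x
    have h2 : 1 ≤ (1 + l) ^ a * (1 + |x|) ^ (-a) * (1 + |s|) ^ a := by
      rw [mul_right_comm, ← Real.mul_rpow (by positivity) hS.le, Real.rpow_neg hX.le,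
        ← div_eq_mul_inv, one_le_div (by positivity)]
      exact Real.rpow_le_rpow hX.le (one_add_abs_le_of_omega₀_ne_zero hl hx h0) ha
    calc |omega₀ l k s x| * |h s| ≤ 1 * |h s| := by gcongr
      _ ≤ ((1 + l) ^ a * (1 + |x|) ^ (-a) * (1 + |s|) ^ a) * |h s| := by gcongr
      _ = _ := by ring

theorem exists_abs_prim₂_le {a : ℝ} {h : ℝ → ℝ} (hl : 0 < l) (ha : 0 ≤ a)
    (hd : IsDensity l k (1 + a) h) :
    ∃ C : ℝ, 0 ≤ C ∧ ∀ x ∈ dom l k, |prim₂ l k h x| ≤ C * (1 + |x|) ^ (-a) := by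
  obtain ⟨C1, h1, hC1⟩ := exists_abs_prim_le hl (by linarith) hd
  obtain ⟨C2, h2, hC2⟩ := exists_abs_prim_le hl ha hd.id_mul
  refine ⟨C1 + C2, by positivity, fun x hx => ?_⟩
  have hX : 0 < 1 + |x| := by positivity
  rw [prim₂_eq ha hd]
  refine (abs_sub _ _).trans ?_
  rw [abs_mul, add_mul]
  refine add_le_add ?_ (hC2 x hx)
  calc |x| * |prim l k h x| ≤ (1 + |x|) * (C1 * (1 + |x|) ^ (-(1 + a))) := by
        gcongr
        · linarith
        · exact hC1 x hx
    _ = C1 * (1 + |x|) ^ (-a) := by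
        rw [show -(1 + a) = -a + -1 by ring, Real.rpow_add hX, Real.rpow_neg_one]
        field_simp

theorem tendsto_zero_of_abs_le_rpow {f : ℝ → ℝ} {a C : ℝ} (ha : 0 < a)
    (hf : ∀ x ∈ bonded l, |f x| ≤ C * (1 + |x|) ^ (-a)) : Tendsto f (cocompact ℝ) (𝓝 0) := by
  have habs : Tendsto (fun x : ℝ => 1 + |x|) (cocompact ℝ) atTop :=
    tendsto_atTop_add_const_left _ _ tendsto_norm_cocompact_atTop
  have h1 : Tendsto (fun x : ℝ => C * (1 + |x|) ^ (-a)) (cocompact ℝ) (𝓝 (C * 0)) :=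
    ((tendsto_rpow_neg_atTop ha).comp habs).const_mul C
  rw [mul_zero] at h1
  refine squeeze_zero_norm' ?_ h1
  filter_upwards [tendsto_norm_cocompact_atTop.eventually_gt_atTop l] with x hx
  exact hf x hx

/-- Near `x` the primitive is an ordinary integral from a tip plus a constant: no constant on the
crack, and on a bonded half-line plus or minus the full integral over it. -/
theorem hasDerivAt_prim {h : ℝ → ℝ} {x : ℝ} (hl : 0 < l) (hc : ContinuousOn h (dom l k))
    (hi : IntegrableOn h (dom l k)) (hx : x ∈ dom l k) : HasDerivAt (prim l k h) (h x) x := by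
  have hcx : ContinuousAt h x := hc.continuousAt ((isOpen_dom l k).mem_nhds hx)
  have hprim : ∀ (b : ℝ), IntervalIntegrable h volume b x →
      HasDerivAt (fun y => ∫ s in b..y, h s) (h x) x := fun b hb =>
    intervalIntegral.integral_hasDerivAt_right hb
      (hc.stronglyMeasurableAtFilter (isOpen_dom l k) x hx) hcx
  have hcrack : dom l k = crack l → (∀ s y, omega₀ l k s y = omegaCrack l s y) →
      HasDerivAt (prim l k h) (h x) x := by
    intro hD hω
    have hsub : ∀ y ∈ crack l, Ioc (-l) y ⊆ crack l := by
      intro y hy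
      rw [crack_eq_Ioo] at hy ⊢
      exact fun s hs => ⟨hs.1, lt_of_le_of_lt hs.2 hy.2⟩
    rw [hD] at hx hi
    have hxl := abs_lt.1 (show |x| < l from hx)
    have hiv : IntervalIntegrable h volume (-l) x := by
      rw [intervalIntegrable_iff_integrableOn_Ioc_of_le hxl.1.le]
      exact hi.mono_set (hsub x hx)
    refine (hprim (-l) hiv).congr_of_eventuallyEq ?_
    filter_upwards [(isOpen_crack l).mem_nhds hx] with y hy
    have hyl := abs_lt.1 (show |y| < l from hy)
    rw [prim, hD, intervalIntegral.integral_of_le hyl.1.le,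
      ← inter_eq_self_of_subset_right (hsub y hy), ← setIntegral_indicator measurableSet_Ioc]
    refine setIntegral_congr_fun (measurableSet_crack l) fun s hs => ?_
    have hs1 := (abs_lt.1 (show |s| < l from hs)).1
    simp only [hω, omegaCrack, indicator, mem_Ioc, hs1, hs1.le, true_and]
    split_ifs <;> simp
  have hbonded : k = 2 → HasDerivAt (prim l k h) (h x) x := by
    rintro rfl
    have hIoi : Ioi l ⊆ bonded l := fun s hs => lt_of_lt_of_le hs (le_abs_self s)
    have hIio : Iio (-l) ⊆ bonded l := fun s hs =>
      lt_of_lt_of_le (lt_neg.1 (show s < -l from hs)) (neg_le_abs s)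
    have hi' : IntegrableOn h (bonded l) := hi
    rcases lt_abs.1 (show l < |x| from hx) with hx' | hx'
    · have hiv : ∀ y, l < y → IntervalIntegrable h volume l y := fun y hy => by
        rw [intervalIntegrable_iff_integrableOn_Ioc_of_le hy.le]
        exact (hi'.mono_set hIoi).mono_set Ioc_subset_Ioi_self
      refine ((hprim l (hiv x hx')).sub_const (∫ s in Ioi l, h s)).congr_of_eventuallyEq ?_
      filter_upwards [Ioi_mem_nhds hx'] with y hy
      have hy' : l < y := hy
      rw [← intervalIntegral.integral_Ioi_sub_Ioi (hi'.mono_set hIoi) hy'.le, sub_sub_cancel_left,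
        ← integral_neg]
      have hsub : Ioi y ⊆ bonded l := (Ioi_subset_Ioi hy'.le).trans hIoi
      rw [← inter_eq_self_of_subset_right hsub, ← setIntegral_indicator measurableSet_Ioi]
      refine setIntegral_congr_fun (measurableSet_bonded l) fun s hs => ?_
      have h1 : ¬ (y < -l ∧ s < y) := fun h' => by linarith [h'.1]
      change omegaBonded l s y * h s = _
      simp only [omegaBonded, indicator, mem_Ioi, hy', true_and, if_neg h1]
      split_ifs <;> simp
    · have hx2 : x < -l := by linarith
      have hiv : ∀ y, y < -l → IntervalIntegrable h volume (-l) y := fun y hy => by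
        refine IntervalIntegrable.symm ?_
        rw [intervalIntegrable_iff_integrableOn_Ioo_of_le hy.le]
        exact (hi'.mono_set hIio).mono_set Ioo_subset_Iio_self
      refine ((hprim (-l) (hiv x hx2)).add_const (∫ s in Iio (-l), h s)).congr_of_eventuallyEq ?_
      filter_upwards [Iio_mem_nhds hx2] with y hy
      have hy' : y < -l := hy
      have hsub : Iio y ⊆ bonded l := (Iio_subset_Iio hy'.le).trans hIio
      have hsplit : ∫ s in Iio (-l), h s = (∫ s in Iio y, h s) + ∫ s in y..(-l), h s := by
        rw [← integral_Iic_eq_integral_Iio, ← integral_Iic_eq_integral_Iio,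
          intervalIntegral.integral_of_le hy'.le, ← setIntegral_union (Iic_disjoint_Ioc le_rfl)
            measurableSet_Ioc ((hi'.mono_set hsub).congr_set_ae Iio_ae_eq_Iic.symm)
            (((hi'.mono_set hIio).congr_set_ae Iio_ae_eq_Iic.symm).mono_set Ioc_subset_Iic_self),
          Iic_union_Ioc_eq_Iic hy'.le]
      rw [hsplit, intervalIntegral.integral_symm (-l) y, add_comm, add_assoc,
        neg_add_cancel, add_zero]
      rw [← inter_eq_self_of_subset_right hsub, ← setIntegral_indicator measurableSet_Iio]
      refine setIntegral_congr_fun (measurableSet_bonded l) fun s hs => ?_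
      have h1 : ¬ (l < y ∧ y < s) := fun h' => by linarith [h'.1]
      change omegaBonded l s y * h s = _
      simp only [omegaBonded, indicator, mem_Iio, hy', true_and, if_neg h1]
      split_ifs <;> simp
  fin_cases k
  exacts [hcrack rfl fun _ _ => rfl, hcrack rfl fun _ _ => rfl, hbonded rfl]

theorem hasDerivAt_prim₂ {a : ℝ} {h : ℝ → ℝ} {x : ℝ} (hl : 0 < l) (ha : 0 ≤ a)
    (hd : IsDensity l k (1 + a) h) (hx : x ∈ dom l k) :
    HasDerivAt (prim₂ l k h) (prim l k h x) x := by
  have h1 := hasDerivAt_prim hl hd.1 (hd.integrableOn (by linarith)) hx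
  have h2 := hasDerivAt_prim hl hd.id_mul.1 (hd.id_mul.integrableOn ha) hx
  have h3 := ((hasDerivAt_id x).mul h1).sub h2
  refine (h3.congr_deriv ?_).congr_of_eventuallyEq (Eventually.of_forall fun y => ?_)
  · simp
  · simp [prim₂_eq ha hd y]

end

/-! ## Representation by densities -/

section

variable {l : ℝ} {k : Fin 3}

theorem exists_eq_const_of_hasDerivAt_zero {S : Set ℝ} {u : ℝ → ℝ} (hS : IsOpen S)
    (hS' : IsPreconnected S) (hu : ∀ x ∈ S, HasDerivAt u 0 x) : ∃ c, ∀ x ∈ S, u x = c :=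
  hS.exists_is_const_of_deriv_eq_zero hS'
    (fun x hx => (hu x hx).differentiableAt.differentiableWithinAt) fun x hx => (hu x hx).deriv

theorem Ioi_subset_bonded (l : ℝ) : Ioi l ⊆ bonded l :=
  fun s hs => lt_of_lt_of_le hs (le_abs_self s)

theorem Iio_subset_bonded (l : ℝ) : Iio (-l) ⊆ bonded l := fun s hs =>
  lt_of_lt_of_le (lt_neg.1 (show s < -l from hs)) (neg_le_abs s)

theorem mem_bonded_iff {x : ℝ} : x ∈ bonded l ↔ x ∈ Ioi l ∨ x ∈ Iio (-l) := by
  change l < |x| ↔ l < x ∨ x < -l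
  rw [lt_abs, lt_neg]

theorem isPreconnected_dom (hk : k ≠ 2) : IsPreconnected (dom l k) := by
  have hc : IsPreconnected (crack l) := by rw [crack_eq_Ioo]; exact isPreconnected_Ioo
  fin_cases k
  exacts [hc, hc, absurd rfl hk]

theorem dom_eq_crack (hk : k ≠ 2) : dom l k = crack l := by
  fin_cases k
  exacts [rfl, rfl, absurd rfl hk]

/-- The increments of an affine function are the constant `c * e`, while those of a function tending
to `0` vanish in the limit. -/
theorem eq_zero_of_tendsto_affine {F : Filter ℝ} [F.NeBot] {u : ℝ → ℝ} {c d e : ℝ} (he : e ≠ 0)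
    (hF : Tendsto (fun x => x + e) F F) (hu : Tendsto u F (𝓝 0))
    (h : ∀ᶠ x in F, u x = c * x + d) : c = 0 ∧ d = 0 := by
  have h1 : Tendsto (fun x => u (x + e) - u x) F (𝓝 (0 - 0)) := (hu.comp hF).sub hu
  have h2 : Tendsto (fun x => u (x + e) - u x) F (𝓝 (c * e)) := by
    refine tendsto_const_nhds.congr' ?_
    filter_upwards [h, hF.eventually h] with x hx hx'
    rw [hx, hx']
    ring
  have hc : c = 0 := by
    have := tendsto_nhds_unique h2 h1
    simpa [he] using this
  refine ⟨hc, ?_⟩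
  refine tendsto_nhds_unique (tendsto_const_nhds.congr' ?_) hu
  filter_upwards [h] with x hx
  rw [hx, hc, zero_mul, zero_add]

/-- A function with an integrable second derivative is the sum of the second primitive of that
derivative and an affine function, which vanishes on the bonded interface if the function vanishes
at infinity. -/
theorem exists_eq_prim₂_add {f f₁ f₂ : ℝ → ℝ} {a : ℝ} (hl : 0 < l) (ha : 0 < a)
    (hd : IsDensity l k (1 + a) f₂) (h1 : ∀ x ∈ dom l k, HasDerivAt f (f₁ x) x)
    (h2 : ∀ x ∈ dom l k, HasDerivAt f₁ (f₂ x) x) (hlim : k = 2 → Tendsto f (cocompact ℝ) (𝓝 0)) :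
    ∃ c d : ℝ, (k = 2 → c = 0 ∧ d = 0) ∧ ∀ x ∈ dom l k,
      f₁ x = prim l k f₂ x + c ∧ f x = prim₂ l k f₂ x + (c * x + d) := by
  have key : ∀ S, IsOpen S → IsPreconnected S → S ⊆ dom l k → ∃ c d : ℝ, ∀ x ∈ S,
      f₁ x = prim l k f₂ x + c ∧ f x = prim₂ l k f₂ x + (c * x + d) := by
    intro S hS hS' hSD
    obtain ⟨c, hc⟩ := exists_eq_const_of_hasDerivAt_zero (u := fun x => f₁ x - prim l k f₂ x) hS hS'
      fun x hx => by
        have := (h2 x (hSD hx)).sub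
          (hasDerivAt_prim hl hd.1 (hd.integrableOn (by linarith)) (hSD hx))
        rwa [sub_self] at this
    obtain ⟨d, hd'⟩ := exists_eq_const_of_hasDerivAt_zero
      (u := fun x => f x - prim₂ l k f₂ x - c * x) hS hS' fun x hx => by
        have h3 := ((h1 x (hSD hx)).sub (hasDerivAt_prim₂ hl ha.le hd (hSD hx))).sub
          ((hasDerivAt_id x).const_mul c)
        refine h3.congr_deriv ?_
        have := hc x hx
        linarith
    exact ⟨c, d, fun x hx => ⟨by linarith [hc x hx], by linarith [hd' x hx]⟩⟩
  by_cases hk : k = 2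
  -- The bonded interface has two components, each with its own affine summand. Both the function
  -- and its second primitive tend to `0` at infinity, so both summands vanish.
  · subst hk
    refine ⟨0, 0, fun _ => ⟨rfl, rfl⟩, ?_⟩
    obtain ⟨C, -, hC⟩ := exists_abs_prim₂_le hl ha.le hd
    have hu : Tendsto (fun x => f x - prim₂ l 2 f₂ x) (cocompact ℝ) (𝓝 0) := by
      simpa using (hlim rfl).sub (tendsto_zero_of_abs_le_rpow ha hC)
    obtain ⟨c, d, hcd⟩ := key _ isOpen_Ioi isPreconnected_Ioi (Ioi_subset_bonded l)
    obtain ⟨c', d', hcd'⟩ := key _ isOpen_Iio isPreconnected_Iio (Iio_subset_bonded l)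
    obtain ⟨rfl, rfl⟩ := eq_zero_of_tendsto_affine one_ne_zero
      (tendsto_atTop_add_const_right atTop 1 tendsto_id) (hu.mono_left atTop_le_cocompact) (by
        filter_upwards [eventually_gt_atTop l] with x hx
        linarith [(hcd x hx).2] : ∀ᶠ x in atTop, f x - prim₂ l 2 f₂ x = c * x + d)
    obtain ⟨rfl, rfl⟩ := eq_zero_of_tendsto_affine one_ne_zero
      (tendsto_atBot_add_const_right atBot 1 tendsto_id) (hu.mono_left atBot_le_cocompact) (by
        filter_upwards [eventually_lt_atBot (-l)] with x hx
        linarith [(hcd' x hx).2] : ∀ᶠ x in atBot, f x - prim₂ l 2 f₂ x = c' * x + d')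
    intro x hx
    rcases mem_bonded_iff.1 hx with hx | hx
    exacts [hcd x hx, hcd' x hx]
  · obtain ⟨c, d, hcd⟩ := key _ (isOpen_dom l k) (isPreconnected_dom hk) Subset.rfl
    exact ⟨c, d, fun h => absurd h hk, hcd⟩

/-- The first-order counterpart: it presents an admissible function as a primitive of its own
derivative, the form to which Poincaré–Bertrand applies. -/
theorem exists_eq_prim_add {f f₁ : ℝ → ℝ} {a : ℝ} (hl : 0 < l) (ha : 0 < a)
    (hd : IsDensity l k a f₁) (h1 : ∀ x ∈ dom l k, HasDerivAt f (f₁ x) x)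
    (hlim : k = 2 → Tendsto f (cocompact ℝ) (𝓝 0)) :
    ∃ c : ℝ, (k = 2 → c = 0) ∧ ∀ x ∈ dom l k, f x = prim l k f₁ x + c := by
  have key : ∀ S, IsOpen S → IsPreconnected S → S ⊆ dom l k → ∃ c : ℝ, ∀ x ∈ S,
      f x - prim l k f₁ x = c := fun S hS hS' hSD =>
    exists_eq_const_of_hasDerivAt_zero hS hS' fun x hx => by
      have := (h1 x (hSD hx)).sub (hasDerivAt_prim hl hd.1 (hd.integrableOn ha.le) (hSD hx))
      rwa [sub_self] at this
  by_cases hk : k = 2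
  · subst hk
    refine ⟨0, fun _ => rfl, ?_⟩
    obtain ⟨C, -, hC⟩ := exists_abs_prim_le hl ha.le hd
    have hu : Tendsto (fun x => f x - prim l 2 f₁ x) (cocompact ℝ) (𝓝 0) := by
      simpa using (hlim rfl).sub (tendsto_zero_of_abs_le_rpow ha hC)
    obtain ⟨c, hc⟩ := key _ isOpen_Ioi isPreconnected_Ioi (Ioi_subset_bonded l)
    obtain ⟨c', hc'⟩ := key _ isOpen_Iio isPreconnected_Iio (Iio_subset_bonded l)
    have e1 : c = 0 := tendsto_nhds_unique (tendsto_const_nhds.congr' (by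
      filter_upwards [eventually_gt_atTop l] with x hx
      exact (hc x hx).symm)) (hu.mono_left atTop_le_cocompact)
    have e2 : c' = 0 := tendsto_nhds_unique (tendsto_const_nhds.congr' (by
      filter_upwards [eventually_lt_atBot (-l)] with x hx
      exact (hc' x hx).symm)) (hu.mono_left atBot_le_cocompact)
    intro x hx
    rcases mem_bonded_iff.1 hx with hx | hx
    exacts [by linarith [hc x hx], by linarith [hc' x hx]]
  · obtain ⟨c, hc⟩ := key _ (isOpen_dom l k) (isPreconnected_dom hk) Subset.rfl
    exact ⟨c, fun h => absurd h hk, fun x hx => by linarith [hc x hx]⟩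

theorem isDensity_const (a : ℝ) (hk : k ≠ 2) (c : ℝ) : IsDensity l k a (fun _ => c) := by
  refine ⟨continuousOn_const, ?_⟩
  rw [dom_eq_crack hk, crack_eq_Ioo]
  have hc : Continuous fun t : ℝ => (1 + |t|) ^ a * c := by
    refine Continuous.mul (Continuous.rpow_const (by fun_prop) fun t => Or.inl ?_) continuous_const
    have := abs_nonneg t
    positivity
  exact (hc.integrableOn_Icc (a := -l) (b := l)).mono_set Ioo_subset_Icc_self

theorem IsDensity.add {a : ℝ} {f g : ℝ → ℝ} (hf : IsDensity l k a f) (hg : IsDensity l k a g) :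
    IsDensity l k a (fun t => f t + g t) := by
  refine ⟨hf.1.add hg.1, ?_⟩
  simp only [mul_add]
  exact hf.2.add hg.2

theorem IsDensity.congr {a : ℝ} {f g : ℝ → ℝ} (hf : IsDensity l k a f)
    (h : EqOn f g (dom l k)) : IsDensity l k a g :=
  ⟨hf.1.congr h.symm, hf.2.congr_fun (fun t ht => by simp only [h ht]) (measurableSet_dom l k)⟩

/-- The decay `-(1 + a)` leaves exponent `-(1 + a / 2)` after spending `a / 2` on the weight, which
is still integrable. -/
theorem isDensity_prim {a : ℝ} {h : ℝ → ℝ} (hl : 0 < l) (ha : 0 < a)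
    (hd : IsDensity l k (1 + a) h) : IsDensity l k (a / 2) (prim l k h) := by
  have hc : ContinuousOn (prim l k h) (dom l k) := fun x hx =>
    (hasDerivAt_prim hl hd.1 (hd.integrableOn (by linarith)) hx).continuousAt.continuousWithinAt
  refine ⟨hc, ?_⟩
  obtain ⟨C, -, hC⟩ := exists_abs_prim_le hl (by linarith) hd
  refine ((integrable_one_add_abs_rpow (half_pos ha)).const_mul C).integrableOn.mono'
    ((aestronglyMeasurable_one_add_abs_rpow _).mul
      (hc.aestronglyMeasurable (measurableSet_dom l k)))
    ((ae_restrict_iff' (measurableSet_dom l k)).2 (ae_of_all _ fun x hx => ?_))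
  have hX : 0 < 1 + |x| := by positivity
  rw [Real.norm_eq_abs, abs_mul, abs_of_nonneg (Real.rpow_nonneg hX.le _)]
  refine (mul_le_mul_of_nonneg_left (hC x hx) (by positivity)).trans (le_of_eq ?_)
  rw [mul_left_comm, ← Real.rpow_add hX]
  congr 2
  ring

/-! ### The change of unknowns -/

theorem contDiffOn_two_iff {S : Set ℝ} (hS : IsOpen S) {f : ℝ → ℝ} :
    ContDiffOn ℝ 2 f S ↔ DifferentiableOn ℝ f S ∧ DifferentiableOn ℝ (deriv f) S ∧
      ContinuousOn (deriv (deriv f)) S := by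
  rw [show (2 : WithTop ℕ∞) = 1 + 1 by norm_num, contDiffOn_succ_iff_deriv_of_isOpen hS,
    show (1 : WithTop ℕ∞) = 0 + 1 by norm_num, contDiffOn_succ_iff_deriv_of_isOpen hS,
    contDiffOn_zero]
  simp

variable {ψ : Fin 3 → ℝ → ℝ}

theorem Admissible.hasDerivAt (h : Admissible l ψ) {x : ℝ} (hx : x ∈ dom l k) :
    HasDerivAt (ψ k) (deriv (ψ k) x) x ∧ HasDerivAt (deriv (ψ k)) (deriv (deriv (ψ k)) x) x := by
  obtain ⟨h1, h2, -⟩ := (contDiffOn_two_iff (isOpen_dom l k)).1 (h.1 k).1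
  have hn := (isOpen_dom l k).mem_nhds hx
  exact ⟨(h1.differentiableAt hn).hasDerivAt, (h2.differentiableAt hn).hasDerivAt⟩

theorem Admissible.admissibleDensity (h : Admissible l ψ) :
    AdmissibleDensity l (fun k => deriv (deriv (ψ k))) := fun k =>
  ⟨((contDiffOn_two_iff (isOpen_dom l k)).1 (h.1 k).1).2.2, (h.1 k).2⟩

theorem AdmissibleDensity.exists_isDensity {χ : Fin 3 → ℝ → ℝ} (h : AdmissibleDensity l χ)
    (k : Fin 3) : ∃ a : ℝ, 0 < a ∧ IsDensity l k (1 + a) (χ k) := by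
  obtain ⟨h1, δ, hδ, h2⟩ := h k
  exact ⟨δ, hδ, h1, h2⟩

theorem Admissible.exists_eq_prim₂_add (hl : 0 < l) (h : Admissible l ψ) (k : Fin 3) :
    ∃ c d : ℝ, (k = 2 → c = 0 ∧ d = 0) ∧ ∀ x ∈ dom l k,
      deriv (ψ k) x = prim l k (deriv (deriv (ψ k))) x + c ∧
      ψ k x = prim₂ l k (deriv (deriv (ψ k))) x + (c * x + d) := by
  obtain ⟨a, ha, hd⟩ := h.admissibleDensity.exists_isDensity k
  refine InterfaceCrack.exists_eq_prim₂_add hl ha hd (fun x hx => (h.hasDerivAt hx).1)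
    (fun x hx => (h.hasDerivAt hx).2) ?_
  rintro rfl
  exact h.2

/-- An admissible function is a primitive of its derivative, which is again a density. -/
theorem Admissible.exists_eq_prim_add (hl : 0 < l) (h : Admissible l ψ) (k : Fin 3) :
    ∃ a c : ℝ, 0 < a ∧ IsDensity l k a (deriv (ψ k)) ∧ (k = 2 → c = 0) ∧
      ∀ x ∈ dom l k, ψ k x = prim l k (deriv (ψ k)) x + c := by
  obtain ⟨a, ha, hd⟩ := h.admissibleDensity.exists_isDensity k
  obtain ⟨c, d, hcd, hrep⟩ := h.exists_eq_prim₂_add hl k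
  have hdens : IsDensity l k (a / 2) (deriv (ψ k)) := by
    by_cases hk : k = 2
    · refine (isDensity_prim hl ha hd).congr fun x hx => ?_
      rw [(hrep x hx).1, (hcd hk).1, add_zero]
    · exact ((isDensity_prim hl ha hd).add (isDensity_const _ hk c)).congr
        fun x hx => (hrep x hx).1.symm
  obtain ⟨c', hc', hrep'⟩ := InterfaceCrack.exists_eq_prim_add hl (half_pos ha) hdens
    (fun x hx => (h.hasDerivAt hx).1) (by rintro rfl; exact h.2)
  exact ⟨a / 2, c', half_pos ha, hdens, hc', hrep'⟩

theorem Admissible.existsUnique_represents (hl : 0 < l) (h : Admissible l ψ) :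
    ∃! C : Fin 4 → ℝ, Represents l (fun k => deriv (deriv (ψ k))) C ψ := by
  obtain ⟨c₀, d₀, -, h0⟩ := h.exists_eq_prim₂_add hl 0
  obtain ⟨c₁, d₁, -, h1⟩ := h.exists_eq_prim₂_add hl 1
  obtain ⟨c₂, d₂, hz, h2⟩ := h.exists_eq_prim₂_add hl 2
  obtain ⟨rfl, rfl⟩ := hz rfl
  refine ⟨![c₀, d₀, c₁, d₁], fun k x hx => ⟨rfl, ?_⟩, fun C hC => ?_⟩
  · fin_cases k
    · exact h0 x hx
    · exact h1 x hx
    · simpa [prim, prim₂] using h2 x hx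
  -- Uniqueness: the values and slopes at the centre of the crack determine the constants.
  · have hz : (0 : ℝ) ∈ crack l := by simpa [crack] using hl
    have a0 : deriv (ψ 0) 0 = prim l 0 (deriv (deriv (ψ 0))) 0 + C 0 := (hC 0 0 hz).2.1
    have a1 : ψ 0 0 = prim₂ l 0 (deriv (deriv (ψ 0))) 0 + (C 0 * 0 + C 1) := (hC 0 0 hz).2.2
    have b0 : deriv (ψ 1) 0 = prim l 1 (deriv (deriv (ψ 1))) 0 + C 2 := (hC 1 0 hz).2.1
    have b1 : ψ 1 0 = prim₂ l 1 (deriv (deriv (ψ 1))) 0 + (C 2 * 0 + C 3) := (hC 1 0 hz).2.2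
    have a0' := h0 0 hz
    have b0' := h1 0 hz
    have e0 : C 0 = c₀ := by linarith [a0'.1]
    have e1 : C 1 = d₀ := by linarith [a0'.2]
    have e2 : C 2 = c₁ := by linarith [b0'.1]
    have e3 : C 3 = d₁ := by linarith [b0'.2]
    funext i
    fin_cases i
    exacts [e0, e1, e2, e3]

theorem AdmissibleDensity.exists_represents (hl : 0 < l) {χ : Fin 3 → ℝ → ℝ}
    (h : AdmissibleDensity l χ) (C : Fin 4 → ℝ) :
    ∃ ψ : Fin 3 → ℝ → ℝ, Admissible l ψ ∧ Represents l χ C ψ := by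
  let c : Fin 3 → ℝ := ![C 0, C 2, 0]
  let d : Fin 3 → ℝ := ![C 1, C 3, 0]
  let ψ : Fin 3 → ℝ → ℝ := fun k x => prim₂ l k (χ k) x + (c k * x + d k)
  have hd1 : ∀ k, ∀ x ∈ dom l k, HasDerivAt (ψ k) (prim l k (χ k) x + c k) x := by
    intro k x hx
    obtain ⟨a, ha, hd⟩ := h.exists_isDensity k
    exact ((hasDerivAt_prim₂ hl ha.le hd hx).add
      (((hasDerivAt_id x).const_mul (c k)).add_const (d k))).congr_deriv (by simp)
  have hev : ∀ k, ∀ x ∈ dom l k, deriv (ψ k) =ᶠ[𝓝 x] fun y => prim l k (χ k) y + c k := by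
    intro k x hx
    filter_upwards [(isOpen_dom l k).mem_nhds hx] with y hy using (hd1 k y hy).deriv
  have hd2 : ∀ k, ∀ x ∈ dom l k, HasDerivAt (deriv (ψ k)) (χ k x) x := by
    intro k x hx
    obtain ⟨a, ha, hd⟩ := h.exists_isDensity k
    exact ((hasDerivAt_prim hl hd.1 (hd.integrableOn (by linarith)) hx).add_const
      (c k)).congr_of_eventuallyEq (hev k x hx)
  refine ⟨ψ, ⟨fun k => ⟨?_, ?_⟩, ?_⟩, fun k x hx => ⟨(hd2 k x hx).deriv.symm, ?_, ?_⟩⟩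
  · refine (contDiffOn_two_iff (isOpen_dom l k)).2
      ⟨fun x hx => (hd1 k x hx).differentiableAt.differentiableWithinAt,
        fun x hx => (hd2 k x hx).differentiableAt.differentiableWithinAt,
        (h k).1.congr fun x hx => (hd2 k x hx).deriv⟩
  · obtain ⟨δ, hδ, hi⟩ := (h k).2
    refine ⟨δ, hδ, hi.congr_fun (fun x hx => ?_) (measurableSet_dom l k)⟩
    simp only [(hd2 k x hx).deriv]
  · obtain ⟨a, ha, hd⟩ := h.exists_isDensity 2
    obtain ⟨B, -, hB⟩ := exists_abs_prim₂_le hl ha.le hd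
    simpa [ψ, c, d] using tendsto_zero_of_abs_le_rpow ha hB
  · rw [(hd1 k x hx).deriv]
    rfl
  · change prim₂ l k (χ k) x + (c k * x + d k) = prim₂ l k (χ k) x + _
    fin_cases k <;> simp [c, d]

end

/-! ## Cauchy integrals of primitives -/

/-- The truncated kernel has the continuous antiderivative `ln max(|r - x|, ε)`, differentiable
except at `x ± ε`. -/
theorem integral_cut {x ε : ℝ} (hε : 0 < ε) (a b : ℝ) :
    ∫ r in a..b, cut x ε r = Real.log (max |b - x| ε) - Real.log (max |a - x| ε) := by
  have hpos : ∀ r, max |r - x| ε ≠ 0 := fun r => (lt_max_of_lt_right hε).ne'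
  have hint : IntervalIntegrable (cut x ε) volume a b := by
    refine (intervalIntegrable_const (c := 1 + (1 + |x|) / ε)).mono_fun'
      (measurable_cut x ε).aestronglyMeasurable (ae_of_all _ fun r => ?_)
    refine (abs_cut_le hε r).trans (mul_le_of_le_one_right (by positivity) ?_)
    exact inv_le_one_of_one_le₀ (by linarith [abs_nonneg r])
  refine integral_eq_of_hasDerivAt_off_countable (fun r => Real.log (max |r - x| ε)) (cut x ε)
    (s := {x - ε, x + ε}) (by simp) ?_ (fun r hr => ?_) hint
  · exact ContinuousOn.log (by fun_prop) fun r _ => hpos r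
  · have hr1 : r ≠ x - ε := fun h => hr.2 (Or.inl h)
    have hr2 : r ≠ x + ε := fun h => hr.2 (Or.inr h)
    have hnhds : |r - x| ≠ ε := by
      intro h
      rcases abs_choice (r - x) with h' | h'
      · exact hr2 (by linarith)
      · exact hr1 (by linarith)
    have hcont : ContinuousAt (fun y : ℝ => |y - x|) r := by fun_prop
    rcases lt_or_gt_of_ne hnhds with h | h
    · rw [cut_of_mem (by rw [← Real.ball_eq_Ioo]; exact h)]
      refine (hasDerivAt_const r (Real.log ε)).congr_of_eventuallyEq ?_
      filter_upwards [hcont.eventually_lt continuousAt_const h] with y hy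
      rw [max_eq_right hy.le]
    · rw [cut_of_notMem (by rw [← Real.ball_eq_Ioo]; exact not_lt.2 h.le)]
      have h0 : r - x ≠ 0 := abs_pos.1 (hε.trans h)
      have hd := ((hasDerivAt_id r).sub_const x).log h0
      rw [one_div] at hd
      refine hd.congr_of_eventuallyEq ?_
      filter_upwards [continuousAt_const.eventually_lt hcont h] with y hy
      rw [max_eq_left (show ε ≤ |y - x| from hy.le), Real.log_abs, id]

/-- Truncation at `ε ≤ 1` only moves a small argument closer to `1`. This gives a majorant
independent of `ε` for dominated convergence. -/
theorem abs_log_max_le {u ε : ℝ} (hε : 0 < ε) (hε1 : ε ≤ 1) (hu : u ≠ 0) :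
    |Real.log (max |u| ε)| ≤ |Real.log u| := by
  rcases le_total ε |u| with h | h
  · rw [max_eq_left h, Real.log_abs]
  · rw [max_eq_right h, ← Real.log_abs u]
    have hu0 := abs_pos.2 hu
    have h1 := Real.log_le_log hu0 h
    have h2 := Real.log_nonpos hε.le hε1
    rw [abs_of_nonpos h2, abs_of_nonpos (h1.trans h2)]
    linarith

theorem tendsto_log_max {u : ℝ} (hu : u ≠ 0) :
    Tendsto (fun ε : ℝ => Real.log (max |u| ε)) (𝓝[>] 0) (𝓝 (Real.log u)) := by
  refine tendsto_const_nhds.congr' ?_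
  filter_upwards [Ioo_mem_nhdsGT (abs_pos.2 hu)] with ε hε
  rw [max_eq_left hε.2.le, Real.log_abs]

/-- Inside `D_k` this is continuity at `x`; off the closure the condition is void for small `ρ`. It
controls the density where `ln |t - x|` is singular. -/
theorem IsDensity.exists_bound_near {l : ℝ} {k : Fin 3} {a : ℝ} {h : ℝ → ℝ}
    (hd : IsDensity l k a h) {x : ℝ} (hx : |x| ≠ l) :
    ∃ ρ B : ℝ, 0 < ρ ∧ ∀ t ∈ dom l k, |t - x| < ρ → |h t| ≤ B := by
  by_cases hxk : x ∈ dom l k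
  · have hc := hd.1.continuousAt ((isOpen_dom l k).mem_nhds hxk)
    obtain ⟨ρ, hρ, hb⟩ := Metric.continuousAt_iff.1 hc 1 one_pos
    refine ⟨ρ, |h x| + 1, hρ, fun t _ ht => ?_⟩
    have h1 := hb (x := t) ht
    rw [Real.dist_eq] at h1
    have h2 := abs_sub_abs_le_abs_sub (h t) (h x)
    linarith
  · have hn : (dom l k)ᶜ ∈ 𝓝 x := by
      have hc : x ∉ crack l → (crack l)ᶜ ∈ 𝓝 x := fun h =>
        compl_crack_mem_nhds (lt_of_le_of_ne (not_lt.1 h) hx.symm)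
      have hb : x ∉ bonded l → (bonded l)ᶜ ∈ 𝓝 x := fun h =>
        compl_bonded_mem_nhds (lt_of_le_of_ne (not_lt.1 h) hx)
      fin_cases k
      exacts [hc hxk, hc hxk, hb hxk]
    obtain ⟨ρ, hρ, hb⟩ := Metric.mem_nhds_iff.1 hn
    exact ⟨ρ, 0, hρ, fun t ht htx => absurd ht (hb htx)⟩

namespace Problem

variable (P : Problem) {k : Fin 3} {x : ℝ}

theorem cauchyKernel_eq (hl : 0 < P.l) (hx : |x| ≠ P.l) {s : ℝ} (hs : s ≠ x) :
    P.cauchyKernel x s = logDiff s (endp P.l s) x := by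
  obtain ⟨hp, hm⟩ := P.sub_ne_zero_of_abs_ne hx hl
  have hs' := sub_ne_zero.2 hs
  rw [cauchyKernel, endp, logDiff]
  split_ifs
  · have hm' : P.l + x ≠ 0 := fun h => hm (by linarith)
    rw [Real.log_abs, Real.log_div hm' hs', ← Real.log_neg_eq_log (P.l + x), neg_add']
  · rw [Real.log_abs, Real.log_div hp hs']

theorem cauchyKernel_ae_eq (hl : 0 < P.l) (hx : |x| ≠ P.l) :
    P.cauchyKernel x =ᵐ[volume] fun s => logDiff s (endp P.l s) x := by
  filter_upwards [ae_ne x] with s hs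
  exact P.cauchyKernel_eq hl hx hs

theorem tipLog_eq (hl : 0 < P.l) (hx : |x| ≠ P.l) : P.tipLog x = logDiff (-P.l) P.l x := by
  obtain ⟨hp, hm⟩ := P.sub_ne_zero_of_abs_ne hx hl
  have hm' : P.l + x ≠ 0 := fun h => hm (by linarith)
  rw [tipLog, logDiff, Real.log_abs, Real.log_div hp hm', ← Real.log_neg_eq_log (P.l + x), neg_add']

theorem measurable_logDiff_endp (l : ℝ) :
    Measurable fun p : ℝ × ℝ => logDiff p.1 (endp l p.1) p.2 := by
  unfold logDiff
  have : Measurable fun p : ℝ × ℝ => endp l p.1 := (measurable_endp l).comp measurable_fst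
  exact ((this.sub measurable_snd).log).sub ((measurable_fst.sub measurable_snd).log)

theorem exists_abs_log_endp_le (l x : ℝ) : ∃ B : ℝ, ∀ t, |Real.log (endp l t - x)| ≤ B := by
  refine ⟨|Real.log (-l - x)| + |Real.log (l - x)|, fun t => ?_⟩
  unfold endp
  split_ifs
  · exact le_add_of_nonneg_right (abs_nonneg _)
  · exact le_add_of_nonneg_left (abs_nonneg _)

theorem integrableOn_abs_log_mul {l a : ℝ} {h : ℝ → ℝ} (ha : 0 < a) (hd : IsDensity l k a h)
    (hx : |x| ≠ l) :
    IntegrableOn (fun t => (|Real.log (endp l t - x)| + |Real.log (t - x)|) * |h t|)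
      (dom l k) := by
  obtain ⟨ρ, B, hρ, hB⟩ := hd.exists_bound_near hx
  have h1 := (integrableOn_log_mul (measurableSet_dom l k) ha hρ hd.2 hd.aestronglyMeasurable hB).abs
  obtain ⟨B', hB'⟩ := exists_abs_log_endp_le l x
  have h2 : IntegrableOn (fun t => |Real.log (endp l t - x)| * |h t|) (dom l k) := by
    refine ((hd.integrableOn ha.le).abs.const_mul B').mono' ?_ (ae_of_all _ fun t => ?_)
    · refine AEStronglyMeasurable.mul ?_ hd.aestronglyMeasurable.norm
      exact (((measurable_endp l).sub_const x).log.abs).aestronglyMeasurable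
    · rw [Real.norm_eq_abs, abs_mul, abs_abs, abs_abs]
      exact mul_le_mul_of_nonneg_right (hB' t) (abs_nonneg _)
  refine (h2.add h1).congr (ae_of_all _ fun t => ?_)
  simp only [Pi.add_apply, abs_mul, add_mul]

theorem integrableOn_cauchyKernel_mul (hl : 0 < P.l) {a : ℝ} {h : ℝ → ℝ} (ha : 0 < a)
    (hd : IsDensity P.l k a h) (hx : |x| ≠ P.l) :
    IntegrableOn (fun t => P.cauchyKernel x t * h t) (dom P.l k) := by
  have hm : AEStronglyMeasurable (fun t => logDiff t (endp P.l t) x * h t)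
      (volume.restrict (dom P.l k)) :=
    ((measurable_logDiff_endp P.l).comp (measurable_prodMk_right (y := x))).aestronglyMeasurable.mul
      hd.aestronglyMeasurable
  refine ((integrableOn_abs_log_mul ha hd hx).mono' hm (ae_of_all _ fun t => ?_)).congr ?_
  · rw [Real.norm_eq_abs, abs_mul]
    exact mul_le_mul_of_nonneg_right (abs_sub _ _) (abs_nonneg _)
  · filter_upwards [ae_restrict_of_ae (P.cauchyKernel_ae_eq hl hx)] with t ht
    rw [ht]

theorem integral_cauchyKernel_mul (hl : 0 < P.l) (hx : |x| ≠ P.l) (k : Fin 3) (h : ℝ → ℝ) :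
    ∫ t in dom P.l k, P.cauchyKernel x t * h t
      = ∫ t in dom P.l k, logDiff t (endp P.l t) x * h t := by
  refine integral_congr_ae ?_
  filter_upwards [ae_restrict_of_ae (P.cauchyKernel_ae_eq hl hx)] with t ht
  rw [ht]

/-- The Cauchy integral of a primitive, as an integral of its density. -/
theorem hasPV_prim (hl : 0 < P.l) {a : ℝ} {h : ℝ → ℝ} (ha : 0 < a)
    (hd : IsDensity P.l k a h) (hx : |x| ≠ P.l) :
    HasPV (dom P.l k) (prim P.l k h) x (∫ t in dom P.l k, P.cauchyKernel x t * h t) := by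
  have hF : ∀ ε : ℝ, 0 < ε → _ := fun ε hε => integral_mul_kernel
    (integrable_omega₀_prod hl ha.le (measurable_cut x ε) (integrable_rpow_mul_cut ha hε x) hd)
  refine ⟨fun ε hε => (integrableOn_diff_Ioo _ x ε).2 (hF ε hε).1, ?_⟩
  simp only [setIntegral_diff_Ioo]
  rw [P.integral_cauchyKernel_mul hl hx]
  -- Fubini, and then the explicit integral of the truncated kernel over the segment from `t` to its
  -- end point.
  have heq : ∀ᶠ ε in 𝓝[>] (0 : ℝ), ∫ t in dom P.l k,
      (Real.log (max |endp P.l t - x| ε) - Real.log (max |t - x| ε)) * h t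
      = ∫ r in dom P.l k, cut x ε r * prim P.l k h r := by
    filter_upwards [self_mem_nhdsWithin] with ε hε
    unfold prim
    rw [(hF ε hε).2.2]
    refine setIntegral_congr_fun (measurableSet_dom P.l k) fun t ht => ?_
    simp only [setIntegral_omega₀ hl ht, integral_cut (show 0 < ε from hε)]
  refine Tendsto.congr' heq ?_
  refine tendsto_integral_filter_of_dominated_convergence _ ?_ ?_
    (integrableOn_abs_log_mul ha hd hx) ?_
  · refine Eventually.of_forall fun ε => AEStronglyMeasurable.mul ?_ hd.aestronglyMeasurable
    have h1 := ((((measurable_endp P.l).sub_const x).abs.max (measurable_const (a := ε))).log).sub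
      (((measurable_id.sub_const x).abs.max (measurable_const (a := ε))).log)
    exact h1.aestronglyMeasurable
  · filter_upwards [Ioo_mem_nhdsGT one_pos] with ε hε
    filter_upwards [ae_restrict_of_ae (ae_ne x)] with t ht
    rw [norm_mul]
    refine mul_le_mul_of_nonneg_right ((abs_sub _ _).trans (add_le_add ?_ ?_)) (norm_nonneg _)
    · exact abs_log_max_le hε.1 hε.2.le (sub_ne_zero.2 (endp_ne hl hx t))
    · exact abs_log_max_le hε.1 hε.2.le (sub_ne_zero.2 ht)
  · filter_upwards [ae_restrict_of_ae (ae_ne x)] with t ht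
    exact ((tendsto_log_max (sub_ne_zero.2 (endp_ne hl hx t))).sub
      (tendsto_log_max (sub_ne_zero.2 ht))).mul_const (h t)

theorem hasPV_one (hl : 0 < P.l) (hx : |x| ≠ P.l) :
    HasPV (crack P.l) (fun _ => 1) x (P.tipLog x) := by
  obtain ⟨hp, hm⟩ := P.sub_ne_zero_of_abs_ne hx hl
  refine ⟨fun ε hε => (integrableOn_diff_Ioo _ x ε).2 ?_, ?_⟩
  · have hf : IntegrableOn (fun _ : ℝ => 1 + (1 + |x|) / ε) (crack P.l) := by
      rw [crack_eq_Ioo]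
      exact integrableOn_const (by simp)
    refine hf.mono' ((measurable_cut x ε).mul_const 1).aestronglyMeasurable
      (ae_of_all _ fun r => ?_)
    rw [mul_one]
    refine (abs_cut_le hε r).trans (mul_le_of_le_one_right (by positivity) ?_)
    exact inv_le_one_of_one_le₀ (by linarith [abs_nonneg r])
  · simp only [setIntegral_diff_Ioo, mul_one]
    rw [P.tipLog_eq hl hx]
    refine ((tendsto_log_max hp).sub (tendsto_log_max hm)).congr' ?_
    filter_upwards [self_mem_nhdsWithin] with ε hε
    rw [setIntegral_crack hl, integral_cut (show 0 < ε from hε)]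

/-- A nonzero constant is allowed only on the crack, since `1 / (r - x)` is not absolutely
integrable at infinity. -/
theorem hasPV_prim_add_const (hl : 0 < P.l) {a c : ℝ} {f h : ℝ → ℝ} (ha : 0 < a)
    (hd : IsDensity P.l k a h) (hc : k = 2 → c = 0)
    (hf : ∀ r ∈ dom P.l k, f r = prim P.l k h r + c) (hx : |x| ≠ P.l) :
    HasPV (dom P.l k) f x ((∫ t in dom P.l k, P.cauchyKernel x t * h t) + c * P.tipLog x) := by
  have h1 := P.hasPV_prim hl ha hd hx
  by_cases hk : k = 2
  · rw [hc hk, zero_mul, add_zero]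
    refine h1.congr (measurableSet_dom _ _) fun r hr => ?_
    rw [hf r hr, hc hk, add_zero]
  · have h2 := (P.hasPV_one hl hx).const_mul c
    rw [← dom_eq_crack hk] at h2
    refine (h1.add h2).congr (measurableSet_dom _ _) fun r hr => ?_
    rw [hf r hr, mul_one]

/-! ### Iterated Cauchy integrals -/

theorem abs_sub_endp_rpow_le {l a : ℝ} (hl : 0 < l) (ha : 0 ≤ a) (t : ℝ) :
    |t - endp l t| ^ a ≤ (1 + l) ^ a * (1 + |t|) ^ a := by
  rw [← Real.mul_rpow (by positivity) (by positivity)]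
  refine Real.rpow_le_rpow (abs_nonneg _) ?_ ha
  have := abs_sub t (endp l t)
  rw [abs_endp hl] at this
  nlinarith [abs_nonneg t]

/-- The inner `L¹` norm is `O(|t - endp t| ^ a)`, hence `O((1 + |t|) ^ a)`, exactly what the weight
of the density absorbs. -/
theorem integrable_cut_logDiff_prod (hl : 0 < P.l) {a ε : ℝ} {h : ℝ → ℝ} (ha : 0 < a) (ha1 : a < 1)
    (hd : IsDensity P.l k a h) (hε : 0 < ε) (x : ℝ) (j : Fin 3) :
    Integrable (fun p : ℝ × ℝ => cut x ε p.2 * logDiff p.1 (endp P.l p.1) p.2 * h p.1)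
      ((volume.restrict (dom P.l k)).prod (volume.restrict (dom P.l j))) := by
  obtain ⟨C, hC, hb⟩ := exists_integral_cut_logDiff_le ha ha1 x hε
  have hm : AEStronglyMeasurable
      (fun p : ℝ × ℝ => cut x ε p.2 * logDiff p.1 (endp P.l p.1) p.2 * h p.1)
      ((volume.restrict (dom P.l k)).prod (volume.restrict (dom P.l j))) :=
    ((((measurable_cut x ε).comp measurable_snd).mul
      (measurable_logDiff_endp P.l)).aestronglyMeasurable).mul hd.aestronglyMeasurable.comp_fst
  rw [integrable_prod_iff hm]
  refine ⟨ae_of_all _ fun t => ((hb t (endp P.l t)).1.integrableOn).mul_const (h t), ?_⟩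
  refine (hd.2.abs.const_mul (C * (1 + P.l) ^ a)).mono' hm.norm.integral_prod_right'
    (ae_of_all _ fun t => ?_)
  have hT : 0 < 1 + |t| := by positivity
  simp only [norm_mul, integral_mul_const]
  rw [norm_norm, abs_mul, abs_of_nonneg (Real.rpow_nonneg hT.le a), ← mul_assoc, Real.norm_eq_abs,
    abs_of_nonneg (integral_nonneg fun s => by positivity), Real.norm_eq_abs (h t)]
  refine mul_le_mul_of_nonneg_right ?_ (abs_nonneg _)
  have h1 : ∫ s in dom P.l j, ‖cut x ε s‖ * ‖logDiff t (endp P.l t) s‖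
      ≤ ∫ s, |cut x ε s * logDiff t (endp P.l t) s| := by
    simp only [Real.norm_eq_abs, ← abs_mul]
    exact setIntegral_le_integral (hb t _).1.abs (ae_of_all _ fun s => abs_nonneg _)
  refine h1.trans ((hb t _).2.trans ?_)
  rw [mul_assoc]
  exact mul_le_mul_of_nonneg_left (abs_sub_endp_rpow_le hl ha.le t) hC

theorem integrableOn_integral_logKernel_mul (hl : 0 < P.l) {a : ℝ} {h : ℝ → ℝ} (ha : 0 < a)
    (hd : IsDensity P.l k a h) (hx : |x| ≠ P.l) :
    IntegrableOn (fun r => P.logKernel x r * prim P.l k h r) (dom P.l k) ∧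
    IntegrableOn (fun t => (∫ r in t..(endp P.l t), P.logKernel x r) * h t) (dom P.l k) ∧
    P.logInt k (prim P.l k h) x
      = ∫ t in dom P.l k, (∫ r in t..(endp P.l t), P.logKernel x r) * h t := by
  obtain ⟨h1, h2, h3⟩ := integral_mul_kernel (integrable_omega₀_prod hl ha.le
    (P.measurable_logKernel_right x) (P.integrable_rpow_mul_logKernel hl hx ha) hd)
  have e : EqOn (fun t => (∫ r in dom P.l k, omega₀ P.l k t r * P.logKernel x r) * h t)
      (fun t => (∫ r in t..(endp P.l t), P.logKernel x r) * h t) (dom P.l k) := fun t ht => by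
    simp only [setIntegral_omega₀ hl ht]
  refine ⟨h1, h2.congr_fun e (measurableSet_dom _ _), ?_⟩
  rw [← setIntegral_congr_fun (measurableSet_dom _ _) e, ← h3]
  rfl

/-- The Poincaré–Bertrand formula for a primitive. -/
theorem hasPV_integral_logDiff (hl : 0 < P.l) {a : ℝ} {h : ℝ → ℝ} (ha : 0 < a)
    (hd : IsDensity P.l k a h) (hx : |x| ≠ P.l) (j : Fin 3) :
    HasPV (dom P.l j) (fun s => ∫ t in dom P.l k, logDiff t (endp P.l t) s * h t) x
      (side j * P.logInt k (prim P.l k h) x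
        - Real.pi ^ 2 * (dom P.l j ∩ dom P.l k).indicator (prim P.l k h) x) := by
  -- The truncated estimate needs an exponent below `1`; lowering the weight loses nothing.
  have hd' : IsDensity P.l k (min a (1 / 2)) h := hd.mono (min_le_left _ _)
  have ha' : 0 < min a (1 / 2) := lt_min ha (by norm_num)
  have ha1 : min a (1 / 2) < 1 := (min_le_right _ _).trans_lt (by norm_num)
  have hF := fun ε hε => P.integrable_cut_logDiff_prod hl ha' ha1 hd' (ε := ε) hε x j
  have e1 : ∀ ε s, ∫ t in dom P.l k, cut x ε s * logDiff t (endp P.l t) s * h t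
      = cut x ε s * ∫ t in dom P.l k, logDiff t (endp P.l t) s * h t := by
    intro ε s
    simp only [mul_assoc, integral_const_mul]
  refine ⟨fun ε hε => (integrableOn_diff_Ioo _ x ε).2 ?_, ?_⟩
  · have := (hF ε hε).integral_prod_right
    simp only [e1] at this
    exact this
  simp only [setIntegral_diff_Ioo]
  obtain ⟨-, hi, hlog⟩ := P.integrableOn_integral_logKernel_mul hl ha hd hx
  obtain ⟨B, hB⟩ := exists_abs_oddDilog_le
  have hB0 : 0 ≤ B := (abs_nonneg _).trans (hB 0)
  let M : ℝ → ℝ → ℝ := fun ε t => (dom P.l j).indicator (fun _ =>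
    oddDilog ((endp P.l t - x) / ε) - oddDilog ((t - x) / ε)) x
  have hM : ∀ ε t, |M ε t| ≤ B + B := by
    intro ε t
    simp only [M, indicator]
    split_ifs
    · exact (abs_sub _ _).trans (add_le_add (hB _) (hB _))
    · rw [abs_zero]; positivity
  have heq : ∀ᶠ ε in 𝓝[>] (0 : ℝ), ∫ t in dom P.l k,
      (side j * (∫ r in t..(endp P.l t), P.logKernel x r) + M ε t) * h t
      = ∫ s in dom P.l j, cut x ε s * ∫ t in dom P.l k, logDiff t (endp P.l t) s * h t := by
    filter_upwards [self_mem_nhdsWithin, P.setIntegral_cut_logDiff hl hx j] with ε hε hcut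
    have hswap := integral_integral_swap
      (f := fun t s => cut x ε s * logDiff t (endp P.l t) s * h t) (hF ε hε)
    simp only [e1, integral_mul_const] at hswap
    rw [← hswap]
    refine integral_congr_ae ?_
    filter_upwards [ae_restrict_of_ae (ae_ne x)] with t ht
    rw [hcut t (endp P.l t) ht (endp_ne hl hx t)]
  refine Tendsto.congr' heq ?_
  -- The expected value is rewritten as a single integral against `h`, so that dominated convergence
  -- can be applied to the integrand.
  have hlim : side j * P.logInt k (prim P.l k h) x
        - Real.pi ^ 2 * (dom P.l j ∩ dom P.l k).indicator (prim P.l k h) x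
      = ∫ t in dom P.l k, (side j * (∫ r in t..(endp P.l t), P.logKernel x r)
        + -(Real.pi ^ 2) * (dom P.l j ∩ dom P.l k).indicator (fun y => omega₀ P.l k t y) x) * h t := by
    have hi2 : IntegrableOn (fun t => -(Real.pi ^ 2) *
        ((dom P.l j ∩ dom P.l k).indicator (fun y => omega₀ P.l k t y) x * h t)) (dom P.l k) := by
      refine Integrable.const_mul ?_ _
      simp only [indicator]
      split_ifs
      · exact integrableOn_omega₀_mul (hd.integrableOn ha.le) x
      · simp
    have hs := integral_add (hi.const_mul (side j)) hi2
    rw [integral_const_mul, integral_const_mul] at hs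
    rw [hlog]
    refine Eq.trans ?_ (hs.symm.trans ?_)
    · have : (dom P.l j ∩ dom P.l k).indicator (prim P.l k h) x = ∫ t in dom P.l k,
          (dom P.l j ∩ dom P.l k).indicator (fun y => omega₀ P.l k t y) x * h t := by
        simp only [indicator]
        split_ifs
        · rfl
        · simp
      rw [this]
      ring
    · refine integral_congr_ae (ae_of_all _ fun t => ?_)
      simp only []
      ring
  rw [hlim]
  refine tendsto_integral_filter_of_dominated_convergence
    (fun t => |side j| * |(∫ r in t..(endp P.l t), P.logKernel x r) * h t| + (B + B) * |h t|)
    ?_ ?_ ((hi.abs.const_mul _).add ((hd.integrableOn ha.le).abs.const_mul _)) ?_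
  · filter_upwards [self_mem_nhdsWithin] with ε hε
    have h1 := hi.aestronglyMeasurable.const_mul (side j)
    have h2 : Measurable (M ε) := by
      simp only [M, indicator]
      split_ifs
      · exact (continuous_oddDilog.measurable.comp (((measurable_endp P.l).sub_const x).div_const ε)).sub
          (continuous_oddDilog.measurable.comp ((measurable_id.sub_const x).div_const ε))
      · exact measurable_const
    refine (h1.add (h2.aestronglyMeasurable.mul hd.aestronglyMeasurable)).congr
      (ae_of_all _ fun t => ?_)
    simp only [Pi.add_apply, Pi.mul_apply]
    ring
  · refine Eventually.of_forall fun ε => ae_of_all _ fun t => ?_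
    rw [Real.norm_eq_abs, add_mul, mul_assoc]
    refine (abs_add_le _ _).trans (add_le_add (abs_mul _ _).le ?_)
    rw [abs_mul]
    exact mul_le_mul_of_nonneg_right (hM ε t) (abs_nonneg _)
  · filter_upwards [ae_restrict_of_ae (ae_ne x), ae_restrict_mem (measurableSet_dom P.l k)]
      with t ht htk
    refine Tendsto.mul_const (h t) (tendsto_const_nhds.add ?_)
    by_cases hxj : x ∈ dom P.l j
    · simp only [M, indicator_of_mem hxj]
      -- The two limits are `-π²/2` times signs. For `x` in `D_k` the difference of the signs is `2
      -- omega₀`, giving `-π² omega₀`; for `x` outside `D_k` the signs agree and nothing is left.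
      have hT := (tendsto_oddDilog_div (endp P.l t - x)).sub (tendsto_oddDilog_div (t - x))
      rw [← mul_sub] at hT
      by_cases hxk : x ∈ dom P.l k
      · rw [indicator_of_mem (mem_inter hxj hxk)]
        rw [sign_endp_sub_sign hl htk hxk ht] at hT
        convert hT using 2
        ring
      · rw [indicator_of_notMem fun h' => hxk h'.2]
        rw [sign_endp_eq_sign hl htk hxk hx, sub_self] at hT
        simpa using hT
    · simp only [M, indicator_of_notMem hxj]
      rw [indicator_of_notMem fun h' => hxj h'.1, mul_zero]
      exact tendsto_const_nhds

/-- The constant function on the crack is the segment from `-l` to `l`, so its iterated Cauchy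
integral is the case `t = -l`, `e = l` of the formula for one segment. -/
theorem hasPV_tipLog (hl : 0 < P.l) (hx : |x| ≠ P.l) (j : Fin 3) :
    HasPV (dom P.l j) P.tipLog x (side j * (∫ r in crack P.l, P.logKernel x r)
      - Real.pi ^ 2 * (dom P.l j ∩ crack P.l).indicator (fun _ => 1) x) := by
  refine HasPV.congr (f := logDiff (-P.l) P.l) (measurableSet_dom _ _) ?_
    fun s hs => (P.tipLog_eq hl (abs_ne_of_mem_dom hs)).symm
  obtain ⟨hp, hm⟩ := P.sub_ne_zero_of_abs_ne hx hl
  refine ⟨fun ε hε => (integrableOn_diff_Ioo _ x ε).2 ?_, ?_⟩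
  · obtain ⟨C, -, hb⟩ := exists_integral_cut_logDiff_le (a := 1 / 2) (by norm_num) (by norm_num) x hε
    exact (hb _ _).1.integrableOn
  simp only [setIntegral_diff_Ioo]
  have heq : ∀ᶠ ε in 𝓝[>] (0 : ℝ), side j * (∫ r in crack P.l, P.logKernel x r)
      + (dom P.l j).indicator (fun _ => oddDilog ((P.l - x) / ε) - oddDilog ((-P.l - x) / ε)) x
      = ∫ s in dom P.l j, cut x ε s * logDiff (-P.l) P.l s := by
    filter_upwards [P.setIntegral_cut_logDiff hl hx j] with ε hcut
    rw [hcut _ _ (sub_ne_zero.1 hm) (sub_ne_zero.1 hp), setIntegral_crack hl]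
  refine Tendsto.congr' heq ?_
  rw [sub_eq_add_neg (side j * _)]
  refine tendsto_const_nhds.add ?_
  by_cases hxj : x ∈ dom P.l j
  · simp only [indicator_of_mem hxj]
    have hT := (tendsto_oddDilog_div (P.l - x)).sub (tendsto_oddDilog_div (-P.l - x))
    rw [← mul_sub] at hT
    by_cases hxk : x ∈ crack P.l
    · have h1 := abs_lt.1 (show |x| < P.l from hxk)
      rw [indicator_of_mem (mem_inter hxj hxk)]
      rw [sign_pos (by linarith), sign_neg (by linarith)] at hT
      convert hT using 2
      rw [SignType.coe_one, SignType.coe_neg_one]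
      ring
    · rw [indicator_of_notMem fun h' => hxk h'.2]
      have hs : (SignType.sign (P.l - x) : ℝ) = SignType.sign (-P.l - x) := by
        rcases lt_abs.1 (lt_of_le_of_ne (not_lt.1 hxk) hx.symm) with h | h
        · rw [sign_neg (by linarith), sign_neg (by linarith)]
        · rw [sign_pos (by linarith), sign_pos (by linarith)]
      rw [hs, sub_self, mul_zero] at hT
      rwa [mul_zero, neg_zero]
  · simp only [indicator_of_notMem hxj]
    rw [indicator_of_notMem fun h' => hxj h'.1, mul_zero, neg_zero]
    exact tendsto_const_nhds

/-- The Poincaré–Bertrand formula: a Cauchy integral over `D_j` of a Cauchy integral over `D_k`. -/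
theorem hasPV_pv (hl : 0 < P.l) {a c : ℝ} {f h : ℝ → ℝ} (ha : 0 < a)
    (hd : IsDensity P.l k a h) (hc : k = 2 → c = 0)
    (hf : ∀ r ∈ dom P.l k, f r = prim P.l k h r + c) (hx : |x| ≠ P.l) (j : Fin 3) :
    IntegrableOn (fun r => P.logKernel x r * f r) (dom P.l k) ∧
    HasPV (dom P.l j) (pv (dom P.l k) f) x
      (side j * P.logInt k f x - Real.pi ^ 2 * (dom P.l j ∩ dom P.l k).indicator f x) := by
  have hpv : ∀ s ∈ dom P.l j, (∫ t in dom P.l k, logDiff t (endp P.l t) s * h t) + c * P.tipLog s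
      = pv (dom P.l k) f s := fun s hs => by
    rw [(P.hasPV_prim_add_const hl ha hd hc hf (abs_ne_of_mem_dom hs)).pv_eq,
      P.integral_cauchyKernel_mul hl (abs_ne_of_mem_dom hs)]
  have h1 := P.hasPV_integral_logDiff hl ha hd hx j
  obtain ⟨hi, -, -⟩ := P.integrableOn_integral_logKernel_mul hl ha hd hx
  by_cases hk : k = 2
  · have hf' : ∀ r ∈ dom P.l k, prim P.l k h r = f r := fun r hr => by
      rw [hf r hr, hc hk, add_zero]
    refine ⟨hi.congr_fun (fun r hr => by simp only [hf' r hr]) (measurableSet_dom _ _), ?_⟩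
    have e1 : P.logInt k (prim P.l k h) x = P.logInt k f x :=
      setIntegral_congr_fun (measurableSet_dom _ _) fun r hr => by simp only [hf' r hr]
    have e2 : (dom P.l j ∩ dom P.l k).indicator (prim P.l k h) x
        = (dom P.l j ∩ dom P.l k).indicator f x := by
      simp only [indicator]
      split_ifs with hm
      exacts [hf' x hm.2, rfl]
    rw [e1, e2] at h1
    refine h1.congr (measurableSet_dom _ _) fun s hs => ?_
    rw [← hpv s hs, hc hk, zero_mul, add_zero]
  · have hic : IntegrableOn (fun r => P.logKernel x r * c) (dom P.l k) := by
      rw [dom_eq_crack hk, crack_eq_Ioo]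
      exact (((intervalIntegrable_iff_integrableOn_Ioo_of_le (by linarith)).1
        (P.intervalIntegrable_logKernel hl hx (-P.l) P.l))).mul_const c
    have e0 : EqOn (fun r => P.logKernel x r * prim P.l k h r + P.logKernel x r * c)
        (fun r => P.logKernel x r * f r) (dom P.l k) := fun r hr => by
      simp only [hf r hr, mul_add]
    refine ⟨(hi.add hic).congr_fun e0 (measurableSet_dom _ _), ?_⟩
    have e1 : P.logInt k (prim P.l k h) x + c * (∫ r in crack P.l, P.logKernel x r)
        = P.logInt k f x := by
      rw [logInt, logInt, ← setIntegral_congr_fun (measurableSet_dom _ _) e0, integral_add hi hic,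
        integral_mul_const, dom_eq_crack hk]
      ring
    have e2 : (dom P.l j ∩ dom P.l k).indicator (prim P.l k h) x
        + c * (dom P.l j ∩ dom P.l k).indicator (fun _ => 1) x
        = (dom P.l j ∩ dom P.l k).indicator f x := by
      simp only [indicator]
      split_ifs with hm
      · rw [hf x hm.2, mul_one]
      · simp
    have h2 := h1.add ((P.hasPV_tipLog hl hx j).const_mul c)
    refine HasPV.congr (measurableSet_dom _ _) (f := fun s =>
      (∫ t in dom P.l k, logDiff t (endp P.l t) s * h t) + c * P.tipLog s) ?_ hpv
    rw [← e1, ← e2]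
    rw [← dom_eq_crack hk] at h2 ⊢
    convert h2 using 1
    ring

end Problem

namespace Problem

variable (P : Problem) {ψ : Fin 3 → ℝ → ℝ} {x : ℝ}

/-! ## Elimination of `φ₁, φ₂, φ` -/

/-- The equation on the bonded part needs the integral of `g` for `|x| > l`. Principal values at two
points of the crack, with disjoint excluded windows, already force `g` to be integrable on the whole
crack, and outside it the Cauchy kernel is bounded there. -/
theorem pvExists_crack_of_forall {g : ℝ → ℝ} (hl : 0 < P.l)
    (hg : ∀ x ∈ crack P.l, PVExists (crack P.l) g x) (hx : |x| ≠ P.l) :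
    PVExists (crack P.l) g x := by
  rcases lt_or_gt_of_ne hx with h | h
  · exact hg x h
  have hbig : ∀ y ∈ crack P.l, ∀ ε : ℝ, 0 < ε →
      IntegrableOn g (crack P.l \ Ioo (y - ε) (y + ε)) := by
    intro y hy ε hε
    refine (((hg y hy).1 ε hε).norm.const_mul (P.l + P.l)).mono' ?_ ?_
    · have h1 := ((hg y hy).1 ε hε).aestronglyMeasurable.mul
        ((by fun_prop : Measurable fun r : ℝ => r - y).aestronglyMeasurable
          (μ := volume.restrict (crack P.l \ Ioo (y - ε) (y + ε))))
      refine h1.congr ?_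
      refine (ae_restrict_iff' ((measurableSet_crack _).diff measurableSet_Ioo)).2
        (ae_of_all _ fun r hr => ?_)
      have h0 : r - y ≠ 0 := fun h0 => hr.2 ⟨by linarith, by linarith⟩
      simp only [Pi.mul_apply]
      rw [div_mul_cancel₀ _ h0]
    · refine (ae_restrict_iff' ((measurableSet_crack _).diff measurableSet_Ioo)).2
        (ae_of_all _ fun r hr => ?_)
      have h0 : 0 < |r - y| := by
        refine abs_pos.2 fun h0 => hr.2 ⟨by linarith, by linarith⟩
      have h1 : |r - y| ≤ P.l + P.l := (abs_sub r y).trans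
        (add_le_add (le_of_lt hr.1) (le_of_lt hy))
      rw [norm_div, Real.norm_eq_abs (r - y), mul_div_assoc', le_div_iff₀ h0, mul_comm]
      exact mul_le_mul_of_nonneg_right h1 (norm_nonneg _)
  have hgi : IntegrableOn g (crack P.l) := by
    have hp : P.l / 2 ∈ crack P.l := by
      change |P.l / 2| < P.l
      rw [abs_of_pos (by linarith)]
      linarith
    have hz : (0 : ℝ) ∈ crack P.l := by simpa [crack] using hl
    -- The windows `(-l/4, l/4)` and `(l/4, 3l/4)` do not meet.
    refine ((hbig 0 hz (P.l / 4) (by linarith)).union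
      (hbig (P.l / 2) hp (P.l / 4) (by linarith))).mono_set fun r hr => ?_
    by_cases h1 : r ∈ Ioo (0 - P.l / 4) (0 + P.l / 4)
    · exact Or.inr ⟨hr, fun h2 => by linarith [h1.2, h2.1]⟩
    · exact Or.inl ⟨hr, h1⟩
  refine (PVExists.hasPV_of_notMem_closure
    (eventually_diff_Ioo_eq (compl_crack_mem_nhds h)) ?_).pvExists
  have hpos : 0 < |x| - P.l := sub_pos.2 h
  refine (hgi.norm.const_mul (|x| - P.l)⁻¹).mono' ?_ ?_
  · simp only [div_eq_mul_inv]
    exact hgi.aestronglyMeasurable.mul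
      (by fun_prop : Measurable fun r : ℝ => (r - x)⁻¹).aestronglyMeasurable
  · refine (ae_restrict_iff' (measurableSet_crack _)).2 (ae_of_all _ fun r hr => ?_)
    rw [norm_div, div_eq_inv_mul]
    refine mul_le_mul_of_nonneg_right (inv_anti₀ hpos ?_) (norm_nonneg _)
    have h1 := abs_sub_abs_le_abs_sub x r
    rw [abs_sub_comm] at h1
    have hr' : |r| < P.l := hr
    rw [Real.norm_eq_abs]
    linarith

section Elimination

variable (hl : 0 < P.l) (h : Admissible P.l ψ)
include hl h

theorem pvExists_of_admissible (k : Fin 3) (hx : |x| ≠ P.l) :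
    PVExists (dom P.l k) (ψ k) x := by
  obtain ⟨a, c, ha, hd, hc, hrep⟩ := h.exists_eq_prim_add hl k
  exact (P.hasPV_prim_add_const hl ha hd hc hrep hx).pvExists

theorem pvExists_deriv_of_admissible (k : Fin 3) (hx : |x| ≠ P.l) :
    PVExists (dom P.l k) (deriv (ψ k)) x := by
  obtain ⟨a, ha, hd⟩ := h.admissibleDensity.exists_isDensity k
  obtain ⟨c, d, hcd, hrep⟩ := h.exists_eq_prim₂_add hl k
  exact (P.hasPV_prim_add_const hl (by linarith) hd (fun hk => (hcd hk).1)
    (fun r hr => (hrep r hr).1) hx).pvExists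

theorem integrableOn_logKernel_of_admissible (k : Fin 3) (hx : |x| ≠ P.l) :
    IntegrableOn (fun r => P.logKernel x r * ψ k r) (dom P.l k) := by
  obtain ⟨a, c, ha, hd, hc, hrep⟩ := h.exists_eq_prim_add hl k
  exact (P.hasPV_pv hl ha hd hc hrep hx 0).1

theorem hasPV_pv_of_admissible (j k : Fin 3) (hx : |x| ≠ P.l) :
    HasPV (dom P.l j) (pv (dom P.l k) (ψ k)) x
      (side j * P.logInt k (ψ k) x
        - Real.pi ^ 2 * (dom P.l j ∩ dom P.l k).indicator (ψ k) x) := by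
  obtain ⟨a, c, ha, hd, hc, hrep⟩ := h.exists_eq_prim_add hl k
  exact (P.hasPV_pv hl ha hd hc hrep hx j).2

/-- A linear combination of Poincaré–Bertrand formulas. The crack and the bonded part are disjoint,
so `π²` arises only from the pair of equal domains; the same holds for the other two functions. -/
theorem hasPV_phiOf_zero (hg : PVExists (crack P.l) P.gp x) (hx : |x| ≠ P.l) :
    HasPV (crack P.l) (P.phiOf ψ 0) x
      (P.α₁⁻¹ * (P.β₁ * (P.logInt 0 (ψ 0) x - Real.pi ^ 2 * (crack P.l).indicator (ψ 0) x)
        + P.β₁ * P.logInt 2 (ψ 2) x + P.σ * P.tipLog x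
        + P.γ₀p * pv (crack P.l) (deriv (ψ 0)) x - pv (crack P.l) P.gp x)) := by
  have h0 := P.hasPV_pv_of_admissible hl h 0 0 hx
  have h2 := P.hasPV_pv_of_admissible hl h 0 2 hx
  have hd := (P.pvExists_deriv_of_admissible hl h 0 hx).hasPV
  simp only [dom, side, Matrix.cons_val_zero, Matrix.cons_val, inter_self, one_mul,
    (disjoint_crack_bonded P.l).inter_eq, indicator_empty, mul_zero, sub_zero] at h0 h2 hd
  have hall := (((((h0.const_mul P.β₁).add (h2.const_mul P.β₁)).add
    ((P.hasPV_one hl hx).const_mul P.σ)).add (hd.const_mul P.γ₀p)).sub hg.hasPV).const_mul P.α₁⁻¹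
  refine hall.congr (measurableSet_crack _) fun r _ => ?_
  simp only [phiOf, Matrix.cons_val_zero, mul_one]
  ring

theorem hasPV_phiOf_one (hg : PVExists (crack P.l) P.gm x) (hx : |x| ≠ P.l) :
    HasPV (crack P.l) (P.phiOf ψ 1) x
      (P.α₂⁻¹ * (-P.β₂ * (P.logInt 1 (ψ 1) x - Real.pi ^ 2 * (crack P.l).indicator (ψ 1) x)
        + -P.β₂ * P.logInt 2 (ψ 2) x + P.σ * P.tipLog x
        + -P.γ₀m * pv (crack P.l) (deriv (ψ 1)) x - pv (crack P.l) P.gm x)) := by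
  have h0 := P.hasPV_pv_of_admissible hl h 1 1 hx
  have h2 := P.hasPV_pv_of_admissible hl h 1 2 hx
  have hd := (P.pvExists_deriv_of_admissible hl h 1 hx).hasPV
  simp only [dom, side, Matrix.cons_val_one, Matrix.cons_val, inter_self, one_mul,
    (disjoint_crack_bonded P.l).inter_eq, indicator_empty, mul_zero, sub_zero] at h0 h2 hd
  have hall := (((((h0.const_mul (-P.β₂)).add (h2.const_mul (-P.β₂))).add
    ((P.hasPV_one hl hx).const_mul P.σ)).add (hd.const_mul (-P.γ₀m))).sub
      hg.hasPV).const_mul P.α₂⁻¹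
  refine hall.congr (measurableSet_crack _) fun r _ => ?_
  simp only [phiOf, Matrix.cons_val_one, Matrix.cons_val_zero, mul_one]
  ring

theorem hasPV_phiOf_two (hx : |x| ≠ P.l) :
    HasPV (bonded P.l) (P.phiOf ψ 2) x
      ((P.α₁ - P.α₂)⁻¹ * (P.β₁ * -P.logInt 0 (ψ 0) x + P.β₂ * -P.logInt 1 (ψ 1) x
        + (P.β₁ + P.β₂) * (-P.logInt 2 (ψ 2) x - Real.pi ^ 2 * (bonded P.l).indicator (ψ 2) x)
        + P.γ₀i * pv (bonded P.l) (deriv (ψ 2)) x)) := by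
  have h0 := P.hasPV_pv_of_admissible hl h 2 0 hx
  have h1 := P.hasPV_pv_of_admissible hl h 2 1 hx
  have h2 := P.hasPV_pv_of_admissible hl h 2 2 hx
  have hd := (P.pvExists_deriv_of_admissible hl h 2 hx).hasPV
  simp only [dom, side, Matrix.cons_val_zero, Matrix.cons_val_one, Matrix.cons_val, inter_self,
    neg_mul, one_mul, (disjoint_crack_bonded P.l).symm.inter_eq, indicator_empty, mul_zero,
    sub_zero] at h0 h1 h2 hd
  have hall := ((((h0.const_mul P.β₁).add (h1.const_mul P.β₂)).add
    (h2.const_mul (P.β₁ + P.β₂))).add (hd.const_mul P.γ₀i)).const_mul (P.α₁ - P.α₂)⁻¹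
  refine hall.congr (measurableSet_bonded _) fun r _ => ?_
  simp only [phiOf, Matrix.cons_val]
  ring

/-- The normal stress equations are equivalent to `φ = phiOf ψ` on the domains, and for admissible
`ψ` every existence clause is then automatic. What remains is to insert the Cauchy integrals of
`phiOf` into the other three equations; each matches its counterpart because the differences of the
two sides agree identically. -/
theorem singularSystem_iff (φ : Fin 3 → ℝ → ℝ) (h1 : P.α₁ ≠ 0) (h2 : P.α₂ ≠ 0)
    (h12 : P.α₁ ≠ P.α₂)
    (hgp : ∀ x ∈ crack P.l, PVExists (crack P.l) P.gp x)
    (hgm : ∀ x ∈ crack P.l, PVExists (crack P.l) P.gm x) :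
    P.SingularSystem φ ψ ↔
      (∀ k, EqOn (φ k) (P.phiOf ψ k) (dom P.l k)) ∧ P.LogSystem ψ := by
  have hΔ : P.α₁ - P.α₂ ≠ 0 := sub_ne_zero.2 h12
  have hGp : ∀ x, |x| ≠ P.l → PVExists (crack P.l) P.gp x := fun x hx =>
    P.pvExists_crack_of_forall hl hgp hx
  have hGm : ∀ x, |x| ≠ P.l → PVExists (crack P.l) P.gm x := fun x hx =>
    P.pvExists_crack_of_forall hl hgm hx
  have hphi : (∀ k, EqOn (φ k) (P.phiOf ψ k) (dom P.l k)) ↔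
      (∀ x ∈ crack P.l,
        (-P.α₁ * φ 0 x + P.β₁ * pv (crack P.l) (ψ 0) x + P.β₁ * pv (bonded P.l) (ψ 2) x + P.σ
          = -P.γ₀p * deriv (ψ 0) x + P.gp x) ∧
        (-P.α₂ * φ 1 x - P.β₂ * pv (crack P.l) (ψ 1) x - P.β₂ * pv (bonded P.l) (ψ 2) x + P.σ
          = P.γ₀m * deriv (ψ 1) x + P.gm x)) ∧
      (∀ x ∈ bonded P.l, -(P.α₁ - P.α₂) * φ 2 x + P.β₁ * pv (crack P.l) (ψ 0) x
        + P.β₂ * pv (crack P.l) (ψ 1) x + (P.β₁ + P.β₂) * pv (bonded P.l) (ψ 2) x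
        = -P.γ₀i * deriv (ψ 2) x) := by
    have e0 : ∀ x, φ 0 x = P.phiOf ψ 0 x ↔
        -P.α₁ * φ 0 x + P.β₁ * pv (crack P.l) (ψ 0) x + P.β₁ * pv (bonded P.l) (ψ 2) x + P.σ
          = -P.γ₀p * deriv (ψ 0) x + P.gp x := by
      intro x
      simp only [phiOf, Matrix.cons_val_zero]
      rw [eq_div_iff h1]
      constructor <;> intro <;> linarith
    have e1 : ∀ x, φ 1 x = P.phiOf ψ 1 x ↔
        -P.α₂ * φ 1 x - P.β₂ * pv (crack P.l) (ψ 1) x - P.β₂ * pv (bonded P.l) (ψ 2) x + P.σ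
          = P.γ₀m * deriv (ψ 1) x + P.gm x := by
      intro x
      simp only [phiOf, Matrix.cons_val_one, Matrix.cons_val_zero]
      rw [eq_div_iff h2]
      constructor <;> intro <;> linarith
    have e2 : ∀ x, φ 2 x = P.phiOf ψ 2 x ↔
        -(P.α₁ - P.α₂) * φ 2 x + P.β₁ * pv (crack P.l) (ψ 0) x
        + P.β₂ * pv (crack P.l) (ψ 1) x + (P.β₁ + P.β₂) * pv (bonded P.l) (ψ 2) x
        = -P.γ₀i * deriv (ψ 2) x := by
      intro x
      simp only [phiOf, Matrix.cons_val]
      rw [eq_div_iff hΔ]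
      constructor <;> intro <;> linarith
    constructor
    · intro hk
      exact ⟨fun x hx => ⟨(e0 x).1 (hk 0 hx), (e1 x).1 (hk 1 hx)⟩, fun x hx => (e2 x).1 (hk 2 hx)⟩
    · rintro ⟨hC, hB⟩ k x hx
      fin_cases k
      exacts [(e0 x).2 (hC x hx).1, (e1 x).2 (hC x hx).2, (e2 x).2 (hB x hx)]
  have hV : (∀ k, EqOn (φ k) (P.phiOf ψ k) (dom P.l k)) → ∀ x, |x| ≠ P.l →
      HasPV (crack P.l) (φ 0) x _ ∧ HasPV (crack P.l) (φ 1) x _ ∧ HasPV (bonded P.l) (φ 2) x _ :=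
    fun hk x hx => ⟨(P.hasPV_phiOf_zero hl h (hGp x hx) hx).congr (measurableSet_crack _)
        (hk 0).symm,
      (P.hasPV_phiOf_one hl h (hGm x hx) hx).congr (measurableSet_crack _) (hk 1).symm,
      (P.hasPV_phiOf_two hl h hx).congr (measurableSet_bonded _) (hk 2).symm⟩
  have hsub : ∀ {a b c d : ℝ}, a - b = c - d → (a = b ↔ c = d) := fun hh => by
    rw [← sub_eq_zero, hh, sub_eq_zero]
  have hex : ∀ x, |x| ≠ P.l → ∀ k, PVExists (dom P.l k) (deriv (ψ k)) x ∧
      IntegrableOn (fun r => P.logKernel x r * ψ k r) (dom P.l k) := fun x hx k =>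
    ⟨P.pvExists_deriv_of_admissible hl h k hx, P.integrableOn_logKernel_of_admissible hl h k hx⟩
  have hmain : (∀ k, EqOn (φ k) (P.phiOf ψ k) (dom P.l k)) →
      (P.SingularSystem φ ψ ↔ P.LogSystem ψ) := by
    intro hk
    have hk' := hphi.1 hk
    have hex' : ∀ x, |x| ≠ P.l → ∀ k, PVExists (dom P.l k) (φ k) x ∧ PVExists (dom P.l k) (ψ k) x := by
      intro x hx k
      refine ⟨?_, P.pvExists_of_admissible hl h k hx⟩
      obtain ⟨v0, v1, v2⟩ := hV hk x hx
      fin_cases k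
      exacts [v0.pvExists, v1.pvExists, v2.pvExists]
    have hcr : ∀ x ∈ crack P.l, _ := fun x hx => hV hk x (ne_of_lt hx)
    have hbo : ∀ x ∈ bonded P.l, _ := fun x hx => hV hk x (ne_of_gt hx)
    simp only [SingularSystem, LogSystem]
    refine and_congr (iff_of_true hex' hex)
      (and_congr (forall₂_congr fun x hx => ?_) (forall₂_congr fun x hx => ?_))
    · obtain ⟨v0, v1, v2⟩ := hcr x hx
      have hxB : x ∉ bonded P.l := Set.disjoint_left.1 (disjoint_crack_bonded P.l) hx
      simp only [(hk'.1 x hx).1, (hk'.1 x hx).2, true_and, and_true, v0.pv_eq, v1.pv_eq, v2.pv_eq,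
        indicator_of_mem hx, indicator_of_notMem hxB]
      refine and_congr (hsub ?_) (hsub ?_)
      · simp only [rhs, Matrix.cons_val_zero]
        field_simp
        ring
      · simp only [rhs, Matrix.cons_val_one, Matrix.cons_val_zero]
        field_simp
        ring
    · obtain ⟨v0, v1, v2⟩ := hbo x hx
      have hxC : x ∉ crack P.l := Set.disjoint_right.1 (disjoint_crack_bonded P.l) hx
      simp only [hk'.2 x hx, and_true, v0.pv_eq, v1.pv_eq, v2.pv_eq,
        indicator_of_mem hx, indicator_of_notMem hxC]
      refine hsub ?_
      simp only [rhs, Matrix.cons_val]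
      field_simp
      ring
  constructor
  · intro hS
    have hk := hphi.2 ⟨fun x hx => ⟨(hS.2.1 x hx).2.1, (hS.2.1 x hx).2.2.2⟩,
      fun x hx => (hS.2.2 x hx).2⟩
    exact ⟨hk, (hmain hk).1 hS⟩
  · rintro ⟨hk, hL⟩
    exact (hmain hk).2 hL

end Elimination

/-! ## The Fredholm system -/

/-- The affine part of `ψ_k`. -/
def affinePart (C : Fin 4 → ℝ) (k : Fin 3) (x : ℝ) : ℝ :=
  (![C 0 * x + C 1, C 2 * x + C 3, 0] : Fin 3 → ℝ) k

/-- The slope of the affine part of `ψ_k`. -/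
def slope (C : Fin 4 → ℝ) (k : Fin 3) : ℝ := (![C 0, C 2, 0] : Fin 3 → ℝ) k

/-- The existence clauses hold for every admissible `ψ` and can be dropped, which leaves three
scalar identities in matrix form. -/
theorem logSystem_iff (hl : 0 < P.l) (h : Admissible P.l ψ) :
    P.LogSystem ψ ↔ ∀ j, ∀ x ∈ dom P.l j,
      P.leadCoef j * deriv (deriv (ψ j)) x + P.diagCoef j * ψ j x
        + ∑ k, P.cauchyCoef j k * pv (dom P.l k) (deriv (ψ k)) x
        + ∑ k, P.logCoef j k * P.logInt k (ψ k) x = P.rhs j x := by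
  have hex : ∀ x, |x| ≠ P.l → ∀ k, PVExists (dom P.l k) (deriv (ψ k)) x ∧
      IntegrableOn (fun r => P.logKernel x r * ψ k r) (dom P.l k) := fun x hx k =>
    ⟨P.pvExists_deriv_of_admissible hl h k hx, P.integrableOn_logKernel_of_admissible hl h k hx⟩
  have hsub : ∀ {a b c : ℝ}, a = c → (a = b ↔ c = b) := fun hh => by rw [hh]
  have h3 : ∀ {p : Fin 3 → Prop}, (∀ j, p j) ↔ p 0 ∧ p 1 ∧ p 2 := fun {p} =>
    ⟨fun hp => ⟨hp 0, hp 1, hp 2⟩, fun hp j => by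
      fin_cases j
      exacts [hp.1, hp.2.1, hp.2.2]⟩
  simp only [LogSystem]
  rw [and_iff_right hex, h3, forall₂_and, and_assoc]
  simp only [Fin.sum_univ_three]
  refine and_congr (forall₂_congr fun x _ => hsub ?_) (and_congr (forall₂_congr fun x _ => hsub ?_)
    (forall₂_congr fun x _ => hsub ?_))
  · simp [leadCoef, diagCoef, cauchyCoef, logCoef, dom]
    ring
  · simp [leadCoef, diagCoef, cauchyCoef, logCoef, dom]
    ring
  · simp [leadCoef, diagCoef, cauchyCoef, logCoef, dom]
    ring

/-- The three summands of the kernel produce the second primitive, the Cauchy integral of the first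
primitive and, after Fubini, the logarithmic integral of the second primitive. -/
theorem integral_fredholmKernel_mul (hl : 0 < P.l) {a : ℝ} {h : ℝ → ℝ} {k : Fin 3} (ha : 0 < a)
    (hd : IsDensity P.l k (1 + a) h) (hx : |x| ≠ P.l) (j : Fin 3) :
    IntegrableOn (fun s => P.fredholmKernel j k x s * h s) (dom P.l k) ∧
    ∫ s in dom P.l k, P.fredholmKernel j k x s * h s
      = (if j = k then P.diagCoef j * prim₂ P.l k h x else 0)
        + P.cauchyCoef j k * (∫ s in dom P.l k, P.cauchyKernel x s * h s)
        + P.logCoef j k * P.logInt k (prim₂ P.l k h) x := by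
  have h1 : IntegrableOn (fun s => (if j = k then P.diagCoef j else 0) *
      (omega₁ P.l k s x * h s)) (dom P.l k) := (integrableOn_omega₁_mul ha.le hd x).const_mul _
  have h2 := (P.integrableOn_cauchyKernel_mul hl (by linarith) hd hx).const_mul (P.cauchyCoef j k)
  obtain ⟨-, h3, h3'⟩ := integral_mul_kernel (integrable_omega₁_prod hl ha.le
    (P.measurable_logKernel_right x) (P.integrable_rpow_mul_logKernel hl hx ha) hd)
  have e3 : ∀ s, ∫ r in dom P.l k, omega₁ P.l k s r * P.logKernel x r
      = P.logInt k (omega₁ P.l k s) x := fun s =>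
    integral_congr_ae (ae_of_all _ fun r => mul_comm _ _)
  simp only [e3] at h3 h3'
  have h3c := h3.const_mul (P.logCoef j k)
  have hfun : (fun s => P.fredholmKernel j k x s * h s) = fun s =>
      (if j = k then P.diagCoef j else 0) * (omega₁ P.l k s x * h s)
      + P.cauchyCoef j k * (P.cauchyKernel x s * h s)
      + P.logCoef j k * (P.logInt k (omega₁ P.l k s) x * h s) := by
    funext s
    simp only [fredholmKernel]
    split_ifs <;> ring
  rw [hfun]
  refine ⟨(h1.add h2).add h3c, ?_⟩
  have i1 := integral_add (h1.add h2) h3c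
  have i2 := integral_add h1 h2
  simp only [Pi.add_apply] at i1
  rw [i1, i2, integral_const_mul, integral_const_mul, integral_const_mul, ← h3']
  simp only [ite_mul, zero_mul]
  rfl

theorem logSystem_iff_solvesFredholm (hl : 0 < P.l) (h : Admissible P.l ψ) {χ : Fin 3 → ℝ → ℝ}
    {C : Fin 4 → ℝ} (hr : Represents P.l χ C ψ) :
    P.LogSystem ψ ↔
      SolvesFredholm (dom P.l) P.leadCoef P.fredholmKernel (P.fredholmRhs C) χ := by
  have hdens : ∀ k, ∃ a : ℝ, 0 < a ∧ IsDensity P.l k (1 + a) (χ k) := by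
    intro k
    obtain ⟨a, ha, hd⟩ := h.admissibleDensity.exists_isDensity k
    exact ⟨a, ha, hd.congr fun x hx => (hr k x hx).1.symm⟩
  have hrep : ∀ k, ∀ x ∈ dom P.l k, deriv (ψ k) x = prim P.l k (χ k) x + slope C k ∧
      ψ k x = prim₂ P.l k (χ k) x + affinePart C k x := fun k x hx => (hr k x hx).2
  have hpv : ∀ k x, |x| ≠ P.l → pv (dom P.l k) (deriv (ψ k)) x
      = (∫ s in dom P.l k, P.cauchyKernel x s * χ k s) + slope C k * P.tipLog x := by
    intro k x hx
    obtain ⟨a, ha, hd⟩ := hdens k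
    exact (P.hasPV_prim_add_const hl (by linarith) hd (by rintro rfl; rfl)
      (fun r hr' => (hrep k r hr').1) hx).pv_eq
  have hlog : ∀ k x, |x| ≠ P.l → P.logInt k (ψ k) x
      = P.logInt k (prim₂ P.l k (χ k)) x + P.logInt k (affinePart C k) x := by
    intro k x hx
    obtain ⟨a, ha, hd⟩ := hdens k
    obtain ⟨i1, -, -⟩ := integral_mul_kernel (integrable_omega₁_prod hl ha.le
      (P.measurable_logKernel_right x) (P.integrable_rpow_mul_logKernel hl hx ha) hd)
    have i0 := P.integrableOn_logKernel_of_admissible hl h k hx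
    -- The affine part is the difference of `ψ_k` and the second primitive, both integrable against
    -- the kernel.
    have i2 : IntegrableOn (fun r => P.logKernel x r * affinePart C k r) (dom P.l k) := by
      refine (i0.sub i1).congr_fun (fun r hr' => ?_) (measurableSet_dom _ _)
      simp only [Pi.sub_apply]
      rw [(hrep k r hr').2, prim₂]
      ring
    have i1' : IntegrableOn (fun r => P.logKernel x r * prim₂ P.l k (χ k) r) (dom P.l k) := i1
    rw [logInt, logInt, logInt, ← integral_add i1' i2]
    refine setIntegral_congr_fun (measurableSet_dom _ _) fun r hr' => ?_
    rw [(hrep k r hr').2, prim₂]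
    ring
  have hz : ∀ x, P.logInt 2 (affinePart C 2) x = 0 := fun x => by simp [logInt, affinePart]
  rw [P.logSystem_iff hl h]
  refine forall_congr' fun j => forall₂_congr fun x hx => ?_
  have hxl := abs_ne_of_mem_dom hx
  have hK : ∀ k, IntegrableOn (fun s => P.fredholmKernel j k x s * χ k s) (dom P.l k) := by
    intro k
    obtain ⟨a, ha, hd⟩ := hdens k
    exact (P.integral_fredholmKernel_mul hl ha hd hxl j).1
  have hKv : ∀ k, ∫ s in dom P.l k, P.fredholmKernel j k x s * χ k s
      = (if j = k then P.diagCoef j * prim₂ P.l k (χ k) x else 0)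
        + P.cauchyCoef j k * (∫ s in dom P.l k, P.cauchyKernel x s * χ k s)
        + P.logCoef j k * P.logInt k (prim₂ P.l k (χ k)) x := by
    intro k
    obtain ⟨a, ha, hd⟩ := hdens k
    exact (P.integral_fredholmKernel_mul hl ha hd hxl j).2
  simp only [hK, implies_true, true_and, hKv, Finset.sum_add_distrib, Finset.sum_ite_eq,
    Finset.mem_univ, if_true, (hr j x hx).1, (hrep j x hx).2, hpv _ x hxl, hlog _ x hxl, mul_add]
  have a0 : (fun r => C 0 * r + C 1) = affinePart C 0 := rfl
  have a1 : (fun r => C 2 * r + C 3) = affinePart C 1 := rfl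
  have aj : (![C 0 * x + C 1, C 2 * x + C 3, 0] : Fin 3 → ℝ) j = affinePart C j x := rfl
  rw [fredholmRhs, a0, a1, aj]
  simp only [Fin.sum_univ_three, hz, slope, Matrix.cons_val_zero, Matrix.cons_val_one,
    Matrix.cons_val, mul_zero, zero_mul, add_zero]
  constructor <;> intro <;> linarith

end Problem

/-! ## Estimates of the Fredholm kernels -/

theorem intervalIntegrable_log_pow_four (a b : ℝ) :
    IntervalIntegrable (fun u : ℝ => Real.log u ^ 4) volume a b := by
  refine intervalIntegrable_of_even (fun u => by rw [Real.log_neg_eq_log]) fun u hu => ?_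
  have h01 : IntervalIntegrable (fun u : ℝ => Real.log u ^ 4) volume 0 1 := by
    refine ((intervalIntegral.intervalIntegrable_rpow' (r := -(1 / 2)) (by norm_num)).const_mul
      (8 ^ 4)).mono_fun' (by fun_prop : Measurable fun u : ℝ => Real.log u ^ 4).aestronglyMeasurable
      ?_
    rw [uIoc_of_le zero_le_one]
    refine (ae_restrict_iff' measurableSet_Ioc).2 (ae_of_all _ fun v hv => ?_)
    -- The exponent `1/8` makes the fourth power bounded by `8⁴ v^(-1/2)`, which is integrable at
    -- `0`.
    have h := (Real.abs_log_mul_self_rpow_lt v (1 / 8) hv.1 hv.2 (by norm_num)).le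
    have h4 := pow_le_pow_left₀ (abs_nonneg _) h 4
    have he : (v ^ (1 / 8 : ℝ)) ^ 4 = v ^ (1 / 2 : ℝ) := by
      rw [← Real.rpow_natCast, ← Real.rpow_mul hv.1.le]
      norm_num
    rw [pow_abs, mul_pow, he, abs_mul, abs_of_nonneg (Real.rpow_nonneg hv.1.le _)] at h4
    beta_reduce
    rw [Real.rpow_neg hv.1.le, ← div_eq_mul_inv, le_div_iff₀ (Real.rpow_pos_of_pos hv.1 _),
      Real.norm_eq_abs]
    refine h4.trans (by norm_num)
  refine h01.trans (ContinuousOn.intervalIntegrable fun v hv => ?_)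
  have hv0 : 0 < v := (lt_min one_pos hu).trans_le (by
    rw [uIcc] at hv
    exact hv.1)
  exact ((Real.continuousAt_log hv0.ne').pow 4).continuousWithinAt

/-- On the square the function is the integrand of a convolution of two truncated integrable
functions. -/
theorem integrableOn_log_sub_pow_four (R : ℝ) :
    IntegrableOn (fun z : ℝ × ℝ => Real.log (z.1 - z.2) ^ 4) (Icc (-R) R ×ˢ Icc (-R) R) := by
  rcases lt_or_ge R 0 with hR | hR
  · rw [Icc_eq_empty (by linarith), empty_prod]
    exact integrableOn_empty
  have hf : Integrable ((Icc (-R) R).indicator fun _ : ℝ => (1 : ℝ)) :=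
    (integrable_indicator_iff measurableSet_Icc).2 (integrableOn_const (by simp))
  have hg : Integrable ((Icc (-(2 * R)) (2 * R)).indicator fun u : ℝ => Real.log u ^ 4) :=
    (integrable_indicator_iff measurableSet_Icc).2
      ((intervalIntegrable_iff_integrableOn_Icc_of_le (by linarith)).1
        (intervalIntegrable_log_pow_four _ _))
  have h := hf.convolution_integrand (ContinuousLinearMap.mul ℝ ℝ) hg
  rw [← Measure.volume_eq_prod] at h
  refine h.integrableOn.congr_fun (fun z hz => ?_) (measurableSet_Icc.prod measurableSet_Icc)
  obtain ⟨h1, h2⟩ := hz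
  have h3 : z.1 - z.2 ∈ Icc (-(2 * R)) (2 * R) :=
    ⟨by linarith [h1.1, h2.2], by linarith [h1.2, h2.1]⟩
  simp only [indicator_of_mem h2, indicator_of_mem h3, ContinuousLinearMap.mul_apply', one_mul]

theorem integrableOn_log_abs_sub_pow_four (l R : ℝ) :
    IntegrableOn (fun x : ℝ => Real.log (|x| - l) ^ 4) (Icc (-R) R) := by
  rcases lt_or_ge R 0 with hR | hR
  · rw [Icc_eq_empty (by linarith)]
    exact integrableOn_empty
  rw [← intervalIntegrable_iff_integrableOn_Icc_of_le (by linarith)]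
  have hpos : ∀ u : ℝ, 0 < u → IntervalIntegrable (fun x : ℝ => Real.log (|x| - l) ^ 4) volume 0 u := by
    intro u hu
    have h := (intervalIntegrable_log_pow_four (0 - l) (u - l)).comp_sub_right l
    simp only [sub_add_cancel] at h
    refine h.congr fun x hx => ?_
    rw [uIoc_of_le hu.le] at hx
    simp only [abs_of_pos hx.1]
  exact intervalIntegrable_of_even (fun u => by rw [abs_neg]) hpos

/-- A logarithmic bound gives local square integrability. -/
theorem integrableOn_sq_of_log_bound {K : ℝ → ℝ → ℝ} {D E : Set ℝ} {l R c : ℝ}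
    (hK : Measurable (Function.uncurry K)) (hD : MeasurableSet D) (hE : MeasurableSet E)
    (hb : ∀ x ∈ D, ∀ s ∈ E, |x| ≤ R → |s| ≤ R →
      |K x s| ≤ c * (1 + |Real.log (x - s)| + Real.log (|x| - l) ^ 2)) :
    IntegrableOn (fun z : ℝ × ℝ => K z.1 z.2 ^ 2) ((D ∩ Icc (-R) R) ×ˢ (E ∩ Icc (-R) R)) := by
  have h1 : IntegrableOn (fun z : ℝ × ℝ => Real.log (|z.1| - l) ^ 4)
      (Icc (-R) R ×ˢ Icc (-R) R) := by
    have := (integrableOn_log_abs_sub_pow_four l R).integrable.comp_fst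
      (volume.restrict (Icc (-R) R))
    rwa [Measure.prod_restrict, ← Measure.volume_eq_prod] at this
  have h0 : IntegrableOn (fun _ : ℝ × ℝ => (1 : ℝ)) (Icc (-R) R ×ˢ Icc (-R) R) := by
    have : Integrable (fun _ : ℝ × ℝ => (1 : ℝ))
        ((volume.restrict (Icc (-R) R)).prod (volume.restrict (Icc (-R) R))) :=
      integrable_const _
    rwa [Measure.prod_restrict, ← Measure.volume_eq_prod] at this
  -- With `w = v²`: `(1 + u + w)² ≤ 3 (1 + u² + w²)` and `u² ≤ 1 + u⁴`, so the square of the bound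
  -- is at most `3 c² (2 + u⁴ + v⁴)`.
  have hsum := (((h0.const_mul 2).add (integrableOn_log_sub_pow_four R)).add h1).const_mul
    (3 * c ^ 2)
  refine (IntegrableOn.mono_set hsum (prod_mono inter_subset_right inter_subset_right)).mono' ?_ ?_
  · exact (hK.pow_const 2).aestronglyMeasurable
  · refine (ae_restrict_iff' ((hD.inter measurableSet_Icc).prod
      (hE.inter measurableSet_Icc))).2 (ae_of_all _ fun z hz => ?_)
    obtain ⟨⟨hx, hxR⟩, hs, hsR⟩ := hz
    have h := hb z.1 hx z.2 hs (abs_le.2 hxR) (abs_le.2 hsR)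
    have h2 := pow_le_pow_left₀ (abs_nonneg _) h 2
    rw [Real.norm_eq_abs, abs_of_nonneg (sq_nonneg _), ← sq_abs]
    refine h2.trans ?_
    simp only [Pi.add_apply]
    set u := |Real.log (z.1 - z.2)| with hu
    set v := Real.log (|z.1| - l)
    have hu4 : Real.log (z.1 - z.2) ^ 4 = u ^ 4 := by
      rw [hu, Even.pow_abs (by decide)]
    rw [hu4, mul_pow, mul_comm 3, mul_assoc]
    refine mul_le_mul_of_nonneg_left ?_ (sq_nonneg c)
    nlinarith [sq_nonneg (u ^ 2 - 1 / 2), sq_nonneg (u - 1), sq_nonneg (u - v ^ 2),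
      sq_nonneg (1 - v ^ 2)]

theorem abs_log_le_of_abs_eq {l R e x : ℝ} (he : |e| = l) (hx : |x| ≠ l) (hR : |x| ≤ R) :
    |Real.log (e - x)| ≤ |Real.log (|x| - l)| + Real.log (1 + R + l) := by
  have hd : 0 < |(|x| - l)| := abs_pos.2 (sub_ne_zero.2 hx)
  have h1 : |(|x| - l)| ≤ |e - x| := by
    rw [← he, abs_sub_comm e]
    exact abs_abs_sub_abs_le_abs_sub x e
  have h2 : |e - x| ≤ 1 + R + l := by linarith [abs_sub e x]
  have h3 := Real.log_le_log hd h1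
  have h4 := Real.log_le_log (hd.trans_le h1) h2
  rw [Real.log_abs] at h3
  rw [Real.log_abs] at h3 h4
  have h5 : 0 ≤ Real.log (1 + R + l) :=
    Real.log_nonneg (by linarith [abs_nonneg x, he ▸ abs_nonneg e])
  exact abs_le.2 ⟨by linarith [neg_abs_le (Real.log (|x| - l))],
    by linarith [abs_nonneg (Real.log (|x| - l))]⟩

theorem log_one_add_div_sq_le {l R A y x : ℝ} (hA : 0 ≤ A) (hl : 0 < l) (hx : |x| ≠ l)
    (hR : |x| ≤ R) (hy : |(|x| - l)| ≤ |y|) :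
    Real.log (1 + A / |y|) ^ 2
      ≤ 2 * Real.log (1 + R + l + A) ^ 2 + 2 * Real.log (|x| - l) ^ 2 := by
  have hd : 0 < |(|x| - l)| := abs_pos.2 (sub_ne_zero.2 hx)
  have hy0 := hd.trans_le hy
  have h0 : 0 ≤ Real.log (1 + A / |y|) :=
    Real.log_nonneg (le_add_of_nonneg_right (div_nonneg hA hy0.le))
  have h1 : Real.log (1 + A / |y|) ≤ Real.log (1 + A / |(|x| - l)|) :=
    Real.log_le_log (by positivity) (by gcongr)
  have h2 : Real.log (1 + A / |(|x| - l)|) = Real.log (|(|x| - l)| + A) - Real.log (|x| - l) := by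
    rw [← Real.log_abs (|x| - l), ← Real.log_div (by positivity) hd.ne']
    congr 1
    field_simp
  have h3 : |(|x| - l)| ≤ R + l := by
    refine (abs_sub _ _).trans ?_
    rw [abs_abs, abs_of_pos hl]
    linarith
  have h4 : Real.log (|(|x| - l)| + A) ≤ Real.log (1 + R + l + A) :=
    Real.log_le_log (by positivity) (by linarith)
  have h5 : Real.log (1 + A / |y|) ≤ Real.log (1 + R + l + A) - Real.log (|x| - l) := by linarith
  have h6 := pow_le_pow_left₀ h0 h5 2
  nlinarith [sq_nonneg (Real.log (1 + R + l + A) + Real.log (|x| - l))]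

namespace Problem

variable (P : Problem)

theorem abs_cauchyKernel_le (hl : 0 < P.l) {x s R : ℝ} (hx : |x| ≠ P.l) (hR : |x| ≤ R) :
    |P.cauchyKernel x s|
      ≤ |Real.log (|x| - P.l)| + Real.log (1 + R + P.l) + |Real.log (x - s)| := by
  have hnn : 0 ≤ |Real.log (|x| - P.l)| + Real.log (1 + R + P.l) + |Real.log (x - s)| := by
    have := Real.log_nonneg (show 1 ≤ 1 + R + P.l by linarith [abs_nonneg x])
    positivity
  have key : ∀ e : ℝ, |e| = P.l →
      |(Real.log |(e - x) / (s - x)|)| ≤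
        |Real.log (|x| - P.l)| + Real.log (1 + R + P.l) + |Real.log (x - s)| := by
    intro e he
    rw [Real.log_abs]
    by_cases hs : s - x = 0
    · rwa [hs, div_zero, Real.log_zero, abs_zero]
    have hex : e - x ≠ 0 := fun h => hx (by rw [← he, sub_eq_zero.1 h])
    rw [Real.log_div hex hs, ← neg_sub x s, Real.log_neg_eq_log]
    exact (abs_sub _ _).trans (add_le_add_left (abs_log_le_of_abs_eq he hx hR) _)
  rw [cauchyKernel]
  split_ifs
  · have := key (-P.l) (by rw [abs_neg, abs_of_pos hl])
    rwa [show -P.l - x = -(P.l + x) by ring, neg_div, abs_neg] at this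
  · exact key P.l (abs_of_pos hl)

/-- For `|s| ≤ R` the function `omega₁(s, ·)` on `D_k` is bounded by `B` and supported in `|r| < T`,
so only the absolute integral of `logKernel` over `[-T, T]` matters. -/
theorem exists_abs_logInt_omega₁_le (hl : 0 < P.l) (k : Fin 3) {R : ℝ} (hR : 0 ≤ R) :
    ∃ c : ℝ, 0 ≤ c ∧ ∀ x s : ℝ, |x| ≠ P.l → |x| ≤ R → |s| ≤ R →
      |P.logInt k (omega₁ P.l k s) x| ≤ c * (1 + Real.log (|x| - P.l) ^ 2) := by
  obtain ⟨C, hC, hCb⟩ := P.exists_integral_abs_logKernel_le hl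
  set B := (2 + P.l) * (1 + R) with hB
  set T := (1 + P.l) * (1 + R) with hT
  set M := Real.log (1 + R + P.l + (T + R)) ^ 2 with hM
  have hB0 : 0 ≤ B := by positivity
  have hT0 : 0 ≤ T := by positivity
  have hM0 : 0 ≤ M := sq_nonneg _
  -- Each tip contributes `2 (2 M + 2 v²)` with `v = ln ||x| - l|`; two tips give `8 M + 8 v²`.
  refine ⟨B * (C + 8 * M + 8), by positivity, fun x s hx hxR hsR => ?_⟩
  have hint : IntegrableOn (fun r => B * |P.logKernel x r|) (Ioc (-T) T) :=
    ((intervalIntegrable_iff_integrableOn_Ioc_of_le (by linarith)).1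
      (P.intervalIntegrable_logKernel hl hx (-T) T)).abs.const_mul B
  have hind := (integrable_indicator_iff measurableSet_Ioc).2 hint
  have hle : |P.logInt k (omega₁ P.l k s) x| ≤ B * ∫ r in (-T)..T, |P.logKernel x r| := by
    rw [logInt]
    rw [← Real.norm_eq_abs]
    refine (norm_integral_le_of_norm_le (hind.integrableOn (s := dom P.l k)) (
      (ae_restrict_iff' (measurableSet_dom _ _)).2 (ae_of_all _ fun r hr => ?_))).trans ?_
    · rw [norm_mul, Real.norm_eq_abs, Real.norm_eq_abs]
      by_cases h0 : omega₀ P.l k s r = 0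
      · rw [omega₁, h0, mul_zero, abs_zero, mul_zero]
        exact indicator_nonneg (fun r _ => by positivity) r
      · have h1 := one_add_abs_le_of_omega₀_ne_zero hl hr h0
        have h2 : (1 + P.l) * (1 + |s|) ≤ T := by rw [hT]; gcongr
        have h3 : |r| < T := by linarith
        have h4 : |omega₁ P.l k s r| ≤ B :=
          (abs_omega₁_le hl hr).trans (by rw [hB]; gcongr)
        have hrT : r ∈ Ioc (-T) T := ⟨(abs_lt.1 h3).1, (abs_lt.1 h3).2.le⟩
        rw [indicator_of_mem hrT, mul_comm]
        exact mul_le_mul_of_nonneg_right h4 (abs_nonneg _)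
    · refine (setIntegral_le_integral hind
        (ae_of_all _ fun r => indicator_nonneg (fun r _ => by positivity) r)).trans ?_
      rw [integral_indicator measurableSet_Ioc, integral_const_mul,
        intervalIntegral.integral_of_le (by linarith)]
  refine hle.trans ?_
  rw [mul_assoc B]
  refine mul_le_mul_of_nonneg_left ((hCb x hx T hT0).trans ?_) hB0
  have hx0 := abs_nonneg x
  have hlog : ∀ e : ℝ, |e| = P.l → Real.log (1 + (T + |x|) / |e - x|) ^ 2
      ≤ 2 * M + 2 * Real.log (|x| - P.l) ^ 2 := by
    intro e he
    have hy : |(|x| - P.l)| ≤ |e - x| := by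
      rw [← he, abs_sub_comm e]
      exact abs_abs_sub_abs_le_abs_sub x e
    refine (log_one_add_div_sq_le (by positivity) hl hx hxR hy).trans ?_
    rw [hM]
    gcongr
    exact Real.log_nonneg (by linarith)
  have h1 := hlog (-P.l) (by rw [abs_neg, abs_of_pos hl])
  have h2 := hlog P.l (abs_of_pos hl)
  nlinarith [sq_nonneg (Real.log (|x| - P.l))]

theorem measurable_cauchyKernel : Measurable (Function.uncurry P.cauchyKernel) := by
  have : Function.uncurry P.cauchyKernel = fun p : ℝ × ℝ =>
      if p.2 < -P.l then Real.log |(P.l + p.1) / (p.2 - p.1)|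
      else Real.log |(P.l - p.1) / (p.2 - p.1)| := rfl
  rw [this]
  exact Measurable.ite (measurableSet_lt (by fun_prop) (by fun_prop)) (by fun_prop) (by fun_prop)

theorem measurable_logInt_omega₁ (k : Fin 3) :
    Measurable fun p : ℝ × ℝ => P.logInt k (omega₁ P.l k p.2) p.1 := by
  have hm : Measurable fun q : (ℝ × ℝ) × ℝ =>
      P.logKernel q.1.1 q.2 * omega₁ P.l k q.1.2 q.2 :=
    (P.measurable_logKernel.comp (measurable_fst.fst.prodMk measurable_snd)).mul
      ((measurable_omega₁ P.l k).comp (measurable_fst.snd.prodMk measurable_snd))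
  exact (hm.stronglyMeasurable.integral_prod_right' (ν := volume.restrict (dom P.l k))).measurable

theorem measurable_fredholmKernel (j k : Fin 3) :
    Measurable (Function.uncurry (P.fredholmKernel j k)) := by
  have h1 : Measurable fun p : ℝ × ℝ =>
      if j = k then P.diagCoef j * omega₁ P.l k p.2 p.1 else 0 := by
    split_ifs
    · exact ((measurable_omega₁ P.l k).comp measurable_swap).const_mul _
    · exact measurable_const
  exact (h1.add (P.measurable_cauchyKernel.const_mul _)).add
    ((P.measurable_logInt_omega₁ k).const_mul _)

theorem exists_abs_fredholmKernel_le (hl : 0 < P.l) (j k : Fin 3) (R : ℝ) :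
    ∃ c : ℝ, ∀ x ∈ dom P.l j, ∀ s ∈ dom P.l k, |x| ≤ R → |s| ≤ R →
      |P.fredholmKernel j k x s|
        ≤ c * (1 + |Real.log (x - s)| + Real.log (|x| - P.l) ^ 2) := by
  rcases lt_or_ge R 0 with hR | hR
  · exact ⟨0, fun x _ s _ hx _ => absurd ((abs_nonneg x).trans hx) (not_le.2 hR)⟩
  obtain ⟨c, hc, hb⟩ := P.exists_abs_logInt_omega₁_le hl k hR
  set N := Real.log (1 + R + P.l) with hN
  have hN0 : 0 ≤ N := Real.log_nonneg (by linarith)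
  refine ⟨|P.diagCoef j| * ((2 + P.l) * (1 + R)) + |P.cauchyCoef j k| * (2 + N)
    + |P.logCoef j k| * c, fun x hx s hs hxR hsR => ?_⟩
  have hxl := abs_ne_of_mem_dom hx
  set u := |Real.log (x - s)| with hu
  set v := Real.log (|x| - P.l) with hv
  have hu0 : 0 ≤ u := abs_nonneg _
  have hv0 : 0 ≤ v ^ 2 := sq_nonneg _
  -- The Cauchy kernel has only a first power of the logarithm at the tips, absorbed here into the
  -- square.
  have hvv : |v| ≤ 1 + v ^ 2 := by nlinarith [sq_nonneg (|v| - 1), sq_abs v, abs_nonneg v]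
  have h1 : |if j = k then P.diagCoef j * omega₁ P.l k s x else 0|
      ≤ |P.diagCoef j| * ((2 + P.l) * (1 + R)) * (1 + u + v ^ 2) := by
    split_ifs with hjk
    · subst hjk
      rw [abs_mul, mul_assoc]
      refine mul_le_mul_of_nonneg_left ?_ (abs_nonneg _)
      refine (abs_omega₁_le hl hx).trans ?_
      refine (show (2 + P.l) * (1 + |s|) ≤ (2 + P.l) * (1 + R) by gcongr).trans ?_
      exact le_mul_of_one_le_right (by positivity) (by linarith)
    · rw [abs_zero]
      positivity
  have h2 : |P.cauchyCoef j k * P.cauchyKernel x s|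
      ≤ |P.cauchyCoef j k| * (2 + N) * (1 + u + v ^ 2) := by
    rw [abs_mul, mul_assoc]
    refine mul_le_mul_of_nonneg_left ((P.abs_cauchyKernel_le hl hxl hxR).trans ?_) (abs_nonneg _)
    have := mul_nonneg hN0 (add_nonneg hu0 hv0)
    nlinarith
  have h3 : |P.logCoef j k * P.logInt k (omega₁ P.l k s) x|
      ≤ |P.logCoef j k| * c * (1 + u + v ^ 2) := by
    rw [abs_mul, mul_assoc]
    refine mul_le_mul_of_nonneg_left ((hb x s hxl hxR hsR).trans ?_) (abs_nonneg _)
    exact mul_le_mul_of_nonneg_left (by linarith) hc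
  rw [fredholmKernel]
  refine (abs_add_three _ _ _).trans ?_
  linarith

theorem fredholmKernel_isFredholm (hl : 0 < P.l) (j k : Fin 3) :
    FredholmKernel P.l (dom P.l j) (dom P.l k) (P.fredholmKernel j k) := by
  refine ⟨P.measurable_fredholmKernel j k, fun R => ?_⟩
  obtain ⟨c, hc⟩ := P.exists_abs_fredholmKernel_le hl j k R
  exact ⟨⟨c, fun x hx s hs hxR hsR _ => hc x hx s hs hxR hsR⟩,
    integrableOn_sq_of_log_bound (P.measurable_fredholmKernel j k) (measurableSet_dom _ _)
      (measurableSet_dom _ _) hc⟩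

end Problem

theorem coef_pos {lam mu : ℝ} (hmu : 0 < mu) (hlam : 0 < lam + mu) :
    0 < 2 * mu ^ 2 / (lam + 3 * mu) :=
  div_pos (by positivity) (by linarith)

end InterfaceCrack

end

/-! ### From the boundary conditions to the Fredholm system -/

theorem mainTheorem2 (P : InterfaceCrack.Problem)
    (hl : 0 < P.l)
    (hmu₁ : 0 < P.mu₁) (hlam₁ : 0 < P.lam₁ + P.mu₁)
    (hmu₂ : 0 < P.mu₂) (hlam₂ : 0 < P.lam₂ + P.mu₂)
    (hgp : ∀ x ∈ InterfaceCrack.crack P.l,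
      InterfaceCrack.PVExists (InterfaceCrack.crack P.l) P.gp x)
    (hgm : ∀ x ∈ InterfaceCrack.crack P.l,
      InterfaceCrack.PVExists (InterfaceCrack.crack P.l) P.gm x) :
    -- the Dirichlet-to-Neumann maps turn the boundary conditions into six singular equations
    (∀ φ ψ : Fin 3 → ℝ → ℝ, P.BoundaryConditions φ ψ ↔ P.SingularSystem φ ψ) ∧
    (P.α₁ ≠ P.α₂ →
      -- elimination of the three functions `φ`
      (∀ φ ψ : Fin 3 → ℝ → ℝ, InterfaceCrack.Admissible P.l ψ →
        (P.SingularSystem φ ψ ↔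
          (∀ k, Set.EqOn (φ k) (P.phiOf ψ k) (InterfaceCrack.dom P.l k)) ∧ P.LogSystem ψ)) ∧
      -- the change of unknowns is a bijection between the `ψ` and the pairs `(χ, C)`
      (∀ ψ : Fin 3 → ℝ → ℝ, InterfaceCrack.Admissible P.l ψ →
        InterfaceCrack.AdmissibleDensity P.l (fun k => deriv (deriv (ψ k))) ∧
        ∃! C : Fin 4 → ℝ,
          InterfaceCrack.Represents P.l (fun k => deriv (deriv (ψ k))) C ψ) ∧
      (∀ (χ : Fin 3 → ℝ → ℝ) (C : Fin 4 → ℝ), InterfaceCrack.AdmissibleDensity P.l χ →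
        ∃ ψ : Fin 3 → ℝ → ℝ,
          InterfaceCrack.Admissible P.l ψ ∧ InterfaceCrack.Represents P.l χ C ψ) ∧
      -- it turns the integro-differential system into the Fredholm system
      (∀ (ψ χ : Fin 3 → ℝ → ℝ) (C : Fin 4 → ℝ), InterfaceCrack.Admissible P.l ψ →
        InterfaceCrack.Represents P.l χ C ψ →
        (P.LogSystem ψ ↔
          InterfaceCrack.SolvesFredholm (InterfaceCrack.dom P.l) P.leadCoef P.fredholmKernel
            (P.fredholmRhs C) χ)) ∧
      (∀ j k, InterfaceCrack.FredholmKernel P.l (InterfaceCrack.dom P.l j)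
        (InterfaceCrack.dom P.l k) (P.fredholmKernel j k))) := by
  have h1 : P.α₁ ≠ 0 := (InterfaceCrack.coef_pos hmu₁ hlam₁).ne'
  have h2 : P.α₂ ≠ 0 := (InterfaceCrack.coef_pos hmu₂ hlam₂).ne'
  refine ⟨P.boundaryConditions_iff_singularSystem, fun h12 => ⟨fun φ ψ h =>
    P.singularSystem_iff hl h φ h1 h2 h12 hgp hgm, fun ψ h => ⟨h.admissibleDensity,
    h.existsUnique_represents hl⟩, fun χ C h => h.exists_represents hl C, fun ψ χ C h hr =>
    P.logSystem_iff_solvesFredholm hl h hr, P.fredholmKernel_isFredholm hl⟩⟩
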